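/- **Setting.** Let $\overline M$ be a compact manifold with boundary, $x$ a boundary defining function, and $\phi:\partial M\to B$ a fibration (surjective submersion) onto a manifold $B$; near $\partial M$ use coordinates $(x,y,z)$ for which $\phi$ is $(y,z)\mapsto y$ on $\partial M$. Primes denote the corresponding objects on the second factor of $\overline M\times\overline M$. The low energy double space $M^2_{k,\phi}$ is the manifold with corners with interior $(0,\infty)\times M^\circ\times M^\circ\ni(k,p,p')$ obtained from $[0,\infty)_k\times\overline M\times\overline M$ by blowing up, in this order, $\{k=x=x'=0\}$ (new face $\mathrm{bf}_0$); the lifts of $\{x=x'=0\}$ (face $\mathrm{bf}$), $\{k=x=0\}$ (face $\mathrm{lb}_0$) and $\{k=x'=0\}$ (face $\mathrm{rb}_0$); the fibre diagonal $\{x'/x=1,\ \phi(p)=\phi(p')\}$ in $\mathrm{bf}$ (face $\mathrm{sc}$); and the lift of the fibre diagonal in $\mathrm{bf}_0$ (face $\phi f_0$). The lifts of $\{k=0\}$, $\{x=0\}$, $\{x'=0\}$ are the faces $\mathrm{zf}$, $\mathrm{lb}$, $\mathrm{rb}$. $M^2_{\omega,\phi}$ is the same space with $k$ renamed $\omega$.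 An index set is a set $E\subset\mathbb C\times\mathbb N_0$ such that $\{(\zeta,p)\in E:\operatorname{Re}\zeta\le s\}$ is finite for every $s\in\mathbb R$, and $(\zeta,p)\in E$ implies $(\zeta+1,p)\in E$ and $(\zeta,q)\in E$ for $q\le p$. Given an index set $E_H$ for each boundary hypersurface $H$, a function $u$, smooth in the interior, is polyhomogeneous conormal if, in local coordinates $(\rho_1,\dots,\rho_m,v)$ near each boundary point ($\rho_i\ge0$ defining the hypersurface $H_i$), $u$ is conormal (i.e. for some $w\in\mathbb R^m$ it is $O(\rho^{w})$ together with all its derivatives by the fields $\rho_i\partial_{\rho_i}$, $\partial_v$), and for each $i$ there is an expansion $$u\sim\sum_{(\zeta,p)\in E_{H_i}}a_{\zeta,p}\,\rho_i^{\zeta}(\log\rho_i)^p,$$ where the $a_{\zeta,p}$ do not depend on $\rho_i$ and are (recursively) polyhomogeneous at the other hypersurfaces, and where, for each $N\in\mathbb N_0$, the remainder after the terms with $\operatorname{Re}\zeta\le N$ is conormal of order $N$ in $\rho_i$, with weights in the other $\rho_j$ independent of $N$. **Lemma.** Let $\frac\pi2<\varphi<\pi$, and let $T(k,p,p')$ be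 a complex function, smooth in the interior of $M^2_{k,\phi}$ and polyhomogeneous conormal on $M^2_{k,\phi}$, with some index sets of which those at $\mathrm{lb}$, $\mathrm{rb}$ and $\mathrm{bf}$ are empty, i.e. $T$ vanishes to infinite order there. Assume that $T$ has at most polynomial growth as $k\to\infty$, in the following sense: for large $k$, where $M^2_{k,\phi}$ is the product of a $k$-interval with the $\phi$-double space of $\overline M$ (that is, $\overline M\times\overline M$ with $\{x=x'=0\}$ and then the fibre diagonal in it blown up, giving $\mathrm{bf}$ and $\mathrm{sc}$), the conormal bounds and the expansions above hold locally uniformly on the $\phi$-double space and up to $k=\infty$, with the same index sets, where $1/k$ is treated as one more coordinate $\rho_i$ in the conormal bounds (also in those for remainders and coefficients), but no expansion in it is required. Then for all $\omega>0$ and $p,p'\in M^\circ$ the integral $$\int_\omega^\infty 2k\,e^{(k/\omega)^2e^{i\varphi}}\,T(k,p,p')\,dk$$ converges absolutely, and as a function of $(\omega,p,p')$ it is polyhomogeneous conormal on $M^2_{\omega,\phi}$ ($0\le\omega<\infty$), with some family of index sets. -/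

import Mathlib

open scoped Manifold ContDiff

noncomputable section

namespace PhiGeometry

/-! ## Index sets and polyhomogeneous functions on a corner -/

/-- An index set: a set of exponents `(z, p)`, standing for the terms `ρ ^ z * (log ρ) ^ p`, with
finitely many members in each half plane `Re z ≤ s`, and closed under lowering `p` and under
`z ↦ z + 1`. -/
structure IndexSet where
  carrier : Set (ℂ × ℕ)
  finite_le : ∀ s : ℝ, {t : ℂ × ℕ | t ∈ carrier ∧ t.1.re ≤ s}.Finite
  log_closed : ∀ z : ℂ, ∀ p q : ℕ, (z, p) ∈ carrier → q ≤ p → (z, q) ∈ carrier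
  add_one_closed : ∀ z : ℂ, ∀ p : ℕ, (z, p) ∈ carrier → (z + 1, p) ∈ carrier

/-- The finitely many exponents with `Re z ≤ s`. -/
def IndexSet.upTo (E : IndexSet) (s : ℝ) : Finset (ℂ × ℕ) := (E.finite_le s).toFinset

section Corner

variable {m : ℕ} {V : Type} [NormedAddCommGroup V] [NormedSpace ℝ V] {Face : Type}

/-- The change of variables `ρ i = exp (τ i)` in the corner coordinates. It turns the vector fields
`ρ i ∂/∂(ρ i)` into the coordinate fields `∂/∂(τ i)`. -/
def expMap (q : (Fin m → ℝ) × V) : (Fin m → ℝ) × V := (fun i => Real.exp (q.1 i), q.2)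

/-- `u` is conormal with weight `w` on the part of `O` where all `ρ i` are positive: it is smooth
there, and for each order `j` all derivatives of total order `j` in the fields `ρ i ∂/∂(ρ i)` and
`∂/∂v` are bounded by a constant times `∏ i, (ρ i) ^ (w i)`. -/
def ConormalOn (O : Set ((Fin m → ℝ) × V)) (w : Fin m → ℝ) (u : (Fin m → ℝ) × V → ℂ) : Prop :=
  ContDiffOn ℝ ∞ (u ∘ expMap) (expMap ⁻¹' O) ∧
    ∀ j : ℕ, ∃ C : ℝ, ∀ q : (Fin m → ℝ) × V, expMap q ∈ O →
      ‖iteratedFDeriv ℝ j (u ∘ expMap) q‖ ≤ C * ∏ i, (Real.exp (q.1 i)) ^ (w i)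

/-- `u` is polyhomogeneous at the faces `{ρ i = 0}`, `i ∈ S`, on the open set `O`. It is conormal,
and for each `i ∈ S` labelled by a face `H` it has an expansion
`u ∼ ∑ a (z, p) * (ρ i) ^ z * (log (ρ i)) ^ p` over `(z, p) ∈ E H`, whose coefficients do not depend
on `ρ i` and are polyhomogeneous at the remaining faces of `S`. The remainder after the terms with
`Re z ≤ N` is conormal of order `N` in `ρ i`, with weights in the other `ρ j` not depending on `N`.
At a coordinate with label `none` only the conormal bounds are required. The natural number bounds
the depth of the recursion. -/
def PhgOn (E : Face → IndexSet) (face : Fin m → Option Face) (O : Set ((Fin m → ℝ) × V)) :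
    ℕ → Finset (Fin m) → ((Fin m → ℝ) × V → ℂ) → Prop
  | 0, _, u => ∃ w, ConormalOn O w u
  | n + 1, S, u => (∃ w, ConormalOn O w u) ∧
      ∀ i ∈ S, ∀ H : Face, face i = some H →
        ∃ a : ℂ × ℕ → (Fin m → ℝ) × V → ℂ,
          (∀ t ∈ (E H).carrier,
            (∀ (q : (Fin m → ℝ) × V) (r : ℝ), a t (Function.update q.1 i r, q.2) = a t q) ∧
              PhgOn E face O n (S.erase i) (a t)) ∧
          ∃ w : Fin m → ℝ, ∀ N : ℕ, ConormalOn O (Function.update w i (N : ℝ))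
            (fun q => u q - ∑ t ∈ (E H).upTo N,
              a t q * (q.1 i : ℂ) ^ t.1 * (Real.log (q.1 i) : ℂ) ^ t.2)

end Corner

/-- A coordinate system of a manifold with corners whose interior is part of `X`. The coordinates
are `(ρ, v)` with `ρ i ≥ 0` and `v` in a finite-dimensional space `V`; `dom` is the (relatively
open) range of the coordinates, boundary points included; `{ρ i = 0}` lies in the boundary
hypersurface `face i` (`none`: not one of the named hypersurfaces). `param` is the inverse of the
coordinate map: it sends the points of `dom` with all `ρ i > 0` to points of `X`, and only its
values there matter. -/
structure CornerChart (X : Type*) (Face : Type) where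
  m : ℕ
  V : Type
  [normed : NormedAddCommGroup V]
  [space : NormedSpace ℝ V]
  face : Fin m → Option Face
  dom : Set ((Fin m → ℝ) × V)
  param : (Fin m → ℝ) × V → X

attribute [instance] CornerChart.normed CornerChart.space

open Classical in
/-- `u` is polyhomogeneous near the point of the manifold with corners with coordinates `q`. If all
`ρ i` are positive at `q`, this says that `u` is smooth near `q`. -/
def CornerChart.PhgAt {X : Type*} {Face : Type} (c : CornerChart X Face) (E : Face → IndexSet)
    (u : X → ℂ) (q : (Fin c.m → ℝ) × c.V) : Prop :=
  ∃ ε > 0, PhgOn E c.face (Metric.ball q ε) c.m (Finset.univ.filter fun i => q.1 i = 0)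
    (u ∘ c.param)

/-- `u` is polyhomogeneous with index family `E` on the manifold with corners with the given
atlas. -/
def IsPhg {X : Type*} {Face : Type} (atlas : CornerChart X Face → Prop) (E : Face → IndexSet)
    (u : X → ℂ) : Prop :=
  ∀ c, atlas c → ∀ q ∈ c.dom, c.PhgAt E u q

/-! ## Manifolds with fibred boundary -/

/-- The point `(x, y, z)` of `ℝ × ℝ ^ b × ℝ ^ f`. -/
def coords {b f : ℕ} (x : ℝ) (y : Fin b → ℝ) (z : Fin f → ℝ) :
    EuclideanSpace ℝ (Fin (b + f + 1)) :=
  WithLp.toLp 2 (Fin.cons x (Fin.append y z))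

section Fibred

variable {b f : ℕ} {M B : Type*}
  [TopologicalSpace M] [ChartedSpace (EuclideanHalfSpace (b + f + 1)) M]
  [TopologicalSpace B] [ChartedSpace (EuclideanSpace ℝ (Fin b)) B]

/-- A chart `(x, y, z)` of `M` whose first coordinate is the boundary defining function `x` and in
which, on the boundary, `φ` is the projection `(y, z) ↦ y`, read in a chart `base` of `B`. -/
structure AdaptedChart (x : M → ℝ) (φ : (𝓡∂ (b + f + 1)).boundary M → B) where
  chart : OpenPartialHomeomorph M (EuclideanHalfSpace (b + f + 1))
  chart_mem : chart ∈ IsManifold.maximalAtlas (𝓡∂ (b + f + 1)) ∞ M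
  base : OpenPartialHomeomorph B (EuclideanSpace ℝ (Fin b))
  base_mem : base ∈ IsManifold.maximalAtlas (𝓡 b) ∞ B
  x_eq : ∀ p ∈ chart.source, (chart p).1 0 = x p
  y_eq : ∀ p : (𝓡∂ (b + f + 1)).boundary M, (p : M) ∈ chart.source →
    φ p ∈ base.source ∧ ∀ j : Fin b, (chart p).1 (Fin.succ (Fin.castAdd f j)) = base (φ p) j

variable (b f M B) in
/-- A fibred boundary on `M`: a boundary defining function `x` and a surjective submersion `φ`
(a fibration, the boundary being compact) of the boundary onto `B`, given in suitable coordinates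
around any boundary point by `(y, z) ↦ y`. The fibres have dimension `f`. -/
structure FibredBoundary where
  x : M → ℝ
  x_smooth : ContMDiff (𝓡∂ (b + f + 1)) 𝓘(ℝ, ℝ) ∞ x
  x_nonneg : ∀ p, 0 ≤ x p
  x_eq_zero : ∀ p, x p = 0 ↔ p ∈ (𝓡∂ (b + f + 1)).boundary M
  φ : (𝓡∂ (b + f + 1)).boundary M → B
  φ_surj : Function.Surjective φ
  exists_chart : ∀ p : (𝓡∂ (b + f + 1)).boundary M,
    ∃ e : AdaptedChart x φ, (p : M) ∈ e.chart.source

namespace AdaptedChart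

variable {x : M → ℝ} {φ : (𝓡∂ (b + f + 1)).boundary M → B}

/-- The point of `M` with coordinates `(x, y, z)`. -/
def pt (e : AdaptedChart x φ) (r : ℝ) (y : Fin b → ℝ) (z : Fin f → ℝ) : M :=
  (e.chart.extend (𝓡∂ (b + f + 1))).symm (coords r y z)

/-- `(x, y, z)` are the coordinates of a point of the chart domain. -/
def Valid (e : AdaptedChart x φ) (r : ℝ) (y : Fin b → ℝ) (z : Fin f → ℝ) : Prop :=
  coords r y z ∈ (e.chart.extend (𝓡∂ (b + f + 1))).target

/-- The point of the base with coordinate `y`. -/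
def basePt (e : AdaptedChart x φ) (y : Fin b → ℝ) : B := e.base.symm (WithLp.toLp 2 y)

end AdaptedChart

variable (b f M) in
/-- A chart of `M`, to be used near interior points. -/
structure SmoothChart where
  chart : OpenPartialHomeomorph M (EuclideanHalfSpace (b + f + 1))
  chart_mem : chart ∈ IsManifold.maximalAtlas (𝓡∂ (b + f + 1)) ∞ M

namespace SmoothChart

/-- The point of `M` with the coordinates `v`. -/
def pt (e : SmoothChart b f M) (v : EuclideanSpace ℝ (Fin (b + f + 1))) : M :=
  (e.chart.extend (𝓡∂ (b + f + 1))).symm v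

/-- `v` are the coordinates of an interior point of `M`. -/
def Valid (e : SmoothChart b f M) (v : EuclideanSpace ℝ (Fin (b + f + 1))) : Prop :=
  v ∈ (e.chart.extend (𝓡∂ (b + f + 1))).target ∧ 0 < v 0

end SmoothChart

/-! ## The low energy double space

The interior of the double space consists of the triples `(k, p, p')` with `k > 0` and `p`, `p'` in
the interior of `M`. Starting from `[0, ∞) × M × M`, blow up, in this order,

* `{k = x = x' = 0}` (new face `bf0`), and then the lifts of `{x = x' = 0}` (`bf`), of
  `{k = x = 0}` (`lb0`) and of `{k = x' = 0}` (`rb0`);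
* the fibre diagonal `{x'/x = 1, φ(p) = φ(p')}` in `bf` (`sc`);
* the lift of the fibre diagonal in `bf0` (`phif0`).

The lifts of `{k = 0}`, `{x = 0}` and `{x' = 0}` are `zf`, `lb` and `rb`. The manifold with corners
obtained in this way is given below by its projective coordinates. -/

/-- The boundary hypersurfaces of the low energy double space. -/
inductive Face
  | zf | bf0 | phif0 | lb0 | rb0 | sc | bf | lb | rb

variable {x : M → ℝ} {φ : (𝓡∂ (b + f + 1)).boundary M → B}

/-- Coordinates near points with `p` and `p'` in the interior of `M`. -/
def interiorChart (e e' : SmoothChart b f M) {m : ℕ} (face : Fin m → Option Face)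
    (kf : (Fin m → ℝ) → ℝ) : CornerChart (ℝ × M × M) Face where
  m := m
  V := EuclideanSpace ℝ (Fin (b + f + 1)) × EuclideanSpace ℝ (Fin (b + f + 1))
  face := face
  dom := {q | (∀ i, 0 ≤ q.1 i) ∧ e.Valid q.2.1 ∧ e'.Valid q.2.2}
  param q := (kf q.1, e.pt q.2.1, e'.pt q.2.2)

/-- Coordinates near points with `p` in the boundary and `p'` in the interior of `M`:
`k = kf ρ`, `x = xf ρ`. -/
def leftChart (e : AdaptedChart x φ) (e' : SmoothChart b f M) {m : ℕ}
    (face : Fin m → Option Face) (kf xf : (Fin m → ℝ) → ℝ) :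
    CornerChart (ℝ × M × M) Face where
  m := m
  V := ((Fin b → ℝ) × (Fin f → ℝ)) × EuclideanSpace ℝ (Fin (b + f + 1))
  face := face
  dom := {q | (∀ i, 0 ≤ q.1 i) ∧ e.Valid (xf q.1) q.2.1.1 q.2.1.2 ∧ e'.Valid q.2.2}
  param q := (kf q.1, e.pt (xf q.1) q.2.1.1 q.2.1.2, e'.pt q.2.2)

/-- Coordinates near points with `p` in the interior and `p'` in the boundary of `M`:
`k = kf ρ`, `x' = xf' ρ`. -/
def rightChart (e : SmoothChart b f M) (e' : AdaptedChart x φ) {m : ℕ}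
    (face : Fin m → Option Face) (kf xf' : (Fin m → ℝ) → ℝ) :
    CornerChart (ℝ × M × M) Face where
  m := m
  V := EuclideanSpace ℝ (Fin (b + f + 1)) × ((Fin b → ℝ) × (Fin f → ℝ))
  face := face
  dom := {q | (∀ i, 0 ≤ q.1 i) ∧ e.Valid q.2.1 ∧ e'.Valid (xf' q.1) q.2.2.1 q.2.2.2}
  param q := (kf q.1, e.pt q.2.1, e'.pt (xf' q.1) q.2.2.1 q.2.2.2)

/-- Coordinates near points with `p` and `p'` in the boundary of `M`, away from the fibre diagonal:
`k = kf ρ`, `x = xf ρ`, `x' = xf' ρ`, and `ratio ρ` is `x'/x` or `x/x'`. The points of the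
fibre diagonal (`x = x' = 0`, ratio `1`, same base point) are removed. -/
def cornerChart (e e' : AdaptedChart x φ) {m : ℕ} (face : Fin m → Option Face)
    (kf xf xf' ratio : (Fin m → ℝ) → ℝ) : CornerChart (ℝ × M × M) Face where
  m := m
  V := ((Fin b → ℝ) × (Fin f → ℝ)) × ((Fin b → ℝ) × (Fin f → ℝ))
  face := face
  dom := {q | (∀ i, 0 ≤ q.1 i) ∧
    e.Valid (xf q.1) q.2.1.1 q.2.1.2 ∧ e'.Valid (xf' q.1) q.2.2.1 q.2.2.2 ∧
    ¬ (xf q.1 = 0 ∧ xf' q.1 = 0 ∧ ratio q.1 = 1 ∧ e.basePt q.2.1.1 = e'.basePt q.2.2.1)}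
  param q := (kf q.1, e.pt (xf q.1) q.2.1.1 q.2.1.2, e'.pt (xf' q.1) q.2.2.1 q.2.2.2)

/-- Coordinates near the fibre diagonal, for two adapted charts over the same chart of the base:
`k = kf ρ`, `x = xf ρ` and `(x'/x - 1, y' - y) = wf ρ • dir θ`. The parameters are
`v = (θ, y, z, z')`; the points of `excl` are removed. -/
def diagChart (e e' : AdaptedChart x φ) {m d : ℕ} (face : Fin m → Option Face)
    (kf xf wf : (Fin m → ℝ) → ℝ) (dir : (Fin d → ℝ) → Fin (b + 1) → ℝ)
    (excl : Set ((Fin m → ℝ) × (Fin d → ℝ))) : CornerChart (ℝ × M × M) Face where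
  m := m
  V := (Fin d → ℝ) × (Fin b → ℝ) × (Fin f → ℝ) × (Fin f → ℝ)
  face := face
  dom := {q | (∀ i, 0 ≤ q.1 i) ∧
    0 < 1 + wf q.1 * dir q.2.1 0 ∧
    e.Valid (xf q.1) q.2.2.1 q.2.2.2.1 ∧
    e'.Valid (xf q.1 * (1 + wf q.1 * dir q.2.1 0))
      (q.2.2.1 + wf q.1 • Fin.tail (dir q.2.1)) q.2.2.2.2 ∧
    (q.1, q.2.1) ∉ excl}
  param q := (kf q.1, e.pt (xf q.1) q.2.2.1 q.2.2.2.1,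
    e'.pt (xf q.1 * (1 + wf q.1 * dir q.2.1 0))
      (q.2.2.1 + wf q.1 • Fin.tail (dir q.2.1)) q.2.2.2.2)

/-- The projective directions in `ℝ ^ (b + 1)` with `j`-th component `σ = ±1`. -/
def projDir (j : Fin (b + 1)) (σ : SignType) (θ : Fin b → ℝ) : Fin (b + 1) → ℝ :=
  Fin.insertNth (α := fun _ => ℝ) j (σ : ℝ) θ

open Face in
/-- The projective coordinate systems of the low energy double space of `M`, for `0 ≤ k < ∞`. -/
inductive DoubleAtlas (𝔣 : FibredBoundary b f M B) : CornerChart (ℝ × M × M) Face → Prop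
  /-- `k` -/
  | int (e e' : SmoothChart b f M) :
      DoubleAtlas 𝔣 (interiorChart e e' ![some zf] (fun ρ => ρ 0))
  /-- `x/k, k` -/
  | left₁ (e : AdaptedChart 𝔣.x 𝔣.φ) (e' : SmoothChart b f M) :
      DoubleAtlas 𝔣 (leftChart e e' ![some lb, some lb0] (fun ρ => ρ 1) (fun ρ => ρ 0 * ρ 1))
  /-- `k/x, x` -/
  | left₂ (e : AdaptedChart 𝔣.x 𝔣.φ) (e' : SmoothChart b f M) :
      DoubleAtlas 𝔣 (leftChart e e' ![some zf, some lb0] (fun ρ => ρ 0 * ρ 1) (fun ρ => ρ 1))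
  /-- `x'/k, k` -/
  | right₁ (e : SmoothChart b f M) (e' : AdaptedChart 𝔣.x 𝔣.φ) :
      DoubleAtlas 𝔣 (rightChart e e' ![some rb, some rb0] (fun ρ => ρ 1) (fun ρ => ρ 0 * ρ 1))
  /-- `k/x', x'` -/
  | right₂ (e : SmoothChart b f M) (e' : AdaptedChart 𝔣.x 𝔣.φ) :
      DoubleAtlas 𝔣 (rightChart e e' ![some zf, some rb0] (fun ρ => ρ 0 * ρ 1) (fun ρ => ρ 1))
  /-- `k, x/k, x'/x` -/
  | corner₁ (e e' : AdaptedChart 𝔣.x 𝔣.φ) :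
      DoubleAtlas 𝔣 (cornerChart e e' ![some bf0, some bf, some rb]
        (fun ρ => ρ 0) (fun ρ => ρ 0 * ρ 1) (fun ρ => ρ 0 * ρ 1 * ρ 2) (fun ρ => ρ 2))
  /-- `k, x'/k, x/x'` -/
  | corner₂ (e e' : AdaptedChart 𝔣.x 𝔣.φ) :
      DoubleAtlas 𝔣 (cornerChart e e' ![some bf0, some bf, some lb]
        (fun ρ => ρ 0) (fun ρ => ρ 0 * ρ 1 * ρ 2) (fun ρ => ρ 0 * ρ 1) (fun ρ => ρ 2))
  /-- `x, k/x, x'/k` -/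
  | corner₃ (e e' : AdaptedChart 𝔣.x 𝔣.φ) :
      DoubleAtlas 𝔣 (cornerChart e e' ![some bf0, some rb0, some rb]
        (fun ρ => ρ 0 * ρ 1) (fun ρ => ρ 0) (fun ρ => ρ 0 * ρ 1 * ρ 2) (fun ρ => ρ 1 * ρ 2))
  /-- `x', k/x', x/k` -/
  | corner₄ (e e' : AdaptedChart 𝔣.x 𝔣.φ) :
      DoubleAtlas 𝔣 (cornerChart e e' ![some bf0, some lb0, some lb]
        (fun ρ => ρ 0 * ρ 1) (fun ρ => ρ 0 * ρ 1 * ρ 2) (fun ρ => ρ 0) (fun ρ => ρ 1 * ρ 2))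
  /-- `x, x'/x, k/x'` -/
  | corner₅ (e e' : AdaptedChart 𝔣.x 𝔣.φ) :
      DoubleAtlas 𝔣 (cornerChart e e' ![some bf0, some rb0, some zf]
        (fun ρ => ρ 0 * ρ 1 * ρ 2) (fun ρ => ρ 0) (fun ρ => ρ 0 * ρ 1) (fun ρ => ρ 1))
  /-- `x', x/x', k/x` -/
  | corner₆ (e e' : AdaptedChart 𝔣.x 𝔣.φ) :
      DoubleAtlas 𝔣 (cornerChart e e' ![some bf0, some lb0, some zf]
        (fun ρ => ρ 0 * ρ 1 * ρ 2) (fun ρ => ρ 0 * ρ 1) (fun ρ => ρ 0) (fun ρ => ρ 1))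
  /-- With `w = (x'/x - 1, y' - y)`: coordinates `x/k, k` and `θ = (k/x) w`, without the set
  `{k = 0, θ = 0}`, which is blown up to `phif0`. -/
  | sc₁ (e e' : AdaptedChart 𝔣.x 𝔣.φ) (h : e.base = e'.base) :
      DoubleAtlas 𝔣 (diagChart e e' ![some sc, some bf0]
        (fun ρ => ρ 1) (fun ρ => ρ 0 * ρ 1) (fun ρ => ρ 0)
        (fun θ : Fin (b + 1) → ℝ => θ) {q | q.1 1 = 0 ∧ q.2 = 0})
  /-- `(x/k)/r, r, k` with `r = |w j|`, and `w/r` -/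
  | sc₂ (e e' : AdaptedChart 𝔣.x 𝔣.φ) (h : e.base = e'.base)
      (j : Fin (b + 1)) (σ : SignType) (hσ : σ ≠ 0) :
      DoubleAtlas 𝔣 (diagChart e e' ![some bf, some sc, some bf0]
        (fun ρ => ρ 2) (fun ρ => ρ 0 * ρ 1 * ρ 2) (fun ρ => ρ 1) (projDir j σ) ∅)
  /-- `x/k, k` and `θ = w/x` -/
  | phi₁ (e e' : AdaptedChart 𝔣.x 𝔣.φ) (h : e.base = e'.base) :
      DoubleAtlas 𝔣 (diagChart e e' ![some sc, some phif0]
        (fun ρ => ρ 1) (fun ρ => ρ 0 * ρ 1) (fun ρ => ρ 0 * ρ 1)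
        (fun θ : Fin (b + 1) → ℝ => θ) ∅)
  /-- `k/r, r, x/k` with `r = (k/x) |w j|`, and `(k/x) w/r` -/
  | phi₂ (e e' : AdaptedChart 𝔣.x 𝔣.φ) (h : e.base = e'.base)
      (j : Fin (b + 1)) (σ : SignType) (hσ : σ ≠ 0) :
      DoubleAtlas 𝔣 (diagChart e e' ![some bf0, some phif0, some sc]
        (fun ρ => ρ 0 * ρ 1) (fun ρ => ρ 0 * ρ 1 * ρ 2) (fun ρ => ρ 1 * ρ 2) (projDir j σ) ∅)
  /-- `k/x, x` and `θ = w/x` -/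
  | phi₃ (e e' : AdaptedChart 𝔣.x 𝔣.φ) (h : e.base = e'.base) :
      DoubleAtlas 𝔣 (diagChart e e' ![some zf, some phif0]
        (fun ρ => ρ 0 * ρ 1) (fun ρ => ρ 1) (fun ρ => ρ 1)
        (fun θ : Fin (b + 1) → ℝ => θ) ∅)
  /-- `x/r, r, k/x` with `r = |w j|`, and `w/r` -/
  | phi₄ (e e' : AdaptedChart 𝔣.x 𝔣.φ) (h : e.base = e'.base)
      (j : Fin (b + 1)) (σ : SignType) (hσ : σ ≠ 0) :
      DoubleAtlas 𝔣 (diagChart e e' ![some bf0, some phif0, some zf]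
        (fun ρ => ρ 0 * ρ 1 * ρ 2) (fun ρ => ρ 0 * ρ 1) (fun ρ => ρ 1) (projDir j σ) ∅)

open Face in
/-- Coordinate systems for large `k`. For `k > 0` the low energy double space is the product of
`(0, ∞)` with the `φ`-double space of `M`, that is, `M × M` with `{x = x' = 0}` (`bf`) and then the
fibre diagonal in it (`sc`) blown up; the coordinate systems are those of the latter, together with
the unlabelled coordinate `1/k`, at whose zero set only conormal bounds, that is, polynomial bounds
in `k`, are required. -/
inductive LargeAtlas (𝔣 : FibredBoundary b f M B) : CornerChart (ℝ × M × M) Face → Prop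
  /-- `1/k` -/
  | int (e e' : SmoothChart b f M) :
      LargeAtlas 𝔣 (interiorChart e e' ![none] (fun ρ => (ρ 0)⁻¹))
  /-- `1/k, x` -/
  | left (e : AdaptedChart 𝔣.x 𝔣.φ) (e' : SmoothChart b f M) :
      LargeAtlas 𝔣 (leftChart e e' ![none, some lb] (fun ρ => (ρ 0)⁻¹) (fun ρ => ρ 1))
  /-- `1/k, x'` -/
  | right (e : SmoothChart b f M) (e' : AdaptedChart 𝔣.x 𝔣.φ) :
      LargeAtlas 𝔣 (rightChart e e' ![none, some rb] (fun ρ => (ρ 0)⁻¹) (fun ρ => ρ 1))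
  /-- `1/k, x, x'/x` -/
  | corner₁ (e e' : AdaptedChart 𝔣.x 𝔣.φ) :
      LargeAtlas 𝔣 (cornerChart e e' ![none, some bf, some rb]
        (fun ρ => (ρ 0)⁻¹) (fun ρ => ρ 1) (fun ρ => ρ 1 * ρ 2) (fun ρ => ρ 2))
  /-- `1/k, x', x/x'` -/
  | corner₂ (e e' : AdaptedChart 𝔣.x 𝔣.φ) :
      LargeAtlas 𝔣 (cornerChart e e' ![none, some bf, some lb]
        (fun ρ => (ρ 0)⁻¹) (fun ρ => ρ 1 * ρ 2) (fun ρ => ρ 1) (fun ρ => ρ 2))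
  /-- With `w = (x'/x - 1, y' - y)`: coordinates `1/k, x` and `θ = w/x`. -/
  | sc₁ (e e' : AdaptedChart 𝔣.x 𝔣.φ) (h : e.base = e'.base) :
      LargeAtlas 𝔣 (diagChart e e' ![none, some sc]
        (fun ρ => (ρ 0)⁻¹) (fun ρ => ρ 1) (fun ρ => ρ 1)
        (fun θ : Fin (b + 1) → ℝ => θ) ∅)
  /-- `1/k, x/r, r` with `r = |w j|`, and `w/r` -/
  | sc₂ (e e' : AdaptedChart 𝔣.x 𝔣.φ) (h : e.base = e'.base)
      (j : Fin (b + 1)) (σ : SignType) (hσ : σ ≠ 0) :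
      LargeAtlas 𝔣 (diagChart e e' ![none, some bf, some sc]
        (fun ρ => (ρ 0)⁻¹) (fun ρ => ρ 1 * ρ 2) (fun ρ => ρ 2) (projDir j σ) ∅)

/-- `T` is polyhomogeneous conormal on the low energy double space, with index family `E`. -/
def PhgDouble (𝔣 : FibredBoundary b f M B) (E : Face → IndexSet) (T : ℝ × M × M → ℂ) : Prop :=
  IsPhg (DoubleAtlas 𝔣) E T

/-- `T` has, with its expansions, at most polynomial growth in `k` as `k → ∞`. -/
def TemperedAtInfinity (𝔣 : FibredBoundary b f M B) (E : Face → IndexSet)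
    (T : ℝ × M × M → ℂ) : Prop :=
  IsPhg (LargeAtlas 𝔣) E T

end Fibred

/-- The integrand `2 k exp ((k/s)² e^{iθ}) T(k, p, p')`. -/
def rayIntegrand {M : Type*} (θ : ℝ) (T : ℝ × M × M → ℂ) (s : ℝ) (p p' : M) (k : ℝ) : ℂ :=
  2 * (k : ℂ) * Complex.exp (((k / s) ^ 2 : ℝ) * Complex.exp (θ * Complex.I)) * T (k, p, p')

end PhiGeometry

end

/-! With `k = s * exp t` the integral becomes `s ^ 2` times the integral over `t > 0` of `rayKernel
θ t * T (s * exp t, p, p')`. Since `cos θ < 0`, the kernel decays like `exp (-c * exp (2 * t))`, so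
it beats every `exp (ℓ * t)`: losing any power of `k / s` along the ray is harmless. In logarithmic
coordinates `τ = log ρ`, where the `ρ` are monomials in `k` and in quantities independent of `k`,
passing from `k` to `k * exp t` is a translation and commutes with the fields `ρ ∂/∂ρ = ∂/∂τ`.

Expansions are awkward to integrate, but constant coefficient operators in `τ` are not. A conormal
function is polyhomogeneous if and only if, for each face and each `N`, the product of the `ρ ∂/∂ρ -
z` over the exponents with `Re z ≤ N`, counted with their powers of the logarithm, sends it to a
function of order `N` at that face, with the other weights independent of `N`. One direction
(`PhgOn.aeval_mem`) holds because the operator kills the terms of the expansion. For the converse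
(`phgOn_of_annihilated`), solving ordinary differential equations in one variable recovers an
expansion (`IsHalf.exists_full_expansion`), and uniqueness of expansions together with interpolation
of estimates shows that the coefficients inherit the conditions at the other faces
(`IsHalf.annihilated_coeff`).

These conditions pass under the integral (`rayInt_aeval`), so it remains to estimate them along rays
starting near a boundary point; the rays may cross several charts and reach `k = ∞`. If the ray ends
near the same face, the field belonging to the face is the same in both charts and the defining
function at the end is at most a constant times a power of `k / s` times the one at the start, so
the estimate is carried back. If it ends far from the face, the defining function at the start is
bounded below by a constant times a power of `s / k`, and any order is available at the cost of a
factor `exp (ℓ * t)`. This is `RayEnd.exists_faceEst`; an ultrafilter argument makes the estimates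
uniform (`exists_ball_rayEst`), and `phgNear_rayIntegral` concludes. The factor `s ^ 2` shifts
exponents by natural numbers, under which index sets are stable, so the index family of `T` also
serves for the integral.

All coordinate systems but `sc₁` are monomial, with parameters independent of `k`. They fall into
families of at most three coordinates, where coverage is a comparison of sizes (`Covers`) and the
behaviour of faces is linear algebra (`LogChart.Compat`). The system `sc₁`, whose parameter `(k/x)
w` moves with `k`, is obtained from its neighbours by a change of coordinates (`phgChart_sc₁`). -/

noncomputable section

namespace PhiGeometry

open Set TopologicalSpace Polynomial MeasureTheory

set_option linter.unusedSectionVars false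

/-! ### Smooth functions on an open set and their commuting derivatives -/

section SmoothSpace

variable {E : Type} [NormedAddCommGroup E] [NormedSpace ℝ E]
variable {E' : Type} [NormedAddCommGroup E'] [NormedSpace ℝ E']

/-- Smooth functions on `Ω`, extended by zero. -/
def Sm (Ω : Opens E) : Submodule ℂ (E → ℂ) where
  carrier := {f | ContDiffOn ℝ ∞ f Ω ∧ ∀ x ∉ Ω, f x = 0}
  zero_mem' := ⟨contDiffOn_const, fun _ _ => rfl⟩
  add_mem' := fun hf hg => ⟨hf.1.add hg.1, fun x hx => by simp [hf.2 x hx, hg.2 x hx]⟩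
  smul_mem' := fun c _ hf => ⟨contDiffOn_const.smul hf.1, fun x hx => by simp [hf.2 x hx]⟩

namespace Sm

variable {Ω : Opens E}

instance : CoeFun (Sm Ω) (fun _ => E → ℂ) := ⟨fun f => f.1⟩

/-- The extension by zero fixes the values off `Ω`, so identities between operators on `Ω` become
equalities in `Module.End`, to which polynomial calculus applies. -/
theorem ext' {f g : Sm Ω} (h : ∀ x ∈ Ω, f x = g x) : f = g := by
  apply Subtype.ext
  funext x
  by_cases hx : x ∈ Ω
  · exact h x hx
  · rw [f.2.2 x hx, g.2.2 x hx]

theorem smooth (f : Sm Ω) : ContDiffOn ℝ ∞ f Ω := f.2.1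

theorem smoothAt (f : Sm Ω) {x : E} (hx : x ∈ Ω) : ContDiffAt ℝ ∞ f x :=
  (Sm.smooth f).contDiffAt (Ω.isOpen.mem_nhds hx)

open Classical in
/-- The restriction of a function to `Ω`. -/
def of (Ω : Opens E) (f : E → ℂ) (hf : ContDiffOn ℝ ∞ f Ω) : Sm Ω :=
  ⟨fun x => if x ∈ Ω then f x else 0,
    hf.congr fun _ hx => if_pos hx, fun _ hx => if_neg hx⟩

theorem of_apply {f : E → ℂ} {hf : ContDiffOn ℝ ∞ f Ω} {x : E} (hx : x ∈ Ω) :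
    of Ω f hf x = f x := if_pos hx

theorem of_eventuallyEq {f : E → ℂ} {hf : ContDiffOn ℝ ∞ f Ω} {x : E} (hx : x ∈ Ω) :
    (of Ω f hf : E → ℂ) =ᶠ[nhds x] f :=
  Filter.eventually_of_mem (Ω.isOpen.mem_nhds hx) fun _ hy => of_apply hy

theorem add_apply (f g : Sm Ω) (x : E) : (f + g) x = f x + g x := rfl
theorem sub_apply (f g : Sm Ω) (x : E) : (f - g) x = f x - g x := rfl
theorem smul_apply (c : ℂ) (f : Sm Ω) (x : E) : (c • f) x = c * f x := rfl
theorem zero_apply (x : E) : (0 : Sm Ω) x = 0 := rfl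

theorem sum_apply {ι : Type*} (s : Finset ι) (f : ι → Sm Ω) (x : E) :
    (∑ i ∈ s, f i) x = ∑ i ∈ s, f i x := by
  have : ((∑ i ∈ s, f i : Sm Ω) : E → ℂ) = ∑ i ∈ s, (f i : E → ℂ) := by
    simp
  rw [show (∑ i ∈ s, f i) x = ((∑ i ∈ s, f i : Sm Ω) : E → ℂ) x from rfl, this, Finset.sum_apply]

theorem contDiffOn_fderiv_apply {f : E → ℂ} (hf : ContDiffOn ℝ ∞ f Ω) (d : E) :
    ContDiffOn ℝ ∞ (fun x => fderiv ℝ f x d) Ω :=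
  ((contDiffOn_infty_iff_fderiv_of_isOpen Ω.isOpen).1 hf).2.clm_apply contDiffOn_const

theorem differentiableAt (f : Sm Ω) {x : E} (hx : x ∈ Ω) : DifferentiableAt ℝ f x :=
  ((Sm.smoothAt f) hx).differentiableAt (by simp)

/-- The derivative in the direction `d`. -/
def dirD (Ω : Opens E) (d : E) : Module.End ℂ (Sm Ω) where
  toFun f := of Ω (fun x => fderiv ℝ f x d) (contDiffOn_fderiv_apply (Sm.smooth f) d)
  map_add' f g := ext' fun x hx => by
    rw [add_apply, of_apply hx, of_apply hx, of_apply hx]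
    rw [show (((f + g : Sm Ω) : E → ℂ)) = (f : E → ℂ) + g from rfl,
      fderiv_add ((Sm.differentiableAt f) hx) ((Sm.differentiableAt g) hx)]
    rfl
  map_smul' c f := ext' fun x hx => by
    rw [RingHom.id_apply, smul_apply, of_apply hx, of_apply hx]
    rw [show (((c • f : Sm Ω) : E → ℂ)) = c • (f : E → ℂ) from rfl,
      fderiv_const_smul ((Sm.differentiableAt f) hx)]
    rfl

theorem dirD_apply (d : E) (f : Sm Ω) {x : E} (hx : x ∈ Ω) :
    dirD Ω d f x = fderiv ℝ f x d :=
  of_apply (hf := contDiffOn_fderiv_apply (smooth f) d) hx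

theorem two_le_infty : (2 : ℕ∞ω) ≤ ∞ := by
  exact WithTop.coe_le_coe.2 (le_top : (2 : ℕ∞) ≤ ⊤)

theorem dirD_comm (d d' : E) (f : Sm Ω) : dirD Ω d (dirD Ω d' f) = dirD Ω d' (dirD Ω d f) := by
  have key : ∀ (d d' : E) {x : E} (hx : x ∈ Ω),
      dirD Ω d (dirD Ω d' f) x = fderiv ℝ (fderiv ℝ f) x d d' := by
    intro d d' x hx
    rw [dirD_apply _ _ hx]
    have h1 : (dirD Ω d' f : E → ℂ) =ᶠ[nhds x] fun y => fderiv ℝ f y d' :=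
      of_eventuallyEq (hf := contDiffOn_fderiv_apply (smooth f) d') hx
    have h2 : DifferentiableAt ℝ (fderiv ℝ f) x :=
      (((Sm.smoothAt f) hx).fderiv_right (m := 1) (by simpa [one_add_one_eq_two] using two_le_infty)).differentiableAt (by simp)
    rw [h1.fderiv_eq, fderiv_clm_apply h2 (differentiableAt_const _)]
    simp
  refine ext' fun x hx => ?_
  rw [key d d' hx, key d' d hx]
  exact ((Sm.smoothAt f) hx).isSymmSndFDerivAt (by simpa using two_le_infty) d d'

end Sm

/-- A polynomial identity for one endomorphism passes to another along an intertwining map defined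
on an invariant submodule. -/
theorem aeval_intertwine {A B : Type*} [AddCommGroup A] [Module ℂ A] [AddCommGroup B] [Module ℂ B]
    (K : Submodule ℂ A) {DA : Module.End ℂ A} {DB : Module.End ℂ B} (hK : ∀ a ∈ K, DA a ∈ K)
    (φ : A → B) (hadd : ∀ a ∈ K, ∀ b ∈ K, φ (a + b) = φ a + φ b)
    (hsmul : ∀ c : ℂ, ∀ a ∈ K, φ (c • a) = c • φ a) (hD : ∀ a ∈ K, φ (DA a) = DB (φ a))
    (P : ℂ[X]) : ∀ a ∈ K, aeval DA P a ∈ K ∧ φ (aeval DA P a) = aeval DB P (φ a) := by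
  induction P using Polynomial.induction_on' with
  | add p q hp hq =>
    intro a ha
    have h1 := hp a ha
    have h2 := hq a ha
    simp only [map_add, LinearMap.add_apply]
    exact ⟨K.add_mem h1.1 h2.1, by rw [hadd _ h1.1 _ h2.1, h1.2, h2.2]⟩
  | monomial n c =>
    have hpow : ∀ n : ℕ, ∀ a ∈ K, (DA ^ n) a ∈ K ∧ φ ((DA ^ n) a) = (DB ^ n) (φ a) := by
      intro n
      induction n with
      | zero => intro a ha; simpa using ha
      | succ n ih =>
        intro a ha
        rw [pow_succ', pow_succ', Module.End.mul_apply, Module.End.mul_apply]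
        have h := ih a ha
        exact ⟨hK _ h.1, by rw [hD _ h.1, h.2]⟩
    intro a ha
    have h := hpow n a ha
    simp only [aeval_monomial, Module.algebraMap_end_eq_smul_id, Module.End.mul_apply,
      LinearMap.smul_apply, LinearMap.id_apply]
    exact ⟨K.smul_mem _ h.1, by rw [hsmul _ _ h.1, h.2]⟩

theorem aeval_mem {A : Type*} [AddCommGroup A] [Module ℂ A]
    (K : Submodule ℂ A) {DA : Module.End ℂ A} (hK : ∀ a ∈ K, DA a ∈ K) (P : ℂ[X]) {a : A}
    (ha : a ∈ K) : aeval DA P a ∈ K :=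
  (aeval_intertwine K hK (DB := DA) id (fun _ _ _ _ => rfl) (fun _ _ _ => rfl)
    (fun _ _ => rfl) P a ha).1

theorem aeval_linear {A B : Type*} [AddCommGroup A] [Module ℂ A] [AddCommGroup B] [Module ℂ B]
    {DA : Module.End ℂ A} {DB : Module.End ℂ B} (φ : A →ₗ[ℂ] B) (hD : ∀ a, φ (DA a) = DB (φ a))
    (P : ℂ[X]) (a : A) : φ (aeval DA P a) = aeval DB P (φ a) :=
  (aeval_intertwine ⊤ (fun _ _ => trivial) φ (fun a _ b _ => map_add φ a b)
    (fun c a _ => map_smul φ c a) (fun a _ => hD a) P a trivial).2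

/-! ### Symbol estimates -/

variable {Ω : Opens E} {Ω' : Opens E'}

/-- Functions all of whose derivatives are `O(exp w)`. -/
def Sym (Ω : Opens E) (w : E → ℝ) : Submodule ℂ (Sm Ω) where
  carrier := {f | ∀ j : ℕ, ∃ C : ℝ, ∀ x ∈ Ω, ‖iteratedFDeriv ℝ j f x‖ ≤ C * Real.exp (w x)}
  zero_mem' := fun j => ⟨0, fun x _ => by
    have : (((0 : Sm Ω) : E → ℂ)) = fun _ => 0 := rfl
    rw [this]
    simp⟩
  add_mem' := fun {f g} hf hg j => by
    obtain ⟨C, hC⟩ := hf j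
    obtain ⟨C', hC'⟩ := hg j
    refine ⟨C + C', fun x hx => ?_⟩
    rw [show (((f + g : Sm Ω) : E → ℂ)) = (f : E → ℂ) + g from rfl,
      iteratedFDeriv_add_apply (((Sm.smoothAt f) hx).of_le (by exact_mod_cast le_top))
        (((Sm.smoothAt g) hx).of_le (by exact_mod_cast le_top)), add_mul]
    exact (norm_add_le _ _).trans (add_le_add (hC x hx) (hC' x hx))
  smul_mem' := fun c f hf j => by
    obtain ⟨C, hC⟩ := hf j
    refine ⟨‖c‖ * C, fun x hx => ?_⟩
    rw [show (((c • f : Sm Ω) : E → ℂ)) = c • (f : E → ℂ) from rfl,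
      iteratedFDeriv_const_smul_apply (((Sm.smoothAt f) hx).of_le (by exact_mod_cast le_top)),
      norm_smul, mul_assoc]
    exact mul_le_mul_of_nonneg_left (hC x hx) (norm_nonneg _)

theorem Sm.norm_iteratedFDeriv_dirD_le (d : E) (f : Sm Ω) (j : ℕ) {x : E} (hx : x ∈ Ω) :
    ‖iteratedFDeriv ℝ j (Sm.dirD Ω d f) x‖ ≤ ‖d‖ * ‖iteratedFDeriv ℝ (j + 1) f x‖ := by
  have h1 : (Sm.dirD Ω d f : E → ℂ) =ᶠ[nhds x] fun y => fderiv ℝ f y d :=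
    Sm.of_eventuallyEq (hf := Sm.contDiffOn_fderiv_apply (Sm.smooth f) d) hx
  rw [(h1.iteratedFDeriv ℝ j).eq_of_nhds, ← norm_iteratedFDeriv_fderiv]
  exact norm_iteratedFDeriv_clm_apply_const (N := (j : ℕ∞ω))
    (((Sm.smoothAt f) hx).fderiv_right (by exact_mod_cast le_top)) le_rfl

theorem dirD_mem_Sym {w : E → ℝ} (d : E) : ∀ f ∈ Sym Ω w, Sm.dirD Ω d f ∈ Sym Ω w := by
  intro f hf j
  obtain ⟨C, hC⟩ := hf (j + 1)
  refine ⟨‖d‖ * C, fun x hx => (Sm.norm_iteratedFDeriv_dirD_le d f j hx).trans ?_⟩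
  rw [mul_assoc]
  exact mul_le_mul_of_nonneg_left (hC x hx) (norm_nonneg _)

theorem aeval_mem_Sym {w : E → ℝ} (d : E) (P : ℂ[X]) {f : Sm Ω} (hf : f ∈ Sym Ω w) :
    aeval (Sm.dirD Ω d) P f ∈ Sym Ω w :=
  aeval_mem _ (dirD_mem_Sym d) P hf

theorem Sym_mono {w w' : E → ℝ} {c : ℝ} (h : ∀ x ∈ Ω, w x ≤ w' x + c) : Sym Ω w ≤ Sym Ω w' := by
  intro f hf j
  obtain ⟨C, hC⟩ := hf j
  refine ⟨|C| * Real.exp c, fun x hx => (hC x hx).trans ?_⟩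
  rw [mul_assoc, ← Real.exp_add]
  exact mul_le_mul (le_abs_self C) (Real.exp_le_exp.2 (by linarith [h x hx]))
    (Real.exp_pos _).le (abs_nonneg _)

/-- The smaller of two weights lies below their mean. This interpolation turns decay at one face and
decay at another into simultaneous decay at both, with half the orders. -/
theorem Sym_average {w w' : E → ℝ} {f : Sm Ω} (h : f ∈ Sym Ω w) (h' : f ∈ Sym Ω w') :
    f ∈ Sym Ω (fun x => (w x + w' x) / 2) := by
  intro j
  obtain ⟨C, hC⟩ := h j
  obtain ⟨C', hC'⟩ := h' j
  refine ⟨max |C| |C'|, fun x hx => ?_⟩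
  rcases le_total (w x) (w' x) with hw | hw
  · refine (hC x hx).trans (mul_le_mul ((le_abs_self C).trans (le_max_left _ _))
      (Real.exp_le_exp.2 (by linarith)) (Real.exp_pos _).le ((abs_nonneg C).trans (le_max_left _ _)))
  · refine (hC' x hx).trans (mul_le_mul ((le_abs_self C').trans (le_max_right _ _))
      (Real.exp_le_exp.2 (by linarith)) (Real.exp_pos _).le ((abs_nonneg C).trans (le_max_left _ _)))

/-- Multiplication by a smooth function. -/
def mulSm (Ω : Opens E) (φ : E → ℂ) (hφ : ContDiffOn ℝ ∞ φ Ω) : Module.End ℂ (Sm Ω) where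
  toFun f := ⟨fun x => φ x * f x, hφ.mul (Sm.smooth f), fun x hx => by
    show φ x * f x = 0
    rw [f.2.2 x hx, mul_zero]⟩
  map_add' f g := Subtype.ext (funext fun x => mul_add _ _ _)
  map_smul' c f := Subtype.ext (funext fun x => mul_left_comm _ _ _)

theorem mulSm_apply (φ : E → ℂ) (hφ : ContDiffOn ℝ ∞ φ Ω) (f : Sm Ω) (x : E) :
    mulSm Ω φ hφ f x = φ x * f x := rfl

theorem mulSm_mem_Sym {w w' : E → ℝ} {φ : E → ℂ} {hφ : ContDiffOn ℝ ∞ φ Ω}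
    (h : Sm.of Ω φ hφ ∈ Sym Ω w) {f : Sm Ω} (hf : f ∈ Sym Ω w') :
    mulSm Ω φ hφ f ∈ Sym Ω (fun x => w x + w' x) := by
  intro j
  choose C hC using h
  choose C' hC' using hf
  refine ⟨∑ i ∈ Finset.range (j + 1), (j.choose i : ℝ) * |C i| * |C' (j - i)|, fun x hx => ?_⟩
  have h0 : (mulSm Ω φ hφ f : E → ℂ) =ᶠ[nhds x] fun y => Sm.of Ω φ hφ y * f y :=
    Filter.eventually_of_mem (Ω.isOpen.mem_nhds hx) fun y hy => by
      show φ y * f y = Sm.of Ω φ hφ y * f y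
      rw [Sm.of_apply hy]
  rw [(h0.iteratedFDeriv ℝ j).eq_of_nhds]
  have h1 := norm_iteratedFDerivWithin_mul_le (n := j) (N := ∞) (Sm.smooth (Sm.of Ω φ hφ)) (Sm.smooth f)
    Ω.isOpen.uniqueDiffOn hx (by exact_mod_cast le_top)
  simp only [iteratedFDerivWithin_of_isOpen _ Ω.isOpen hx] at h1
  refine h1.trans ?_
  rw [Finset.sum_mul]
  refine Finset.sum_le_sum fun i _ => ?_
  have e1 : ‖iteratedFDeriv ℝ i (Sm.of Ω φ hφ) x‖ ≤ |C i| * Real.exp (w x) :=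
    (hC i x hx).trans (mul_le_mul_of_nonneg_right (le_abs_self _) (Real.exp_pos _).le)
  have e2 : ‖iteratedFDeriv ℝ (j - i) f x‖ ≤ |C' (j - i)| * Real.exp (w' x) :=
    (hC' _ x hx).trans (mul_le_mul_of_nonneg_right (le_abs_self _) (Real.exp_pos _).le)
  calc _ ≤ (j.choose i : ℝ) * (|C i| * Real.exp (w x)) * (|C' (j - i)| * Real.exp (w' x)) := by
        gcongr
    _ = _ := by rw [Real.exp_add]; ring

/-- The exponential of a linear function is a symbol. -/
theorem norm_iteratedFDeriv_cexp_le (ℓ : E →L[ℝ] ℂ) (j : ℕ) (x : E) :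
    ‖iteratedFDeriv ℝ j (fun y => Complex.exp (ℓ y)) x‖ ≤ ‖ℓ‖ ^ j * Real.exp (ℓ x).re := by
  have hs : ContDiff ℝ ∞ fun y => Complex.exp (ℓ y) := Complex.contDiff_exp.comp ℓ.contDiff
  induction j with
  | zero => simp [Complex.norm_exp]
  | succ j ih =>
    rw [← norm_iteratedFDeriv_fderiv]
    have h1 : fderiv ℝ (fun y => Complex.exp (ℓ y)) =
        (ContinuousLinearMap.lsmul ℝ ℂ).flip ℓ ∘ fun y => Complex.exp (ℓ y) := by
      funext y
      rw [(ℓ.hasFDerivAt (x := y)).cexp.fderiv]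
      ext v
      simp
    rw [h1]
    refine (ContinuousLinearMap.norm_iteratedFDeriv_comp_left (N := ∞) _ hs.contDiffAt
      (by exact_mod_cast le_top)).trans ?_
    have h2 : ‖(ContinuousLinearMap.lsmul ℝ ℂ).flip ℓ‖ ≤ ‖ℓ‖ := by
      refine ContinuousLinearMap.opNorm_le_bound _ (norm_nonneg _) fun c => ?_
      simp [norm_smul, mul_comm]
    calc _ ≤ ‖ℓ‖ * (‖ℓ‖ ^ j * Real.exp (ℓ x).re) := by gcongr
      _ = _ := by ring

theorem contDiff_cexp_clm (ℓ : E →L[ℝ] ℂ) : ContDiff ℝ ∞ fun y => Complex.exp (ℓ y) :=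
  Complex.contDiff_exp.comp ℓ.contDiff

/-- Multiplication by `exp ∘ ℓ`. -/
def expMul (Ω : Opens E) (ℓ : E →L[ℝ] ℂ) : Module.End ℂ (Sm Ω) :=
  mulSm Ω (fun y => Complex.exp (ℓ y)) (contDiff_cexp_clm ℓ).contDiffOn

theorem expMul_apply (ℓ : E →L[ℝ] ℂ) (f : Sm Ω) (x : E) :
    expMul Ω ℓ f x = Complex.exp (ℓ x) * f x := rfl

theorem expMul_mem_Sym {w : E → ℝ} (ℓ : E →L[ℝ] ℂ) {f : Sm Ω} (hf : f ∈ Sym Ω w) :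
    expMul Ω ℓ f ∈ Sym Ω (fun x => (ℓ x).re + w x) := by
  refine mulSm_mem_Sym (w := fun x => (ℓ x).re) (fun j => ⟨‖ℓ‖ ^ j, fun x hx => ?_⟩) hf
  rw [((Sm.of_eventuallyEq hx).iteratedFDeriv ℝ j).eq_of_nhds]
  exact norm_iteratedFDeriv_cexp_le ℓ j x

theorem dirD_mulSm (d : E) (φ : E → ℂ) (hφ : ContDiff ℝ ∞ φ) (f : Sm Ω) {x : E} (hx : x ∈ Ω) :
    Sm.dirD Ω d (mulSm Ω φ hφ.contDiffOn f) x = fderiv ℝ φ x d * f x + φ x * Sm.dirD Ω d f x := by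
  rw [Sm.dirD_apply _ _ hx, Sm.dirD_apply _ _ hx]
  have h1 : (mulSm Ω φ hφ.contDiffOn f : E → ℂ) = φ * (f : E → ℂ) := rfl
  rw [h1, fderiv_mul (hφ.differentiable (by simp)).differentiableAt ((Sm.differentiableAt f) hx)]
  simp
  ring

/-- Conjugation by an exponential shifts a derivative by a constant. This is how a factor `D - z` is
reduced to `D` throughout. -/
theorem dirD_expMul (d : E) (ℓ : E →L[ℝ] ℂ) (f : Sm Ω) :
    Sm.dirD Ω d (expMul Ω ℓ f) = expMul Ω ℓ (Sm.dirD Ω d f + ℓ d • f) := by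
  refine Sm.ext' fun x hx => ?_
  rw [expMul, dirD_mulSm d _ (contDiff_cexp_clm ℓ) f hx, mulSm_apply, Sm.add_apply, Sm.smul_apply]
  have h2 : fderiv ℝ (fun y => Complex.exp (ℓ y)) x = Complex.exp (ℓ x) • ℓ :=
    (ℓ.hasFDerivAt (x := x)).cexp.fderiv
  rw [h2]
  simp
  ring

/-! ### Pullbacks -/

/-- Composition with a smooth map. -/
def pull (Ψ : E' → E) (hΨ : ContDiffOn ℝ ∞ Ψ Ω') (hm : ∀ x ∈ Ω', Ψ x ∈ Ω) : Sm Ω →ₗ[ℂ] Sm Ω' where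
  toFun f := Sm.of Ω' (fun x => f (Ψ x)) ((Sm.smooth f).comp hΨ hm)
  map_add' f g := Sm.ext' fun x hx => by
    rw [Sm.add_apply, Sm.of_apply hx, Sm.of_apply hx, Sm.of_apply hx, Sm.add_apply]
  map_smul' c f := Sm.ext' fun x hx => by
    rw [RingHom.id_apply, Sm.smul_apply, Sm.of_apply hx, Sm.of_apply hx, Sm.smul_apply]

theorem pull_apply {Ψ : E' → E} {hΨ : ContDiffOn ℝ ∞ Ψ Ω'} {hm : ∀ x ∈ Ω', Ψ x ∈ Ω} (f : Sm Ω)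
    {x : E'} (hx : x ∈ Ω') : pull Ψ hΨ hm f x = f (Ψ x) :=
  Sm.of_apply (hf := (Sm.smooth f).comp hΨ hm) hx

theorem pull_dirD {Ψ : E' → E} {hΨ : ContDiffOn ℝ ∞ Ψ Ω'} {hm : ∀ x ∈ Ω', Ψ x ∈ Ω} {d : E}
    {d' : E'} (hd : ∀ x ∈ Ω', fderiv ℝ Ψ x d' = d) (f : Sm Ω) :
    pull Ψ hΨ hm (Sm.dirD Ω d f) = Sm.dirD Ω' d' (pull Ψ hΨ hm f) := by
  refine Sm.ext' fun x hx => ?_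
  rw [pull_apply _ hx, Sm.dirD_apply _ _ (hm x hx), Sm.dirD_apply _ _ hx]
  have h1 : (pull Ψ hΨ hm f : E' → ℂ) =ᶠ[nhds x] (f : E → ℂ) ∘ Ψ :=
    Sm.of_eventuallyEq (hf := (Sm.smooth f).comp hΨ hm) hx
  have h2 : DifferentiableAt ℝ Ψ x :=
    (hΨ.contDiffAt (Ω'.isOpen.mem_nhds hx)).differentiableAt (by simp)
  rw [h1.fderiv_eq, fderiv_comp x ((Sm.differentiableAt f) (hm x hx)) h2]
  simp [hd x hx]

theorem pull_aeval {Ψ : E' → E} {hΨ : ContDiffOn ℝ ∞ Ψ Ω'} {hm : ∀ x ∈ Ω', Ψ x ∈ Ω} {d : E}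
    {d' : E'} (hd : ∀ x ∈ Ω', fderiv ℝ Ψ x d' = d) (P : ℂ[X]) (f : Sm Ω) :
    pull Ψ hΨ hm (aeval (Sm.dirD Ω d) P f) = aeval (Sm.dirD Ω' d') P (pull Ψ hΨ hm f) :=
  aeval_linear _ (fun f => pull_dirD hd f) P f

/-- A pointwise form of the estimates for compositions. -/
theorem norm_iteratedFDeriv_pull_le {Ψ : E' → E} {hΨ : ContDiffOn ℝ ∞ Ψ Ω'}
    {hm : ∀ x ∈ Ω', Ψ x ∈ Ω}
    (hb : ∀ j : ℕ, 1 ≤ j → ∃ C : ℝ, ∀ x ∈ Ω', ‖iteratedFDeriv ℝ j Ψ x‖ ≤ C) (j : ℕ) :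
    ∃ A : ℝ, 0 ≤ A ∧ ∀ (f : Sm Ω), ∀ x ∈ Ω', ∀ B : ℝ,
      (∀ i ≤ j, ‖iteratedFDeriv ℝ i f (Ψ x)‖ ≤ B) →
      ‖iteratedFDeriv ℝ j (pull Ψ hΨ hm f) x‖ ≤ A * B := by
  choose! C hC using hb
  -- The estimate for compositions asks for a bound `D ^ i` on the `i`-th derivative; any `D ≥ 1`
  -- above all the constants will do.
  set D : ℝ := 1 + ∑ i ∈ Finset.range (j + 1), |C i| with hD
  have hD1 : 1 ≤ D := by
    have : 0 ≤ ∑ i ∈ Finset.range (j + 1), |C i| := Finset.sum_nonneg fun _ _ => abs_nonneg _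
    linarith
  refine ⟨(j.factorial : ℝ) * D ^ j, by positivity, fun f x hx B hB => ?_⟩
  have h1 : (pull Ψ hΨ hm f : E' → ℂ) =ᶠ[nhds x] (f : E → ℂ) ∘ Ψ :=
    Sm.of_eventuallyEq (hf := (Sm.smooth f).comp hΨ hm) hx
  rw [(h1.iteratedFDeriv ℝ j).eq_of_nhds, ← iteratedFDerivWithin_of_isOpen j Ω'.isOpen hx]
  have h2 := norm_iteratedFDerivWithin_comp_le (n := j) (N := ∞) (C := B) (D := D)
    (Sm.smooth f) hΨ (by exact_mod_cast le_top) Ω.isOpen.uniqueDiffOn Ω'.isOpen.uniqueDiffOn hm hx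
    (fun i hi => by rw [iteratedFDerivWithin_of_isOpen i Ω.isOpen (hm x hx)]; exact hB i hi)
    (fun i hi hij => by
      rw [iteratedFDerivWithin_of_isOpen i Ω'.isOpen hx]
      refine (hC i hi x hx).trans ?_
      have : |C i| ≤ ∑ i ∈ Finset.range (j + 1), |C i| :=
        Finset.single_le_sum (f := fun i => |C i|) (fun _ _ => abs_nonneg _)
          (Finset.mem_range.2 (by omega))
      calc C i ≤ D := by linarith [le_abs_self (C i)]
        _ ≤ D ^ i := le_self_pow₀ hD1 (by omega))
  linarith

theorem pull_mem_Sym {Ψ : E' → E} {hΨ : ContDiffOn ℝ ∞ Ψ Ω'} {hm : ∀ x ∈ Ω', Ψ x ∈ Ω}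
    (hb : ∀ j : ℕ, 1 ≤ j → ∃ C : ℝ, ∀ x ∈ Ω', ‖iteratedFDeriv ℝ j Ψ x‖ ≤ C)
    {w : E → ℝ} {f : Sm Ω} (hf : f ∈ Sym Ω w) :
    pull Ψ hΨ hm f ∈ Sym Ω' (fun x => w (Ψ x)) := by
  intro j
  obtain ⟨A, hA, h⟩ := norm_iteratedFDeriv_pull_le (hΨ := hΨ) (hm := hm) hb j
  choose C hC using hf
  refine ⟨A * ∑ i ∈ Finset.range (j + 1), |C i|, fun x hx => ?_⟩
  rw [mul_assoc]
  refine h f x hx _ fun i hi => (hC i _ (hm x hx)).trans ?_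
  have : |C i| ≤ ∑ i ∈ Finset.range (j + 1), |C i| :=
    Finset.single_le_sum (f := fun i => |C i|) (fun _ _ => abs_nonneg _)
      (Finset.mem_range.2 (by omega))
  gcongr
  exact (le_abs_self _).trans this

theorem bounded_iteratedFDeriv_clm (L : E' →L[ℝ] E) (j : ℕ) (hj : 1 ≤ j) :
    ∃ C : ℝ, ∀ x, ‖iteratedFDeriv ℝ j L x‖ ≤ C := by
  obtain ⟨n, rfl⟩ : ∃ n, j = n + 1 := ⟨j - 1, by omega⟩
  have h : fderiv ℝ L = fun _ => L := by
    funext x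
    exact L.fderiv
  refine ⟨‖L‖, fun x => ?_⟩
  rw [← norm_iteratedFDeriv_fderiv, h]
  rcases n with _ | n
  · simp
  · rw [iteratedFDeriv_const_of_ne (by omega)]
    simp

end SmoothSpace

/-! ### Differentiation under integrals along rays -/

section RayIntegral

variable {E : Type} [NormedAddCommGroup E] [NormedSpace ℝ E]

/-- Bounds allowing differentiation under the integral `∫ k t • g (x + t • α)` over `t > 0`. -/
structure RayBound (Ω' Ω : Opens E) (α : E) (k : ℝ → ℂ) (w : E → ℝ) {F : Type}
    [NormedAddCommGroup F] [NormedSpace ℝ F] (g : E → F) (β : ℕ → ℝ → ℝ) : Prop where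
  smooth : ContDiffOn ℝ ∞ g Ω'
  integrable : ∀ j, IntegrableOn (fun t => ‖k t‖ * β j t) (Ioi 0)
  bound : ∀ j, ∀ x ∈ Ω, ∀ t : ℝ, 0 < t →
    ‖iteratedFDeriv ℝ j g (x + t • α)‖ ≤ Real.exp (w x) * β j t

variable {Ω' Ω : Opens E} {α : E} {k : ℝ → ℂ} {w : E → ℝ} {β : ℕ → ℝ → ℝ}
  {F : Type} [NormedAddCommGroup F] [NormedSpace ℝ F] {g : E → F}

theorem RayBound.fderiv (h : RayBound Ω' Ω α k w g β) :
    RayBound Ω' Ω α k w (fderiv ℝ g) (fun j => β (j + 1)) where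
  smooth := ((contDiffOn_infty_iff_fderiv_of_isOpen Ω'.isOpen).1 h.smooth).2
  integrable j := h.integrable (j + 1)
  bound j x hx t ht := by
    rw [norm_iteratedFDeriv_fderiv]
    exact h.bound (j + 1) x hx t ht

theorem RayBound.norm_le [NormedSpace ℂ F] (h : RayBound Ω' Ω α k w g β) {x : E} (hx : x ∈ Ω)
    {t : ℝ} (ht : 0 < t) :
    ‖k t • g (x + t • α)‖ ≤ Real.exp (w x) * (‖k t‖ * β 0 t) := by
  have := h.bound 0 x hx t ht
  rw [norm_iteratedFDeriv_zero] at this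
  rw [norm_smul]
  calc _ ≤ ‖k t‖ * (Real.exp (w x) * β 0 t) := by gcongr
    _ = _ := by ring

theorem RayBound.aestronglyMeasurable [NormedSpace ℂ F]
    (hα : ∀ x ∈ Ω, ∀ t : ℝ, 0 < t → x + t • α ∈ Ω') (hk : ContinuousOn k (Ioi 0))
    (h : RayBound Ω' Ω α k w g β) {x : E} (hx : x ∈ Ω) :
    AEStronglyMeasurable (fun t => k t • g (x + t • α)) (volume.restrict (Ioi 0)) := by
  refine ContinuousOn.aestronglyMeasurable ?_ measurableSet_Ioi
  refine hk.smul (h.smooth.continuousOn.comp (by fun_prop) fun t ht => hα x hx t ht)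

theorem RayBound.integrableOn [NormedSpace ℂ F]
    (hα : ∀ x ∈ Ω, ∀ t : ℝ, 0 < t → x + t • α ∈ Ω') (hk : ContinuousOn k (Ioi 0))
    (h : RayBound Ω' Ω α k w g β) {x : E} (hx : x ∈ Ω) :
    IntegrableOn (fun t => k t • g (x + t • α)) (Ioi 0) := by
  refine Integrable.mono' ((h.integrable 0).const_mul (Real.exp (w x)))
    (h.aestronglyMeasurable hα hk hx) ?_
  filter_upwards [ae_restrict_mem measurableSet_Ioi] with t ht
  exact h.norm_le hx ht

theorem RayBound.hasFDerivAt [NormedSpace ℂ F] [SMulCommClass ℝ ℂ F]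
    (hα : ∀ x ∈ Ω, ∀ t : ℝ, 0 < t → x + t • α ∈ Ω') (hk : ContinuousOn k (Ioi 0))
    (hw : ContinuousOn w Ω) (h : RayBound Ω' Ω α k w g β) {x : E} (hx : x ∈ Ω) :
    HasFDerivAt (fun x => ∫ t in Ioi (0 : ℝ), k t • g (x + t • α))
      (∫ t in Ioi (0 : ℝ), k t • _root_.fderiv ℝ g (x + t • α)) x := by
  have hΩ : (Ω : Set E) ∈ nhds x := Ω.isOpen.mem_nhds hx
  -- On this neighbourhood the weight exceeds `w x` by less than one, so a single integrable
  -- majorant serves all nearby points.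
  have hs : {y | y ∈ Ω ∧ w y < w x + 1} ∈ nhds x := by
    have h1 : ContinuousAt w x := hw.continuousAt hΩ
    have h2 : ContinuousAt (fun _ : E => w x + 1) x := continuousAt_const
    exact Filter.inter_mem hΩ (h1.eventually_lt h2 (by simp))
  refine hasFDerivAt_integral_of_dominated_of_fderiv_le (𝕜 := ℝ) (E := F) (H := E)
    (F := fun x t => k t • g (x + t • α)) (F' := fun x t => k t • _root_.fderiv ℝ g (x + t • α)) hs
    (bound := fun t => Real.exp (w x + 1) * (‖k t‖ * β 1 t)) ?_ ?_ ?_ ?_ ?_ ?_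
  · filter_upwards [hΩ] with y hy
    exact h.aestronglyMeasurable hα hk hy
  · exact h.integrableOn hα hk hx
  · exact h.fderiv.aestronglyMeasurable hα hk hx
  · filter_upwards [ae_restrict_mem measurableSet_Ioi] with t ht y hy
    have h1 := h.fderiv.bound 0 y hy.1 t ht
    rw [norm_iteratedFDeriv_zero] at h1
    have h2 : 0 ≤ β 1 t := by
      have := (norm_nonneg _).trans h1
      exact nonneg_of_mul_nonneg_right this (Real.exp_pos _)
    rw [norm_smul]
    calc _ ≤ ‖k t‖ * (Real.exp (w x + 1) * β 1 t) := by
          gcongr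
          refine h1.trans ?_
          gcongr
          exact hy.2.le
      _ = _ := by ring
  · exact (h.integrable 1).const_mul _
  · filter_upwards [ae_restrict_mem measurableSet_Ioi] with t ht y hy
    have h1 : HasFDerivAt g (_root_.fderiv ℝ g (y + t • α)) (y + t • α) :=
      ((h.smooth.contDiffAt (Ω'.isOpen.mem_nhds (hα y hy.1 t ht))).differentiableAt
        (by simp)).hasFDerivAt
    have h2 : HasFDerivAt (fun y => g (y + t • α)) (_root_.fderiv ℝ g (y + t • α)) y := by
      have := h1.comp y ((hasFDerivAt_id y).add_const (t • α))
      rwa [ContinuousLinearMap.comp_id] at this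
    exact h2.const_smul (k t)

/-- The target space is quantified inside the induction on the order, because the step applies the
hypothesis to `fderiv ℝ g`, which takes values in another space. -/
theorem RayBound.contDiffOn_nat (hα : ∀ x ∈ Ω, ∀ t : ℝ, 0 < t → x + t • α ∈ Ω')
    (hk : ContinuousOn k (Ioi 0)) (hw : ContinuousOn w Ω) (n : ℕ) :
    ∀ {F : Type} [NormedAddCommGroup F] [NormedSpace ℝ F] [NormedSpace ℂ F] [SMulCommClass ℝ ℂ F]
      {g : E → F} {β : ℕ → ℝ → ℝ}, RayBound Ω' Ω α k w g β →
      ContDiffOn ℝ n (fun x => ∫ t in Ioi (0 : ℝ), k t • g (x + t • α)) Ω ∧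
      ∀ x ∈ Ω, ‖iteratedFDeriv ℝ n (fun x => ∫ t in Ioi (0 : ℝ), k t • g (x + t • α)) x‖ ≤
        (∫ t in Ioi (0 : ℝ), ‖k t‖ * β n t) * Real.exp (w x) := by
  induction n with
  | zero =>
    intro F _ _ _ _ g β h
    refine ⟨?_, fun x hx => ?_⟩
    · exact contDiffOn_zero.2 fun x hx =>
        (h.hasFDerivAt hα hk hw hx).continuousAt.continuousWithinAt
    · rw [norm_iteratedFDeriv_zero, mul_comm, ← integral_const_mul]
      refine norm_integral_le_of_norm_le ((h.integrable 0).const_mul _) ?_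
      filter_upwards [ae_restrict_mem measurableSet_Ioi] with t ht
      exact h.norm_le hx ht
  | succ n ih =>
    intro F _ _ _ _ g β h
    obtain ⟨h1, h2⟩ := ih h.fderiv
    have h3 : ∀ x ∈ Ω, _root_.fderiv ℝ (fun x => ∫ t in Ioi (0 : ℝ), k t • g (x + t • α)) x =
        ∫ t in Ioi (0 : ℝ), k t • _root_.fderiv ℝ g (x + t • α) :=
      fun x hx => (h.hasFDerivAt hα hk hw hx).fderiv
    refine ⟨?_, fun x hx => ?_⟩
    · rw [Nat.cast_succ, contDiffOn_succ_iff_fderiv_of_isOpen Ω.isOpen]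
      refine ⟨fun x hx => (h.hasFDerivAt hα hk hw hx).differentiableAt.differentiableWithinAt,
        by simp, h1.congr h3⟩
    · rw [← norm_iteratedFDeriv_fderiv]
      have h4 := Filter.eventuallyEq_of_mem (Ω.isOpen.mem_nhds hx) h3
      rw [(h4.iteratedFDeriv ℝ n).eq_of_nhds]
      exact h2 x hx

theorem RayBound.contDiffOn [NormedSpace ℂ F] [SMulCommClass ℝ ℂ F]
    (hα : ∀ x ∈ Ω, ∀ t : ℝ, 0 < t → x + t • α ∈ Ω')
    (hk : ContinuousOn k (Ioi 0)) (hw : ContinuousOn w Ω) (h : RayBound Ω' Ω α k w g β) :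
    ContDiffOn ℝ ∞ (fun x => ∫ t in Ioi (0 : ℝ), k t • g (x + t • α)) Ω :=
  contDiffOn_infty.2 fun n => (RayBound.contDiffOn_nat hα hk hw n h).1

/-- Functions which can be integrated along the rays `x + t • α`. -/
def rayDom (hα : ∀ x ∈ Ω, ∀ t : ℝ, 0 < t → x + t • α ∈ Ω') (k : ℝ → ℂ) (w : E → ℝ) :
    Submodule ℂ (Sm Ω') where
  carrier := {g | ∃ β, RayBound Ω' Ω α k w g β}
  zero_mem' := ⟨fun _ _ => 0, Sm.smooth 0, fun j => by simp, fun j x hx t ht => by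
    have : (((0 : Sm Ω') : E → ℂ)) = fun _ => 0 := rfl
    rw [this]
    simp⟩
  add_mem' := by
    rintro f g ⟨β, hf⟩ ⟨β', hg⟩
    refine ⟨fun j t => |β j t| + |β' j t|, Sm.smooth (f + g), fun j => ?_, fun j x hx t ht => ?_⟩
    · have := (hf.integrable j).norm.add (hg.integrable j).norm
      refine this.congr (Filter.Eventually.of_forall fun t => ?_)
      simp [mul_add]
    · have h := hα x hx t ht
      rw [show (((f + g : Sm Ω') : E → ℂ)) = (f : E → ℂ) + g from rfl,
        iteratedFDeriv_add_apply ((Sm.smoothAt f h).of_le (by exact_mod_cast le_top))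
        ((Sm.smoothAt g h).of_le (by exact_mod_cast le_top)), mul_add]
      refine (norm_add_le _ _).trans (add_le_add ((hf.bound j x hx t ht).trans ?_)
        ((hg.bound j x hx t ht).trans ?_)) <;> gcongr <;> exact le_abs_self _
  smul_mem' := by
    rintro c f ⟨β, hf⟩
    refine ⟨fun j t => ‖c‖ * β j t, Sm.smooth (c • f), fun j => ?_, fun j x hx t ht => ?_⟩
    · refine ((hf.integrable j).const_mul ‖c‖).congr (Filter.Eventually.of_forall fun t => ?_)
      simp only
      ring
    · have h := hα x hx t ht
      rw [show (((c • f : Sm Ω') : E → ℂ)) = c • (f : E → ℂ) from rfl,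
        iteratedFDeriv_const_smul_apply ((Sm.smoothAt f h).of_le (by exact_mod_cast le_top)),
        norm_smul]
      calc _ ≤ ‖c‖ * (Real.exp (w x) * β j t) := by
            gcongr
            exact hf.bound j x hx t ht
        _ = _ := by ring

variable (hα : ∀ x ∈ Ω, ∀ t : ℝ, 0 < t → x + t • α ∈ Ω')

theorem dirD_mem_rayDom (d : E) : ∀ g ∈ rayDom hα k w, Sm.dirD Ω' d g ∈ rayDom hα k w := by
  rintro g ⟨β, hg⟩
  refine ⟨fun j t => ‖d‖ * β (j + 1) t, Sm.smooth (Sm.dirD Ω' d g), fun j => ?_,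
    fun j x hx t ht => ?_⟩
  · refine ((hg.integrable (j + 1)).const_mul ‖d‖).congr (Filter.Eventually.of_forall fun t => ?_)
    simp only
    ring
  · refine (Sm.norm_iteratedFDeriv_dirD_le d g j (hα x hx t ht)).trans ?_
    calc _ ≤ ‖d‖ * (Real.exp (w x) * β (j + 1) t) := by
          gcongr
          exact hg.bound (j + 1) x hx t ht
      _ = _ := by ring

open Classical in
/-- The integral of `k t * g (x + t • α)` over `t > 0`, as a smooth function of `x ∈ Ω`. -/
def rayInt (Ω' Ω : Opens E) (α : E) (k : ℝ → ℂ) (g : Sm Ω') : Sm Ω :=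
  -- The value `0` in the other case is a convention: on `rayDom` the integral is always smooth.
  if h : ContDiffOn ℝ ∞ (fun x => ∫ t in Ioi (0 : ℝ), k t • g (x + t • α)) Ω then
    Sm.of Ω _ h else 0

theorem rayInt_apply (hk : ContinuousOn k (Ioi 0)) (hw : ContinuousOn w Ω) {g : Sm Ω'}
    (hg : g ∈ rayDom hα k w) {x : E} (hx : x ∈ Ω) :
    rayInt Ω' Ω α k g x = ∫ t in Ioi (0 : ℝ), k t • g (x + t • α) := by
  obtain ⟨β, hg⟩ := hg
  rw [rayInt, dif_pos (hg.contDiffOn hα hk hw), Sm.of_apply hx]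

theorem rayInt_eventuallyEq (hk : ContinuousOn k (Ioi 0)) (hw : ContinuousOn w Ω) {g : Sm Ω'}
    (hg : g ∈ rayDom hα k w) {x : E} (hx : x ∈ Ω) :
    (rayInt Ω' Ω α k g : E → ℂ) =ᶠ[nhds x] fun x => ∫ t in Ioi (0 : ℝ), k t • g (x + t • α) :=
  Filter.eventually_of_mem (Ω.isOpen.mem_nhds hx) fun _ hy => rayInt_apply hα hk hw hg hy

theorem rayInt_mem_Sym (hk : ContinuousOn k (Ioi 0)) (hw : ContinuousOn w Ω) {g : Sm Ω'}
    (hg : g ∈ rayDom hα k w) : rayInt Ω' Ω α k g ∈ Sym Ω w := by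
  intro j
  have hg' := hg
  obtain ⟨β, hg⟩ := hg
  refine ⟨∫ t in Ioi (0 : ℝ), ‖k t‖ * β j t, fun x hx => ?_⟩
  rw [((rayInt_eventuallyEq hα hk hw hg' hx).iteratedFDeriv ℝ j).eq_of_nhds]
  exact (RayBound.contDiffOn_nat hα hk hw j hg).2 x hx

theorem rayInt_dirD (hk : ContinuousOn k (Ioi 0)) (hw : ContinuousOn w Ω) (d : E) {g : Sm Ω'}
    (hg : g ∈ rayDom hα k w) :
    rayInt Ω' Ω α k (Sm.dirD Ω' d g) = Sm.dirD Ω d (rayInt Ω' Ω α k g) := by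
  refine Sm.ext' fun x hx => ?_
  rw [rayInt_apply hα hk hw (dirD_mem_rayDom hα d g hg) hx, Sm.dirD_apply _ _ hx,
    (rayInt_eventuallyEq hα hk hw hg hx).fderiv_eq]
  obtain ⟨β, hg⟩ := hg
  rw [(hg.hasFDerivAt hα hk hw hx).fderiv,
    ContinuousLinearMap.integral_apply (hg.fderiv.integrableOn hα hk hx)]
  refine setIntegral_congr_fun measurableSet_Ioi fun t ht => ?_
  simp only [Sm.dirD_apply d g (hα x hx t ht)]
  rfl

/-- The integral is additive only on integrable functions, so `rayInt` is not a linear map. This is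
why `aeval_intertwine` asks for additivity only on an invariant submodule, here `rayDom`. -/
theorem rayInt_aeval (hk : ContinuousOn k (Ioi 0)) (hw : ContinuousOn w Ω) (d : E) (P : ℂ[X])
    {g : Sm Ω'} (hg : g ∈ rayDom hα k w) :
    rayInt Ω' Ω α k (aeval (Sm.dirD Ω' d) P g) = aeval (Sm.dirD Ω d) P (rayInt Ω' Ω α k g) := by
  have hint : ∀ g ∈ rayDom hα k w, ∀ x ∈ Ω,
      IntegrableOn (fun t => k t • g (x + t • α)) (Ioi 0) := by
    rintro g ⟨β, hg⟩ x hx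
    exact hg.integrableOn hα hk hx
  refine (aeval_intertwine (rayDom hα k w) (dirD_mem_rayDom hα d) (rayInt Ω' Ω α k) ?_ ?_
    (fun g hg => rayInt_dirD hα hk hw d hg) P g hg).2
  · intro a ha b hb
    refine Sm.ext' fun x hx => ?_
    rw [Sm.add_apply, rayInt_apply hα hk hw ha hx, rayInt_apply hα hk hw hb hx,
      rayInt_apply hα hk hw (Submodule.add_mem _ ha hb) hx,
      ← integral_add (hint a ha x hx) (hint b hb x hx)]
    refine setIntegral_congr_fun measurableSet_Ioi fun t _ => ?_
    simp only [Sm.add_apply, smul_add]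
  · intro c a ha
    refine Sm.ext' fun x hx => ?_
    rw [Sm.smul_apply, rayInt_apply hα hk hw ha hx,
      rayInt_apply hα hk hw (Submodule.smul_mem _ c ha) hx, ← integral_const_mul]
    refine setIntegral_congr_fun measurableSet_Ioi fun t _ => ?_
    simp only [Sm.smul_apply, smul_eq_mul]
    ring

end RayIntegral

/-! ### Logarithmic coordinates at a corner and the operators that annihilate expansions -/

section CornerOperators

variable {m : ℕ} {V : Type} [NormedAddCommGroup V] [NormedSpace ℝ V]

/-- The linear weight `∑ w i * τ i` in logarithmic coordinates. -/
def lin (w : Fin m → ℝ) (x : (Fin m → ℝ) × V) : ℝ := ∑ l, w l * x.1 l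

theorem lin_update (w : Fin m → ℝ) (i : Fin m) (a : ℝ) (x : (Fin m → ℝ) × V) :
    lin (Function.update w i a) x = lin w x + (a - w i) * x.1 i := by
  rw [← sub_eq_iff_eq_add', lin, lin, ← Finset.sum_sub_distrib,
    Finset.sum_eq_single i (fun l _ hl => by simp [hl]) (by simp)]
  simp
  ring

theorem continuous_lin (w : Fin m → ℝ) :
    Continuous (lin w : (Fin m → ℝ) × V → ℝ) := by
  unfold lin
  fun_prop

theorem continuous_expMap : Continuous (expMap : (Fin m → ℝ) × V → (Fin m → ℝ) × V) := by
  unfold expMap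
  fun_prop

/-- The unit vector of the logarithmic coordinate `i`. -/
def ei (V : Type) [NormedAddCommGroup V] (i : Fin m) : (Fin m → ℝ) × V := (Pi.single i 1, 0)

/-- The logarithmic coordinate `i`, multiplied by `z`. -/
def coordL (V : Type) [NormedAddCommGroup V] [NormedSpace ℝ V] (i : Fin m) (z : ℂ) :
    ((Fin m → ℝ) × V) →L[ℝ] ℂ :=
  ((ContinuousLinearMap.proj (R := ℝ) (φ := fun _ : Fin m => ℝ) i).comp
    (ContinuousLinearMap.fst ℝ (Fin m → ℝ) V)).smulRight z

@[simp] theorem coordL_apply (i : Fin m) (z : ℂ) (x : (Fin m → ℝ) × V) :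
    coordL V i z x = x.1 i * z := by simp [coordL]

/-- The part of a ball with positive coordinates, in logarithmic coordinates. -/
def logBall (q : (Fin m → ℝ) × V) (ε : ℝ) : Opens ((Fin m → ℝ) × V) :=
  ⟨expMap ⁻¹' Metric.ball q ε, Metric.isOpen_ball.preimage continuous_expMap⟩

theorem mem_logBall {q : (Fin m → ℝ) × V} {ε : ℝ} {x : (Fin m → ℝ) × V} :
    x ∈ logBall q ε ↔ expMap x ∈ Metric.ball q ε := Iff.rfl

theorem mem_logBall_iff {q : (Fin m → ℝ) × V} {ε : ℝ} (hε : 0 < ε) {x : (Fin m → ℝ) × V} :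
    x ∈ logBall q ε ↔ (∀ l, |Real.exp (x.1 l) - q.1 l| < ε) ∧ ‖x.2 - q.2‖ < ε := by
  rw [mem_logBall, Metric.mem_ball, Prod.dist_eq, max_lt_iff, dist_pi_lt_iff hε, dist_eq_norm]
  rfl

variable {Ω : Opens ((Fin m → ℝ) × V)}

/-- Multiplication by the logarithmic coordinate `i`. -/
def coordMul (Ω : Opens ((Fin m → ℝ) × V)) (i : Fin m) : Module.End ℂ (Sm Ω) :=
  mulSm Ω (coordL V i 1) (coordL V i 1).contDiff.contDiffOn

theorem coordMul_apply (i : Fin m) (f : Sm Ω) (x : (Fin m → ℝ) × V) :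
    coordMul Ω i f x = x.1 i * f x := by
  simp [coordMul, mulSm_apply]

theorem coordMul_pow_apply (i : Fin m) (p : ℕ) (f : Sm Ω) (x : (Fin m → ℝ) × V) :
    (coordMul Ω i ^ p) f x = (x.1 i : ℂ) ^ p * f x := by
  induction p with
  | zero => simp
  | succ p ih =>
    rw [pow_succ', Module.End.mul_apply, coordMul_apply, ih]
    ring

theorem dirD_coordMul (i : Fin m) (f : Sm Ω) :
    Sm.dirD Ω (ei V i) (coordMul Ω i f) = f + coordMul Ω i (Sm.dirD Ω (ei V i) f) := by
  refine Sm.ext' fun x hx => ?_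
  rw [coordMul, dirD_mulSm _ _ (coordL V i 1).contDiff f hx, Sm.add_apply, mulSm_apply,
    ContinuousLinearMap.fderiv]
  simp [ei]

theorem dirD_coordMul_pow (i : Fin m) {c : Sm Ω} (hc : Sm.dirD Ω (ei V i) c = 0) (p : ℕ) :
    Sm.dirD Ω (ei V i) ((coordMul Ω i ^ (p + 1)) c) = (p + 1 : ℂ) • (coordMul Ω i ^ p) c := by
  induction p with
  | zero => simp [dirD_coordMul, hc]
  | succ p ih =>
    rw [pow_succ', Module.End.mul_apply, dirD_coordMul, ih, map_smul, ← Module.End.mul_apply,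
      ← pow_succ']
    push_cast
    module

theorem dirD_pow_coordMul_pow (i : Fin m) {c : Sm Ω} (hc : Sm.dirD Ω (ei V i) c = 0) (p : ℕ) :
    (Sm.dirD Ω (ei V i) ^ (p + 1)) ((coordMul Ω i ^ p) c) = 0 := by
  induction p with
  | zero => simpa using hc
  | succ p ih =>
    rw [pow_succ, Module.End.mul_apply, dirD_coordMul_pow i hc, map_smul, ih, smul_zero]

/-- The operator `D - z`. -/
theorem aeval_X_sub_C {A : Type*} [AddCommGroup A] [Module ℂ A] (D : Module.End ℂ A) (z : ℂ)
    (a : A) : aeval D (X - C z) a = D a - z • a := by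
  simp [Module.algebraMap_end_apply]

theorem aeval_mul_apply {A : Type*} [AddCommGroup A] [Module ℂ A] (D : Module.End ℂ A)
    (P Q : ℂ[X]) (a : A) : aeval D (P * Q) a = aeval D P (aeval D Q a) := by
  rw [map_mul, Module.End.mul_apply]

/-- Conjugation by `ρ ^ z` turns `D - z` into `D`. -/
theorem aeval_expMul (i : Fin m) (z : ℂ) (f : Sm Ω) :
    aeval (Sm.dirD Ω (ei V i)) (X - C z) (expMul Ω (coordL V i z) f) =
      expMul Ω (coordL V i z) (Sm.dirD Ω (ei V i) f) := by
  rw [aeval_X_sub_C, dirD_expMul, map_add, map_smul]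
  simp [ei]

theorem aeval_expMul_pow (i : Fin m) (z : ℂ) (n : ℕ) (f : Sm Ω) :
    aeval (Sm.dirD Ω (ei V i)) ((X - C z) ^ n) (expMul Ω (coordL V i z) f) =
      expMul Ω (coordL V i z) ((Sm.dirD Ω (ei V i) ^ n) f) := by
  induction n with
  | zero => simp
  | succ n ih =>
    rw [pow_succ', aeval_mul_apply, ih, aeval_expMul, pow_succ', Module.End.mul_apply]

/-- Multiplication by `ρ ^ z * (log ρ) ^ p`, where `ρ` is the coordinate `i`. -/
def termOp (Ω : Opens ((Fin m → ℝ) × V)) (i : Fin m) (t : ℂ × ℕ) : Module.End ℂ (Sm Ω) :=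
  expMul Ω (coordL V i t.1) * coordMul Ω i ^ t.2

theorem termOp_apply (i : Fin m) (t : ℂ × ℕ) (f : Sm Ω) (x : (Fin m → ℝ) × V) :
    termOp Ω i t f x = Complex.exp (x.1 i * t.1) * ((x.1 i : ℂ) ^ t.2 * f x) := by
  rw [termOp, Module.End.mul_apply, expMul_apply, coordMul_pow_apply, coordL_apply]

/-- After removing `ρ ^ z` by conjugation, `(D - z) ^ (p + 1)` becomes the derivative of order `p +
1` in `log ρ`, applied to a polynomial of degree `p` in `log ρ` with coefficients free of `ρ`. -/
theorem aeval_termOp_eq_zero (i : Fin m) {c : Sm Ω} (hc : Sm.dirD Ω (ei V i) c = 0) (t : ℂ × ℕ)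
    {P : ℂ[X]} (hP : (X - C t.1) ^ (t.2 + 1) ∣ P) :
    aeval (Sm.dirD Ω (ei V i)) P (termOp Ω i t c) = 0 := by
  obtain ⟨Q, rfl⟩ := hP
  rw [mul_comm, aeval_mul_apply, termOp, Module.End.mul_apply, aeval_expMul_pow,
    dirD_pow_coordMul_pow i hc, map_zero, map_zero]

/-- The polynomial whose roots are the exponents of a finite set, with multiplicity. -/
def expPoly (F : Finset (ℂ × ℕ)) : ℂ[X] := ∏ t ∈ F, (X - C t.1)

/-- Each of the exponents `(z, 0), …, (z, p)` contributes one factor `X - z`; closure under lowering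
the power of the logarithm supplies all of them. -/
theorem pow_dvd_expPoly {F : Finset (ℂ × ℕ)} {t : ℂ × ℕ} (h : ∀ q ≤ t.2, (t.1, q) ∈ F) :
    (X - C t.1) ^ (t.2 + 1) ∣ expPoly F := by
  have h1 : (Finset.range (t.2 + 1)).image (fun q => (t.1, q)) ⊆ F := by
    intro s hs
    obtain ⟨q, hq, rfl⟩ := Finset.mem_image.1 hs
    exact h q (by simpa [Nat.lt_succ_iff] using hq)
  have h2 := Finset.prod_dvd_prod_of_subset _ _ (fun t : ℂ × ℕ => (X - C t.1 : ℂ[X])) h1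
  rw [Finset.prod_image (by simp)] at h2
  simpa [expPoly] using h2

theorem IndexSet.mem_upTo {E : IndexSet} {s : ℝ} {t : ℂ × ℕ} :
    t ∈ E.upTo s ↔ t ∈ E.carrier ∧ t.1.re ≤ s := by
  simp [IndexSet.upTo]

theorem IndexSet.upTo_log_closed {E : IndexSet} {s : ℝ} {t : ℂ × ℕ} (ht : t ∈ E.upTo s) (q : ℕ)
    (hq : q ≤ t.2) : (t.1, q) ∈ E.upTo s := by
  rw [IndexSet.mem_upTo] at ht ⊢
  exact ⟨E.log_closed t.1 t.2 q ht.1 hq, ht.2⟩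

theorem IndexSet.upTo_mono (E : IndexSet) {s s' : ℝ} (h : s ≤ s') : E.upTo s ⊆ E.upTo s' := by
  intro t ht
  rw [IndexSet.mem_upTo] at ht ⊢
  exact ⟨ht.1, ht.2.trans h⟩

theorem expPoly_dvd {F F' : Finset (ℂ × ℕ)} (h : F ⊆ F') : expPoly F ∣ expPoly F' :=
  Finset.prod_dvd_prod_of_subset _ _ _ h

theorem aeval_mem_Sym_of_dvd {w : (Fin m → ℝ) × V → ℝ} {d : (Fin m → ℝ) × V} {P Q : ℂ[X]}
    (h : P ∣ Q) {f : Sm Ω} (hf : aeval (Sm.dirD Ω d) P f ∈ Sym Ω w) :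
    aeval (Sm.dirD Ω d) Q f ∈ Sym Ω w := by
  obtain ⟨R, rfl⟩ := h
  rw [mul_comm, aeval_mul_apply]
  exact aeval_mem_Sym d R hf

theorem exp_lin (w : Fin m → ℝ) (x : (Fin m → ℝ) × V) :
    Real.exp (lin w x) = ∏ i, (Real.exp (x.1 i)) ^ (w i) := by
  rw [lin, Real.exp_sum]
  refine Finset.prod_congr rfl fun i _ => ?_
  rw [mul_comm, Real.exp_mul]

theorem conormalOn_iff {q : (Fin m → ℝ) × V} {ε : ℝ} {w : Fin m → ℝ}
    {u : (Fin m → ℝ) × V → ℂ} :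
    ConormalOn (Metric.ball q ε) w u ↔
      ∃ g ∈ Sym (logBall q ε) (lin w), ∀ x ∈ logBall q ε, g x = u (expMap x) := by
  constructor
  · rintro ⟨h1, h2⟩
    replace h1 : ContDiffOn ℝ ∞ (u ∘ expMap) (logBall q ε) := h1
    refine ⟨Sm.of (logBall q ε) (u ∘ expMap) h1, fun j => ?_, fun x hx => Sm.of_apply hx⟩
    obtain ⟨C, hC⟩ := h2 j
    refine ⟨C, fun x hx => ?_⟩
    rw [((Sm.of_eventuallyEq hx).iteratedFDeriv ℝ j).eq_of_nhds, exp_lin]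
    exact hC x hx
  · rintro ⟨g, hg, hgu⟩
    refine ⟨(Sm.smooth g).congr fun x hx => (hgu x hx).symm, fun j => ?_⟩
    obtain ⟨C, hC⟩ := hg j
    refine ⟨C, fun x hx => ?_⟩
    have h1 : (g : (Fin m → ℝ) × V → ℂ) =ᶠ[nhds x] u ∘ expMap :=
      Filter.eventually_of_mem ((logBall q ε).isOpen.mem_nhds hx) hgu
    rw [← (h1.iteratedFDeriv ℝ j).eq_of_nhds, ← exp_lin]
    exact hC x hx

variable {Face : Type}

theorem PhgOn.conormal {E : Face → IndexSet} {face : Fin m → Option Face}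
    {O : Set ((Fin m → ℝ) × V)} {n : ℕ} {S : Finset (Fin m)} {u : (Fin m → ℝ) × V → ℂ}
    (h : PhgOn E face O n S u) : ∃ w, ConormalOn O w u := by
  cases n with
  | zero => exact h
  | succ n => exact h.1

theorem dirD_eq_zero_of_update {q : (Fin m → ℝ) × V} {ε : ℝ} (i : Fin m) {c : Sm (logBall q ε)}
    {a : (Fin m → ℝ) × V → ℂ}
    (ha : ∀ (p : (Fin m → ℝ) × V) (r : ℝ), a (Function.update p.1 i r, p.2) = a p)
    (hc : ∀ x ∈ logBall q ε, c x = a (expMap x)) : Sm.dirD (logBall q ε) (ei V i) c = 0 := by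
  refine Sm.ext' fun x hx => ?_
  rw [Sm.dirD_apply _ _ hx, Sm.zero_apply]
  have h1 : (c : (Fin m → ℝ) × V → ℂ) =ᶠ[nhds x] a ∘ expMap :=
    Filter.eventually_of_mem ((logBall q ε).isOpen.mem_nhds hx) hc
  have h2 : HasFDerivAt (a ∘ expMap) (fderiv ℝ c x) x :=
    (Sm.differentiableAt c hx).hasFDerivAt.congr_of_eventuallyEq h1.symm
  have h3 : HasLineDerivAt ℝ (a ∘ expMap) (fderiv ℝ c x (ei V i)) x (ei V i) :=
    h2.hasLineDerivAt _
  have h4 : (fun t : ℝ => (a ∘ expMap) (x + t • ei V i)) = fun _ => a (expMap x) := by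
    funext t
    have : expMap (x + t • ei V i) =
        (Function.update (expMap x).1 i (Real.exp (x.1 i + t)), (expMap x).2) := by
      refine Prod.ext ?_ (by simp [expMap, ei])
      funext l
      by_cases hl : l = i
      · subst hl
        simp [expMap, ei]
      · simp [expMap, ei, hl]
    rw [Function.comp_apply, this, ha]
  rw [HasLineDerivAt, h4] at h3
  exact h3.unique (hasDerivAt_const _ _)

/-- Polyhomogeneous functions satisfy the differential conditions. -/
theorem PhgOn.aeval_mem {E : Face → IndexSet} {face : Fin m → Option Face}
    {q : (Fin m → ℝ) × V} {ε : ℝ} {n : ℕ} {S : Finset (Fin m)} {u : (Fin m → ℝ) × V → ℂ}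
    (h : PhgOn E face (Metric.ball q ε) (n + 1) S u) {g : Sm (logBall q ε)}
    (hg : ∀ x ∈ logBall q ε, g x = u (expMap x)) {i : Fin m} (hi : i ∈ S) {H : Face}
    (hH : face i = some H) :
    ∃ w : Fin m → ℝ, ∀ N : ℕ, aeval (Sm.dirD (logBall q ε) (ei V i)) (expPoly ((E H).upTo N)) g ∈
      Sym (logBall q ε) (lin (Function.update w i N)) := by
  obtain ⟨a, ha, w, hw⟩ := h.2 i hi H hH
  refine ⟨w, fun N => ?_⟩
  obtain ⟨r, hr, hru⟩ := conormalOn_iff.1 (hw N)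
  have hc : ∀ t, ∃ c : Sm (logBall q ε), t ∈ (E H).carrier →
      (Sm.dirD (logBall q ε) (ei V i) c = 0 ∧ ∀ x ∈ logBall q ε, c x = a t (expMap x)) := by
    intro t
    by_cases ht : t ∈ (E H).carrier
    · obtain ⟨w', hw'⟩ := (ha t ht).2.conormal
      obtain ⟨c, -, hc⟩ := conormalOn_iff.1 hw'
      exact ⟨c, fun _ => ⟨dirD_eq_zero_of_update i (ha t ht).1 hc, hc⟩⟩
    · exact ⟨0, fun h => absurd h ht⟩
  choose c hc using hc
  -- The function is its remainder plus finitely many terms. The operator kills the terms and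
  -- preserves the symbol class of the remainder.
  have hgr : g = r + ∑ t ∈ (E H).upTo N, termOp (logBall q ε) i t (c t) := by
    refine Sm.ext' fun x hx => ?_
    rw [Sm.add_apply, Sm.sum_apply, hru x hx, hg x hx]
    rw [sub_add_eq_add_sub, eq_sub_iff_add_eq, add_right_inj]
    refine Finset.sum_congr rfl fun t ht => ?_
    rw [termOp_apply, (hc t (IndexSet.mem_upTo.1 ht).1).2 x hx]
    simp only [expMap, Real.log_exp]
    rw [Complex.cpow_def_of_ne_zero (by exact_mod_cast (Real.exp_pos _).ne'),
      ← Complex.ofReal_log (Real.exp_pos _).le, Real.log_exp]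
    ring
  rw [hgr, map_add, map_sum, Finset.sum_eq_zero, add_zero]
  · exact aeval_mem_Sym _ _ hr
  · intro t ht
    exact aeval_termOp_eq_zero i (hc t (IndexSet.mem_upTo.1 ht).1).1 t
      (pow_dvd_expPoly (IndexSet.upTo_log_closed ht))

end CornerOperators

/-! ### Exchange of derivatives, and splitting of kernels by coprimality -/

/-- Directional derivatives commute with iterated derivatives. -/
theorem fderiv_iteratedFDeriv_apply {E F : Type} [NormedAddCommGroup E] [NormedSpace ℝ E]
    [NormedAddCommGroup F] [NormedSpace ℝ F] {Ω : Set E} (hΩ : IsOpen Ω) {f : E → F}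
    (hf : ContDiffOn ℝ ∞ f Ω) (d : E) (j : ℕ) : ∀ x ∈ Ω,
    fderiv ℝ (iteratedFDeriv ℝ j f) x d = iteratedFDeriv ℝ j (fun y => fderiv ℝ f y d) x := by
  have hfd : ContDiffOn ℝ ∞ (fun y => fderiv ℝ f y d) Ω :=
    ((contDiffOn_infty_iff_fderiv_of_isOpen hΩ).1 hf).2.clm_apply contDiffOn_const
  have hsm : ∀ (j : ℕ), ∀ x ∈ Ω, ContDiffAt ℝ ∞ (iteratedFDeriv ℝ j f) x := fun j x hx =>
    (hf.contDiffAt (hΩ.mem_nhds hx)).iteratedFDeriv_right (m := ∞) (by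
      exact_mod_cast le_of_eq (top_add (a := (j : ℕ∞))))
  induction j with
  | zero =>
    intro x hx
    rw [iteratedFDeriv_zero_eq_comp, iteratedFDeriv_zero_eq_comp]
    have hd : DifferentiableAt ℝ f x := (hf.contDiffAt (hΩ.mem_nhds hx)).differentiableAt (by simp)
    rw [LinearIsometryEquiv.comp_fderiv]
    simp
  | succ j ih =>
    intro x hx
    have h1 : DifferentiableAt ℝ (fderiv ℝ (iteratedFDeriv ℝ j f)) x :=
      ((hsm j x hx).fderiv_right (m := 1)
        (by simpa [one_add_one_eq_two] using Sm.two_le_infty)).differentiableAt (by simp)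
    have hap : ∀ (k : ℕ) (G : E → E [×k]→L[ℝ] F) (_ : DifferentiableAt ℝ G x) (v : Fin k → E),
        fderiv ℝ G x d v = fderiv ℝ (fun y => G y v) x d := by
      intro k G hG v
      have h : HasFDerivAt (fun y => G y v) _ x :=
        (ContinuousMultilinearMap.apply ℝ (fun _ : Fin k => E) F v).hasFDerivAt.comp x
          hG.hasFDerivAt
      rw [h.fderiv]
      rfl
    ext m
    rw [hap _ _ ((hsm (j + 1) x hx).differentiableAt (by simp))]
    simp only [iteratedFDeriv_succ_apply_left]
    set v := m 0
    have h1v : DifferentiableAt ℝ (fun y => fderiv ℝ (iteratedFDeriv ℝ j f) y v) x :=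
      h1.clm_apply (differentiableAt_const _)
    rw [← hap _ _ h1v]
    refine congrArg (fun T : E [×j]→L[ℝ] F => T (Fin.tail m)) ?_
    rw [fderiv_clm_apply h1 (differentiableAt_const _)]
    -- Symmetry of the second derivative of the `j`-th iterated derivative moves `d` past the new
    -- direction `v`.
    have h2 : fderiv ℝ (fderiv ℝ (iteratedFDeriv ℝ j f)) x d v =
        fderiv ℝ (fderiv ℝ (iteratedFDeriv ℝ j f)) x v d :=
      (hsm j x hx).isSymmSndFDerivAt (by simpa using Sm.two_le_infty) d v
    have h3 : (fun y => fderiv ℝ (iteratedFDeriv ℝ j f) y d) =ᶠ[nhds x]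
        iteratedFDeriv ℝ j (fun y => fderiv ℝ f y d) :=
      Filter.eventually_of_mem (hΩ.mem_nhds hx) ih
    rw [← h3.fderiv_eq, fderiv_clm_apply h1 (differentiableAt_const _)]
    simpa using h2

/-- Kernels of products of coprime powers split. -/
theorem exists_decomposition {A : Type*} [AddCommGroup A] [Module ℂ A] {D : Module.End ℂ A}
    {K : Submodule ℂ A} (hK : ∀ a ∈ K, D a ∈ K) (n : ℂ → ℕ) (Z : Finset ℂ) : ∀ s ∈ K,
    aeval D (∏ z ∈ Z, (X - C z) ^ n z) s = 0 →
    ∃ σ : ℂ → A, (∀ z ∈ Z, σ z ∈ K ∧ aeval D ((X - C z) ^ n z) (σ z) = 0) ∧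
      s = ∑ z ∈ Z, σ z := by
  induction Z using Finset.induction_on with
  | empty =>
    intro s _ h
    exact ⟨0, by simp, by simpa using h⟩
  | insert a Z ha ih =>
    intro s hs h
    rw [Finset.prod_insert ha] at h
    have hco : IsCoprime ((X - C a : ℂ[X]) ^ n a) (∏ z ∈ Z, (X - C z) ^ n z) := by
      refine IsCoprime.prod_right fun z hz => (IsCoprime.pow ?_)
      refine isCoprime_X_sub_C_of_isUnit_sub (isUnit_iff_ne_zero.2 (sub_ne_zero.2 ?_))
      rintro rfl
      exact ha hz
    obtain ⟨u, v, huv⟩ := hco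
    set P : ℂ[X] := (X - C a) ^ n a
    set Q : ℂ[X] := ∏ z ∈ Z, (X - C z) ^ n z
    -- From `u * P + v * Q = 1` the element splits as `(u * P) s + (v * Q) s`; the first part is
    -- killed by `Q`, the second by `P`.
    have h1 : aeval D Q (aeval D (u * P) s) = 0 := by
      rw [← aeval_mul_apply, show Q * (u * P) = u * (P * Q) by ring, aeval_mul_apply, h, map_zero]
    have h2 : aeval D P (aeval D (v * Q) s) = 0 := by
      rw [← aeval_mul_apply, show P * (v * Q) = v * (P * Q) by ring, aeval_mul_apply, h, map_zero]
    obtain ⟨σ, hσ, hs'⟩ := ih _ (aeval_mem K hK (u * P) hs) h1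
    have hne : ∀ z ∈ Z, Function.update σ a (aeval D (v * Q) s) z = σ z := fun z hz =>
      Function.update_of_ne (ne_of_mem_of_not_mem hz ha) _ _
    refine ⟨Function.update σ a (aeval D (v * Q) s), fun z hz => ?_, ?_⟩
    · rcases Finset.mem_insert.1 hz with rfl | hz
      · rw [Function.update_self]
        exact ⟨aeval_mem K hK _ hs, h2⟩
      · rw [hne z hz]
        exact hσ z hz
    · rw [Finset.sum_insert ha, Function.update_self,
        Finset.sum_congr rfl hne, ← hs', add_comm, ← LinearMap.add_apply, ← map_add, huv]
      simp

/-- The component at `a` is killed by a power of `X - a` and, being minus the sum of the other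
components, also by the product of the other powers. These polynomials are coprime. -/
theorem decomposition_unique {A : Type*} [AddCommGroup A] [Module ℂ A] {D : Module.End ℂ A}
    (n : ℂ → ℕ) {Z : Finset ℂ} {σ : ℂ → A}
    (hσ : ∀ z ∈ Z, aeval D ((X - C z) ^ n z) (σ z) = 0) (hs : ∑ z ∈ Z, σ z = 0) :
    ∀ z ∈ Z, σ z = 0 := by
  intro a ha
  have hco : IsCoprime ((X - C a : ℂ[X]) ^ n a) (∏ z ∈ Z.erase a, (X - C z) ^ n z) := by
    refine IsCoprime.prod_right fun z hz => (IsCoprime.pow ?_)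
    exact isCoprime_X_sub_C_of_isUnit_sub
      (isUnit_iff_ne_zero.2 (sub_ne_zero.2 (Finset.ne_of_mem_erase hz).symm))
  obtain ⟨u, v, huv⟩ := hco
  have h1 : aeval D (∏ z ∈ Z.erase a, (X - C z) ^ n z) (σ a) = 0 := by
    rw [← Finset.add_sum_erase Z σ ha] at hs
    rw [eq_neg_of_add_eq_zero_left hs, map_neg, map_sum, Finset.sum_eq_zero, neg_zero]
    intro z hz
    rw [← Finset.prod_erase_mul _ _ hz, aeval_mul_apply, hσ z (Finset.mem_of_mem_erase hz),
      map_zero]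
  have h2 : σ a = aeval D (1 : ℂ[X]) (σ a) := by simp
  rw [h2, ← huv, map_add, LinearMap.add_apply, aeval_mul_apply, aeval_mul_apply, h1, hσ a ha,
    map_zero, map_zero, add_zero]

/-! ### Ordinary differential equations in one logarithmic coordinate -/

section HalfDomain

variable {m : ℕ} {V : Type} [NormedAddCommGroup V] [NormedSpace ℝ V]

/-- `Ω` is a product with a half line `(-∞, c)` in the coordinate `i`, and bounded above. -/
structure IsHalf (Ω : Opens ((Fin m → ℝ) × V)) (i : Fin m) (c : ℝ) : Prop where
  lt : ∀ x ∈ Ω, x.1 i < c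
  upd : ∀ x ∈ Ω, ∀ s < c, (Function.update x.1 i s, x.2) ∈ Ω

variable {Ω : Opens ((Fin m → ℝ) × V)} {i : Fin m} {c : ℝ}

theorem IsHalf.hasDerivAt (h : IsHalf Ω i c) (f : Sm Ω) {x : (Fin m → ℝ) × V} (hx : x ∈ Ω)
    {s : ℝ} (hs : s < c) : HasDerivAt (fun s => f (Function.update x.1 i s, x.2))
      (Sm.dirD Ω (ei V i) f (Function.update x.1 i s, x.2)) s := by
  have h1 := (Sm.differentiableAt f (h.upd x hx s hs)).hasFDerivAt
  have h2 : HasDerivAt (fun s : ℝ => (Function.update x.1 i s, x.2)) (ei V i) s :=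
    (hasDerivAt_update x.1 i s).prodMk (hasDerivAt_const s x.2)
  rw [Sm.dirD_apply _ _ (h.upd x hx s hs)]
  exact h1.comp_hasDerivAt s h2

theorem IsHalf.eq_update (h : IsHalf Ω i c) {b : Sm Ω} (hb : Sm.dirD Ω (ei V i) b = 0)
    {x : (Fin m → ℝ) × V} (hx : x ∈ Ω) {s : ℝ} (hs : s < c) :
    b (Function.update x.1 i s, x.2) = b x := by
  have h1 : ∀ s < c, HasDerivAt (fun s => b (Function.update x.1 i s, x.2)) 0 s := by
    intro s hs
    have := h.hasDerivAt b hx hs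
    rwa [hb, Sm.zero_apply] at this
  have h2 := isOpen_Iio.is_const_of_deriv_eq_zero (s := Iio c) isPreconnected_Iio
    (f := fun s => b (Function.update x.1 i s, x.2))
    (fun s hs => (h1 s hs).differentiableAt.differentiableWithinAt)
    (fun s hs => (h1 s hs).deriv) (mem_Iio.2 hs) (mem_Iio.2 (h.lt x hx))
  simpa using h2

theorem lin_update_point (w : Fin m → ℝ) (i : Fin m) (s : ℝ) (x : (Fin m → ℝ) × V) :
    lin w (Function.update x.1 i s, x.2) = lin (Function.update w i 0) x + w i * s := by
  rw [lin_update]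
  have : lin w (Function.update x.1 i s, x.2) - lin w x = w i * (s - x.1 i) := by
    rw [lin, lin, ← Finset.sum_sub_distrib,
      Finset.sum_eq_single i (fun l _ hl => by simp [hl]) (by simp)]
    simp
    ring
  linarith

theorem add_smul_ei (i : Fin m) (t : ℝ) (x : (Fin m → ℝ) × V) :
    x + t • ei V i = (Function.update x.1 i (x.1 i + t), x.2) := by
  refine Prod.ext ?_ (by simp [ei])
  funext l
  by_cases hl : l = i
  · subst hl
    simp [ei]
  · simp [ei, hl]

/-- A function constant along the coordinate `i` equals its translate to the slice `τ i = c - 1`,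
where `ρ i` to any power is just a constant. Hence its weight in `ρ i` may be taken to be `0`. -/
theorem IsHalf.const_mem_Sym (h : IsHalf Ω i c) {b : Sm Ω} (hb : Sm.dirD Ω (ei V i) b = 0)
    {w : Fin m → ℝ} (hw : b ∈ Sym Ω (lin w)) : b ∈ Sym Ω (lin (Function.update w i 0)) := by
  intro j
  obtain ⟨C, hC⟩ := hw j
  refine ⟨C * Real.exp (w i * (c - 1)), fun x hx => ?_⟩
  have hx' := h.upd x hx (c - 1) (by linarith)
  have h1 : (b : (Fin m → ℝ) × V → ℂ) =ᶠ[nhds x] fun y => b (y + (c - 1 - x.1 i) • ei V i) := by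
    have h2 : ∀ᶠ y : (Fin m → ℝ) × V in nhds x, y.1 i + (c - 1 - x.1 i) < c := by
      have : ContinuousAt (fun y : (Fin m → ℝ) × V => y.1 i + (c - 1 - x.1 i)) x := by fun_prop
      exact this.eventually_lt continuousAt_const (by linarith)
    filter_upwards [h2, Ω.isOpen.mem_nhds hx] with y hy1 hy2
    rw [add_smul_ei]
    exact (h.eq_update hb hy2 hy1).symm
  rw [(h1.iteratedFDeriv ℝ j).eq_of_nhds, iteratedFDeriv_comp_add_right, mul_assoc,
    ← Real.exp_add]
  rw [add_smul_ei, add_sub_cancel, add_comm, ← lin_update_point]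
  exact hC _ hx'

theorem expMul_mem_lin {w : Fin m → ℝ} {f : Sm Ω} (hf : f ∈ Sym Ω (lin w)) (i : Fin m) (z : ℂ) :
    expMul Ω (coordL V i z) f ∈ Sym Ω (lin (Function.update w i (w i + z.re))) := by
  refine Sym_mono (c := 0) (fun x _ => le_of_eq ?_) (expMul_mem_Sym _ hf)
  rw [lin_update]
  simp
  ring

theorem expMul_neg (i : Fin m) (z : ℂ) (f : Sm Ω) :
    expMul Ω (coordL V i z) (expMul Ω (coordL V i (-z)) f) = f := by
  refine Sm.ext' fun x hx => ?_
  rw [expMul_apply, expMul_apply, ← mul_assoc, ← Complex.exp_add]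
  simp

theorem expMul_neg' (i : Fin m) (z : ℂ) (f : Sm Ω) :
    expMul Ω (coordL V i (-z)) (expMul Ω (coordL V i z) f) = f := by
  simpa using expMul_neg i (-z) f

/-- A function killed by `D - z` which decays faster than `ρ ^ z` vanishes. -/
theorem IsHalf.eq_zero_of_dirD (h : IsHalf Ω i c) {w : Fin m → ℝ} (hw : 0 < w i) {g : Sm Ω}
    (hg : g ∈ Sym Ω (lin w)) (hD : Sm.dirD Ω (ei V i) g = 0) : g = 0 := by
  refine Sm.ext' fun x hx => ?_
  obtain ⟨C, hC⟩ := hg 0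
  have h1 : ∀ s < c, ‖g x‖ ≤ C * Real.exp (lin (Function.update w i 0) x + w i * s) := by
    intro s hs
    have := hC _ (h.upd x hx s hs)
    rwa [norm_iteratedFDeriv_zero, h.eq_update hD hx hs, lin_update_point] at this
  have h2 : Filter.Tendsto (fun s => C * Real.exp (lin (Function.update w i 0) x + w i * s))
      Filter.atBot (nhds (C * 0)) := by
    refine Filter.Tendsto.const_mul _ (Real.tendsto_exp_atBot.comp ?_)
    exact Filter.tendsto_atBot_add_const_left _ _ (Filter.tendsto_id.const_mul_atBot hw)
  have h3 : ‖g x‖ ≤ C * 0 :=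
    ge_of_tendsto h2 ((Filter.eventually_lt_atBot c).mono fun s hs => h1 s hs)
  rw [Sm.zero_apply]
  simpa using h3

/-- The factors are removed one at a time: after conjugation by `ρ ^ z`, a function killed by `D -
z` is constant along `i`, yet it still tends to zero as `ρ i → 0`. -/
theorem IsHalf.eq_zero_of_aeval (h : IsHalf Ω i c) {w : Fin m → ℝ} (F : Finset (ℂ × ℕ))
    (hF : ∀ t ∈ F, t.1.re < w i) {g : Sm Ω} (hg : g ∈ Sym Ω (lin w))
    (hD : aeval (Sm.dirD Ω (ei V i)) (expPoly F) g = 0) : g = 0 := by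
  induction F using Finset.induction_on generalizing g with
  | empty => simpa [expPoly] using hD
  | insert a F ha ih =>
    refine ih (fun t ht => hF t (Finset.mem_insert_of_mem ht)) hg ?_
    rw [expPoly, Finset.prod_insert ha, aeval_mul_apply] at hD
    set k := aeval (Sm.dirD Ω (ei V i)) (expPoly F) g with hk
    have hkS : k ∈ Sym Ω (lin w) := aeval_mem_Sym _ _ hg
    change aeval (Sm.dirD Ω (ei V i)) (X - C a.1) k = 0 at hD
    rw [← expMul_neg i a.1 k, aeval_expMul] at hD
    have h1 : Sm.dirD Ω (ei V i) (expMul Ω (coordL V i (-a.1)) k) = 0 := by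
      rw [← expMul_neg' i a.1 (Sm.dirD Ω (ei V i) (expMul Ω (coordL V i (-a.1)) k)), hD, map_zero]
    have h2 := h.eq_zero_of_dirD (w := Function.update w i (w i + (-a.1).re))
      (by simpa using hF a (Finset.mem_insert_self _ _)) (expMul_mem_lin hkS i (-a.1)) h1
    rw [← expMul_neg i a.1 k, h2, map_zero]

/-- Integration from `ρ = 0`. -/
theorem IsHalf.exists_dirD_eq (h : IsHalf Ω i c) {w : Fin m → ℝ} (hw : 0 < w i) {g : Sm Ω}
    (hg : g ∈ Sym Ω (lin w)) : ∃ r ∈ Sym Ω (lin w), Sm.dirD Ω (ei V i) r = g := by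
  have hshift : ∀ (x : (Fin m → ℝ) × V) (t : ℝ),
      x + t • (-ei V i) = (Function.update x.1 i (x.1 i - t), x.2) := by
    intro x t
    rw [smul_neg, ← neg_smul, add_smul_ei, sub_eq_add_neg]
  have hα : ∀ x ∈ Ω, ∀ t : ℝ, 0 < t → x + t • (-ei V i) ∈ Ω := by
    intro x hx t ht
    rw [hshift]
    exact h.upd x hx _ (by linarith [h.lt x hx])
  have hlin : ∀ (x : (Fin m → ℝ) × V) (t : ℝ), lin w (x + t • (-ei V i)) = lin w x - w i * t := by
    intro x t
    rw [hshift, lin_update_point, lin_update]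
    ring
  have hk : ContinuousOn (fun _ : ℝ => (1 : ℂ)) (Ioi 0) := continuousOn_const
  have hwc : ContinuousOn (lin w : (Fin m → ℝ) × V → ℝ) Ω := (continuous_lin w).continuousOn
  choose C hC using hg
  have hdom : g ∈ rayDom hα (fun _ : ℝ => (1 : ℂ)) (lin w) := by
    refine ⟨fun j t => C j * Real.exp (-(w i) * t), Sm.smooth g, fun j => ?_, fun j x hx t ht => ?_⟩
    · have := (integrableOn_exp_mul_Ioi (a := -(w i)) (by linarith) 0).const_mul (C j)
      refine this.congr (Filter.Eventually.of_forall fun t => ?_)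
      simp
    · refine (hC j _ (hα x hx t ht)).trans (le_of_eq ?_)
      rw [hlin, sub_eq_add_neg, Real.exp_add]
      ring_nf
  -- The primitive from `τ i = -∞`, written as an integral along the ray in the direction `-ei V i`;
  -- it converges because `w i > 0`.
  refine ⟨rayInt Ω Ω (-ei V i) (fun _ => 1) g, rayInt_mem_Sym hα hk hwc hdom, ?_⟩
  rw [← rayInt_dirD hα hk hwc _ hdom]
  refine Sm.ext' fun x hx => ?_
  have hdom' := dirD_mem_rayDom hα (ei V i) g hdom
  rw [rayInt_apply hα hk hwc hdom' hx]
  have hint : IntegrableOn (fun t : ℝ => (1 : ℂ) • Sm.dirD Ω (ei V i) g (x + t • (-ei V i)))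
      (Ioi 0) := by
    obtain ⟨β, hβ⟩ := hdom'
    exact hβ.integrableOn hα hk hx
  have hder : ∀ t : ℝ, 0 ≤ t → HasDerivAt (fun t => - g (x + t • (-ei V i)))
      ((1 : ℂ) • Sm.dirD Ω (ei V i) g (x + t • (-ei V i))) t := by
    intro t ht
    have h1 := h.hasDerivAt g hx (s := x.1 i - t) (by linarith [h.lt x hx])
    have h2 : HasDerivAt (fun t => -g (Function.update x.1 i (x.1 i - t), x.2)) _ t :=
      (h1.scomp t ((hasDerivAt_id t).const_sub (x.1 i))).neg
    simp only [hshift]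
    simpa using h2
  have h0 := integral_Ioi_of_hasDerivAt_of_tendsto (m := 0)
    (hder 0 le_rfl).continuousAt.continuousWithinAt (fun t ht => hder t (le_of_lt ht)) hint ?_
  · rw [h0]
    simp
  · have h1 : Filter.Tendsto (fun t => C 0 * Real.exp (lin w x + -(w i * t))) Filter.atTop
        (nhds (C 0 * 0)) := by
      refine Filter.Tendsto.const_mul _ (Real.tendsto_exp_atBot.comp ?_)
      refine Filter.tendsto_atBot_add_const_left _ _ (Filter.tendsto_neg_atTop_atBot.comp ?_)
      exact Filter.tendsto_id.const_mul_atTop hw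
    rw [mul_zero] at h1
    refine squeeze_zero_norm' ?_ h1
    filter_upwards [Filter.eventually_gt_atTop 0] with t ht
    have := hC 0 _ (hα x hx t ht)
    rw [norm_iteratedFDeriv_zero, hlin] at this
    rwa [norm_neg]

/-- For each factor `D - z`, conjugation by `ρ ^ z` leaves a positive weight `w i - Re z`, so one
can integrate from `ρ = 0` without losing decay. -/
theorem IsHalf.exists_aeval_eq (h : IsHalf Ω i c) {w : Fin m → ℝ} (F : Finset (ℂ × ℕ))
    (hF : ∀ t ∈ F, t.1.re < w i) {g : Sm Ω} (hg : g ∈ Sym Ω (lin w)) :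
    ∃ r ∈ Sym Ω (lin w), aeval (Sm.dirD Ω (ei V i)) (expPoly F) r = g := by
  induction F using Finset.induction_on generalizing g with
  | empty => exact ⟨g, hg, by simp [expPoly]⟩
  | insert a F ha ih =>
    have h1 := expMul_mem_lin hg i (-a.1)
    obtain ⟨k, hk, hkD⟩ := h.exists_dirD_eq (w := Function.update w i (w i + (-a.1).re))
      (by simpa using hF a (Finset.mem_insert_self _ _)) h1
    have h2 := expMul_mem_lin hk i a.1
    have h3 : Function.update (Function.update w i (w i + (-a.1).re)) i
        (Function.update w i (w i + (-a.1).re) i + a.1.re) = w := by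
      simp
    rw [h3] at h2
    obtain ⟨r, hr, hrD⟩ := ih (fun t ht => hF t (Finset.mem_insert_of_mem ht)) h2
    refine ⟨r, hr, ?_⟩
    rw [expPoly, Finset.prod_insert ha, aeval_mul_apply]
    change aeval (Sm.dirD Ω (ei V i)) (X - C a.1) (aeval (Sm.dirD Ω (ei V i)) (expPoly F) r) = g
    rw [hrD, aeval_expMul, hkD, expMul_neg]

end HalfDomain

/-! ### Sets of exponents -/

/-- A finite set of exponents closed under lowering the power of the logarithm. -/
def LogClosed (F : Finset (ℂ × ℕ)) : Prop := ∀ t ∈ F, ∀ q ≤ t.2, (t.1, q) ∈ F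

/-- The number of powers of the logarithm at the exponent `z`. -/
def mult (F : Finset (ℂ × ℕ)) (z : ℂ) : ℕ := (F.filter fun t => t.1 = z).card

/-- The powers of the logarithm at a fixed exponent form an initial segment of `ℕ`, hence are
determined by their number. -/
theorem LogClosed.filter_eq {F : Finset (ℂ × ℕ)} (hF : LogClosed F) (z : ℂ) :
    F.filter (fun t => t.1 = z) = (Finset.range (mult F z)).image fun p => (z, p) := by
  have hsub : F.filter (fun t => t.1 = z) ⊆ (Finset.range (mult F z)).image fun p => (z, p) := by
    rintro ⟨a, p⟩ ht
    obtain ⟨h1, rfl⟩ := Finset.mem_filter.1 ht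
    refine Finset.mem_image.2 ⟨p, Finset.mem_range.2 ?_, rfl⟩
    have : (Finset.range (p + 1)).image (fun q => (a, q)) ⊆ F.filter (fun t => t.1 = a) := by
      intro s hs
      obtain ⟨q, hq, rfl⟩ := Finset.mem_image.1 hs
      exact Finset.mem_filter.2 ⟨hF _ h1 q (by simpa [Nat.lt_succ_iff] using hq), rfl⟩
    have := Finset.card_le_card this
    rw [Finset.card_image_of_injective _ (fun x y h => by simpa using h), Finset.card_range] at this
    exact this
  refine Finset.eq_of_subset_of_card_le hsub ?_
  refine Finset.card_image_le.trans ?_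
  rw [Finset.card_range, mult]

theorem LogClosed.sum_eq {A : Type*} [AddCommMonoid A] {F : Finset (ℂ × ℕ)} (hF : LogClosed F)
    (f : ℂ × ℕ → A) :
    ∑ t ∈ F, f t = ∑ z ∈ F.image Prod.fst, ∑ p ∈ Finset.range (mult F z), f (z, p) := by
  rw [← Finset.sum_fiberwise_of_maps_to (g := Prod.fst) (t := F.image Prod.fst)
    (fun t ht => Finset.mem_image_of_mem _ ht)]
  refine Finset.sum_congr rfl fun z _ => ?_
  rw [hF.filter_eq z, Finset.sum_image (by simp)]

theorem expPoly_eq (F : Finset (ℂ × ℕ)) :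
    expPoly F = ∏ z ∈ F.image Prod.fst, (X - C z) ^ mult F z :=
  Finset.prod_comp (fun z => (X - C z : ℂ[X])) Prod.fst

theorem LogClosed.mem {F : Finset (ℂ × ℕ)} (hF : LogClosed F) {t : ℂ × ℕ} (ht : t ∈ F) :
    t.1 ∈ F.image Prod.fst ∧ t.2 ∈ Finset.range (mult F t.1) := by
  refine ⟨Finset.mem_image_of_mem _ ht, ?_⟩
  have : t ∈ F.filter fun s => s.1 = t.1 := Finset.mem_filter.2 ⟨ht, rfl⟩
  rw [hF.filter_eq] at this
  obtain ⟨p, hp, hpt⟩ := Finset.mem_image.1 this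
  rwa [← hpt]

theorem LogClosed.filter_re_lt {F : Finset (ℂ × ℕ)} (hF : LogClosed F) (M : ℝ) :
    LogClosed (F.filter fun t => t.1.re < M) := by
  intro t ht q hq
  rw [Finset.mem_filter] at ht ⊢
  exact ⟨hF t ht.1 q hq, ht.2⟩

/-! ### Existence and uniqueness of finite expansions in one coordinate -/

section HalfDomain

variable {m : ℕ} {V : Type} [NormedAddCommGroup V] [NormedSpace ℝ V]
variable {Ω : Opens ((Fin m → ℝ) × V)} {i : Fin m} {c : ℝ}

theorem Sym_lin_mono (hbd : ∃ C : ℝ, ∀ x ∈ Ω, ∀ l, x.1 l ≤ C) {w w' : Fin m → ℝ}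
    (h : ∀ l, w' l ≤ w l) : Sym Ω (lin w) ≤ Sym Ω (lin w') := by
  obtain ⟨C, hC⟩ := hbd
  refine Sym_mono (c := ∑ l, (w l - w' l) * C) fun x hx => ?_
  rw [lin, lin, ← Finset.sum_add_distrib]
  refine Finset.sum_le_sum fun l _ => ?_
  have := mul_le_mul_of_nonneg_left (hC x hx l) (sub_nonneg.2 (h l))
  linarith

/-- A function whose derivative along `i` is `O(ρ ^ M)`, with `M < 0`, is itself `O(ρ ^ M)`. -/
theorem IsHalf.mem_of_dirD_mem (h : IsHalf Ω i c) {w : Fin m → ℝ} {M : ℝ} (hM : M < 0) {f : Sm Ω}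
    (hf : f ∈ Sym Ω (lin w))
    (hD : Sm.dirD Ω (ei V i) f ∈ Sym Ω (lin (Function.update w i M))) :
    f ∈ Sym Ω (lin (Function.update w i M)) := by
  intro j
  obtain ⟨C, hC⟩ := hf j
  obtain ⟨C', hC'⟩ := hD j
  set s₀ := c - 1 with hs₀
  refine ⟨|C| * Real.exp (|w i - M| * (|c| + 1)) + |C| * Real.exp (w i * s₀ - M * s₀) +
    |C'| / (-M), fun x hx => ?_⟩
  have hMpos : 0 < -M := by linarith
  -- For `τ i` between `s₀ = c - 1` and `c` all powers of `ρ i` are comparable. Below `s₀` the bound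
  -- is propagated from `s₀` by means of the derivative.
  rcases le_or_gt s₀ (x.1 i) with hxs | hxs
  · have h1 : |x.1 i| ≤ |c| + 1 := by
      have h2 := h.lt x hx
      rw [abs_le]
      constructor
      · linarith [neg_abs_le c]
      · linarith [le_abs_self c]
    have h3 : lin w x ≤ lin (Function.update w i M) x + |w i - M| * (|c| + 1) := by
      rw [lin_update]
      have : (w i - M) * x.1 i ≤ |w i - M| * (|c| + 1) :=
        (le_abs_self _).trans (by rw [abs_mul]; gcongr)
      linarith
    have h4 : ‖iteratedFDeriv ℝ j f x‖ ≤ |C| * Real.exp (|w i - M| * (|c| + 1)) *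
        Real.exp (lin (Function.update w i M) x) := by
      refine (hC x hx).trans ?_
      rw [mul_assoc, ← Real.exp_add, add_comm (|w i - M| * _)]
      gcongr
      exact le_abs_self C
    refine h4.trans ?_
    gcongr
    rw [add_assoc]
    exact le_add_of_nonneg_right (by positivity)
  · set L := lin (Function.update w i 0) x with hL
    have hLM : lin (Function.update w i M) x = L + M * x.1 i := by
      rw [hL, lin_update, lin_update]
      ring
    set A := iteratedFDeriv ℝ j (f : (Fin m → ℝ) × V → ℂ) with hA
    set γ : ℝ → (Fin m → ℝ) × V := fun s => (Function.update x.1 i s, x.2) with hγ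
    have hγΩ : ∀ s < c, γ s ∈ Ω := h.upd x hx
    have hder : ∀ s < c, ∃ A', HasDerivAt (fun s => A (γ s)) A' s ∧
        ‖A'‖ ≤ |C'| * Real.exp (L + M * s) := by
      intro s hs
      have h1 : DifferentiableAt ℝ A (γ s) := by
        have := (Sm.smoothAt f (hγΩ s hs)).iteratedFDeriv_right (i := j) (m := ∞) (by
          exact_mod_cast le_of_eq (top_add (a := (j : ℕ∞))))
        exact this.differentiableAt (by simp)
      have h2 : HasDerivAt γ (ei V i) s :=
        (hasDerivAt_update x.1 i s).prodMk (hasDerivAt_const s x.2)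
      refine ⟨_, h1.hasFDerivAt.comp_hasDerivAt s h2, ?_⟩
      rw [hA, fderiv_iteratedFDeriv_apply Ω.isOpen (Sm.smooth f) _ _ _ (hγΩ s hs)]
      have h3 : (Sm.dirD Ω (ei V i) f : (Fin m → ℝ) × V → ℂ) =ᶠ[nhds (γ s)]
          fun y => fderiv ℝ f y (ei V i) :=
        Filter.eventually_of_mem (Ω.isOpen.mem_nhds (hγΩ s hs)) fun y hy => Sm.dirD_apply _ _ hy
      rw [← (h3.iteratedFDeriv ℝ j).eq_of_nhds]
      refine (hC' _ (hγΩ s hs)).trans ?_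
      rw [lin_update_point]
      simp only [Function.update_idem, Function.update_self]
      gcongr
      exact le_abs_self _
    choose! A' hA' hA'b using hder
    -- Going down from `s₀` to `x.1 i`, the growth is compared with the primitive `B` of the bound
    -- on the derivative. As `M < 0`, both the initial value and this primitive are `O(exp (M * τ
    -- i))`.
    have hfin := image_norm_le_of_norm_deriv_right_le_deriv_boundary (a := 0) (b := s₀ - x.1 i)
      (f := fun y => A (γ (s₀ - y))) (f' := fun y => -A' (s₀ - y))
      (B := fun y => |C| * Real.exp (L + w i * s₀) +
        |C'| / (-M) * Real.exp (L + M * (s₀ - y)))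
      (B' := fun y => |C'| * Real.exp (L + M * (s₀ - y))) ?_ ?_ ?_ ?_ ?_
      (x := s₀ - x.1 i) ⟨by linarith, le_rfl⟩
    · have hx0 : γ (s₀ - (s₀ - x.1 i)) = x := by simp [hγ]
      simp only [hx0] at hfin
      refine hfin.trans ?_
      rw [sub_sub_cancel, hLM, add_mul, add_mul]
      have e1 : |C| * Real.exp (L + w i * s₀) ≤
          |C| * Real.exp (w i * s₀ - M * s₀) * Real.exp (L + M * x.1 i) := by
        rw [mul_assoc, ← Real.exp_add]
        refine mul_le_mul_of_nonneg_left (Real.exp_le_exp.2 ?_) (abs_nonneg _)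
        nlinarith [mul_pos_of_neg_of_neg hM (sub_neg.2 hxs)]
      have e2 : 0 ≤ |C| * Real.exp (|w i - M| * (|c| + 1)) * Real.exp (L + M * x.1 i) := by
        positivity
      linarith
    · intro y hy
      have := (hA' (s₀ - y) (by linarith [hy.1])).scomp y ((hasDerivAt_id y).const_sub s₀)
      exact this.continuousAt.continuousWithinAt
    · intro y hy
      have := (hA' (s₀ - y) (by linarith [hy.1])).scomp y ((hasDerivAt_id y).const_sub s₀)
      simp only [neg_smul, one_smul] at this
      exact this.hasDerivWithinAt
    · simp only [sub_zero]
      refine (hC _ (hγΩ s₀ (by linarith))).trans ?_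
      rw [lin_update_point]
      have : 0 ≤ |C'| / (-M) * Real.exp (L + M * s₀) := by positivity
      have : C * Real.exp (L + w i * s₀) ≤ |C| * Real.exp (L + w i * s₀) := by
        gcongr
        exact le_abs_self _
      linarith
    · intro y
      have h1 : HasDerivAt (fun y => L + M * (s₀ - y)) (-M) y := by
        have := (((hasDerivAt_id y).const_sub s₀).const_mul M).const_add L
        simpa using this
      have h2 := (h1.exp.const_mul (|C'| / (-M))).const_add (|C| * Real.exp (L + w i * s₀))
      refine h2.congr_deriv ?_
      have hM' : -M ≠ 0 := (neg_pos.2 hM).ne'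
      rw [mul_comm (Real.exp _), ← mul_assoc, div_mul_cancel₀ _ hM']
    · intro y hy
      rw [norm_neg]
      exact hA'b _ (by linarith [hy.1])

/-- A factor `D - z` with `Re z > M` does not obstruct order `M`: after conjugation by `ρ ^ (-z)`
the weight `M - Re z` is negative, and `IsHalf.mem_of_dirD_mem` applies. -/
theorem IsHalf.mem_of_aeval_mem (h : IsHalf Ω i c) {w : Fin m → ℝ} {M : ℝ}
    (F : Finset (ℂ × ℕ)) (hF : ∀ t ∈ F, M < t.1.re) {f : Sm Ω}
    (hf : f ∈ Sym Ω (lin w))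
    (hD : aeval (Sm.dirD Ω (ei V i)) (expPoly F) f ∈ Sym Ω (lin (Function.update w i M))) :
    f ∈ Sym Ω (lin (Function.update w i M)) := by
  induction F using Finset.induction_on with
  | empty => simpa [expPoly] using hD
  | insert a F ha ih =>
    refine ih (fun t ht => hF t (Finset.mem_insert_of_mem ht)) ?_
    rw [expPoly, Finset.prod_insert ha, aeval_mul_apply] at hD
    change aeval (Sm.dirD Ω (ei V i)) (X - C a.1) (aeval (Sm.dirD Ω (ei V i)) (expPoly F) f) ∈ _
      at hD
    set k := aeval (Sm.dirD Ω (ei V i)) (expPoly F) f with hk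
    have hkS : k ∈ Sym Ω (lin w) := aeval_mem_Sym _ _ hf
    rw [← expMul_neg i a.1 k, aeval_expMul] at hD
    have h1 := expMul_mem_lin hD i (-a.1)
    rw [expMul_neg'] at h1
    have h2 := expMul_mem_lin hkS i (-a.1)
    have h3 := h.mem_of_dirD_mem (w := Function.update w i (w i + (-a.1).re))
      (M := M - a.1.re) (by linarith [hF a (Finset.mem_insert_self _ _)]) h2 (by
        convert h1 using 3
        simp [sub_eq_add_neg])
    have h4 := expMul_mem_lin h3 i a.1
    rw [expMul_neg] at h4
    convert h4 using 3
    simp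

/-- On a half line bounded above, `|τ i|` is at most a constant times `exp (-τ i)`: a logarithm
costs at most one power of `ρ i`. This crude loss is recovered later. -/
theorem IsHalf.coordMul_mem (h : IsHalf Ω i c) {w : Fin m → ℝ} {f : Sm Ω}
    (hf : f ∈ Sym Ω (lin w)) :
    coordMul Ω i f ∈ Sym Ω (lin (Function.update w i (w i - 1))) := by
  have h1 : Sm.of Ω (coordL V i 1) (coordL V i 1).contDiff.contDiffOn ∈
      Sym Ω (fun x => -x.1 i) := by
    intro j
    rcases Nat.eq_zero_or_pos j with rfl | hj
    · refine ⟨1 + |c| * Real.exp |c|, fun x hx => ?_⟩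
      rw [norm_iteratedFDeriv_zero, Sm.of_apply hx, coordL_apply, mul_one, Complex.norm_real,
        Real.norm_eq_abs]
      have hc := h.lt x hx
      rcases le_total (x.1 i) 0 with h0 | h0
      · rw [abs_of_nonpos h0]
        have e1 := Real.add_one_le_exp (-x.1 i)
        have e2 : 0 ≤ |c| * Real.exp |c| * Real.exp (-x.1 i) := by positivity
        linarith
      · rw [abs_of_nonneg h0]
        have e1 : |c| * 1 ≤ |c| * Real.exp (|c| + -x.1 i) := by
          gcongr
          exact Real.one_le_exp (by linarith [le_abs_self c])
        rw [Real.exp_add, ← mul_assoc] at e1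
        have e2 := Real.exp_pos (-x.1 i)
        linarith [le_abs_self c]
    · obtain ⟨C, hC⟩ := bounded_iteratedFDeriv_clm (coordL V i 1) j hj
      refine ⟨|C| * Real.exp c, fun x hx => ?_⟩
      rw [((Sm.of_eventuallyEq hx).iteratedFDeriv ℝ j).eq_of_nhds, mul_assoc, ← Real.exp_add]
      have := Real.one_le_exp (x := c + -x.1 i) (by linarith [h.lt x hx])
      calc _ ≤ |C| * 1 := by rw [mul_one]; exact (hC x).trans (le_abs_self C)
        _ ≤ _ := by gcongr
  refine Sym_mono (c := 0) (fun x _ => le_of_eq ?_) (mulSm_mem_Sym h1 hf)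
  rw [lin_update]
  ring

theorem IsHalf.coordMul_pow_mem (h : IsHalf Ω i c) {w : Fin m → ℝ} {f : Sm Ω}
    (hf : f ∈ Sym Ω (lin w)) (p : ℕ) :
    (coordMul Ω i ^ p) f ∈ Sym Ω (lin (Function.update w i (w i - p))) := by
  induction p with
  | zero => simpa using hf
  | succ p ih =>
    rw [pow_succ', Module.End.mul_apply]
    have := h.coordMul_mem ih
    simp only [Function.update_self, Function.update_idem] at this
    convert this using 3
    push_cast
    ring_nf

/-- Solutions of `D ^ n g = 0` are polynomials in the logarithm. -/
theorem IsHalf.kernel_pow (h : IsHalf Ω i c) (hbd : ∃ C : ℝ, ∀ x ∈ Ω, ∀ l, x.1 l ≤ C)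
    {w : Fin m → ℝ} (n : ℕ) : ∀ g ∈ Sym Ω (lin w), (Sm.dirD Ω (ei V i) ^ n) g = 0 →
    ∃ b : ℕ → Sm Ω, (∀ p, Sm.dirD Ω (ei V i) (b p) = 0 ∧
      b p ∈ Sym Ω (lin (Function.update w i 0))) ∧
      g = ∑ p ∈ Finset.range n, (coordMul Ω i ^ p) (b p) := by
  induction n with
  | zero =>
    intro g _ hD
    exact ⟨0, fun p => ⟨map_zero _, Submodule.zero_mem _⟩, by simpa using hD⟩
  | succ n ih =>
    intro g hg hD
    rw [pow_succ, Module.End.mul_apply] at hD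
    obtain ⟨b, hb, hbs⟩ := ih _ (dirD_mem_Sym _ g hg) hD
    -- Termwise integration: the derivative of `τ ^ (p + 1) / (p + 1)` is `τ ^ p`.
    set b' : ℕ → Sm Ω := fun p => ((p : ℂ) + 1)⁻¹ • b p with hb'
    have hb'D : ∀ p, Sm.dirD Ω (ei V i) (b' p) = 0 := fun p => by
      rw [hb', map_smul, (hb p).1, smul_zero]
    set g' : Sm Ω := g - ∑ p ∈ Finset.range n, (coordMul Ω i ^ (p + 1)) (b' p) with hg'
    have hD' : Sm.dirD Ω (ei V i) g' = 0 := by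
      rw [hg', map_sub, map_sum, sub_eq_zero, hbs]
      refine Finset.sum_congr rfl fun p _ => ?_
      rw [dirD_coordMul_pow i (hb'D p), hb']
      simp only [map_smul, smul_smul]
      rw [mul_inv_cancel₀ (by exact_mod_cast Nat.succ_ne_zero p), one_smul]
    -- The logarithms worsen the weight in `ρ i`, but only temporarily: `g'` is constant along `i`,
    -- so `IsHalf.const_mem_Sym` resets that weight to `0`. Then `g'` is the coefficient of the
    -- zeroth power.
    have hgS : g' ∈ Sym Ω (lin (Function.update w i (min (w i) (-n)))) := by
      refine Submodule.sub_mem _ (Sym_lin_mono hbd (fun l => ?_) hg)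
        (Submodule.sum_mem _ fun p hp => ?_)
      · by_cases hl : l = i
        · subst hl
          simp
        · simp [hl]
      · refine Sym_lin_mono hbd (fun l => ?_)
          (h.coordMul_pow_mem (Submodule.smul_mem _ _ (hb p).2) (p + 1))
        by_cases hl : l = i
        · subst hl
          have : ((p + 1 : ℕ) : ℝ) ≤ n := by exact_mod_cast Finset.mem_range.1 hp
          simp only [Function.update_self]
          refine (min_le_right _ _).trans ?_
          linarith
        · simp [hl]
    have hgS' := h.const_mem_Sym hD' hgS
    rw [Function.update_idem] at hgS'
    refine ⟨fun p => Nat.casesOn p g' b', fun p => ?_, ?_⟩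
    · cases p with
      | zero => exact ⟨hD', hgS'⟩
      | succ p => exact ⟨hb'D p, Submodule.smul_mem _ _ (hb p).2⟩
    · rw [Finset.sum_range_succ']
      simp [hg']

theorem dirD_pow_coordMul_pow_self {b : Sm Ω} (hb : Sm.dirD Ω (ei V i) b = 0) (n : ℕ) :
    (Sm.dirD Ω (ei V i) ^ n) ((coordMul Ω i ^ n) b) = (n.factorial : ℂ) • b := by
  induction n with
  | zero => simp
  | succ n ih =>
    rw [pow_succ, Module.End.mul_apply, dirD_coordMul_pow i hb, map_smul, ih, smul_smul,
      Nat.factorial_succ]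
    push_cast
    rfl

theorem dirD_pow_coordMul_pow_lt {b : Sm Ω} (hb : Sm.dirD Ω (ei V i) b = 0) {p n : ℕ}
    (hpn : p < n) : (Sm.dirD Ω (ei V i) ^ n) ((coordMul Ω i ^ p) b) = 0 := by
  obtain ⟨k, rfl⟩ := Nat.exists_eq_add_of_lt hpn
  rw [show p + k + 1 = k + (p + 1) by ring, pow_add, Module.End.mul_apply,
    dirD_pow_coordMul_pow i hb, map_zero]

/-- The `n`-th derivative of a polynomial of degree `n` in the logarithm isolates `n!` times its
leading coefficient; one descends from there. -/
theorem coordMul_pow_unique {b : ℕ → Sm Ω} (hb : ∀ p, Sm.dirD Ω (ei V i) (b p) = 0) (n : ℕ)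
    (hs : ∑ p ∈ Finset.range n, (coordMul Ω i ^ p) (b p) = 0) : ∀ p < n, b p = 0 := by
  induction n with
  | zero => simp
  | succ n ih =>
    have h1 := congrArg (Sm.dirD Ω (ei V i) ^ n) hs
    rw [Finset.sum_range_succ, map_add, map_sum, map_zero, Finset.sum_eq_zero, zero_add,
      dirD_pow_coordMul_pow_self (hb n)] at h1
    · have h2 : b n = 0 :=
        (smul_eq_zero.1 h1).resolve_left (by exact_mod_cast n.factorial_ne_zero)
      rw [Finset.sum_range_succ, h2, map_zero, add_zero] at hs
      intro p hp
      rcases Nat.lt_succ_iff_lt_or_eq.1 hp with hp | rfl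
      · exact ih hs p hp
      · exact h2
    · intro p hp
      exact dirD_pow_coordMul_pow_lt (hb p) (Finset.mem_range.1 hp)

/-- Uniqueness of asymptotic expansions. -/
theorem IsHalf.expansion_unique (h : IsHalf Ω i c) {F : Finset (ℂ × ℕ)} (hF : LogClosed F)
    {w : Fin m → ℝ} (hw : ∀ t ∈ F, t.1.re < w i) {a : ℂ × ℕ → Sm Ω}
    (ha : ∀ t, Sm.dirD Ω (ei V i) (a t) = 0)
    (hs : ∑ t ∈ F, termOp Ω i t (a t) ∈ Sym Ω (lin w)) : ∀ t ∈ F, a t = 0 := by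
  -- The sum is killed by the operator of its exponents and decays faster than each of them, so it
  -- is zero. Then the exponents are separated by coprimality and the powers of the logarithm by
  -- differentiation.
  have h0 : ∑ t ∈ F, termOp Ω i t (a t) = 0 := by
    refine h.eq_zero_of_aeval F hw hs ?_
    rw [map_sum]
    exact Finset.sum_eq_zero fun t ht =>
      aeval_termOp_eq_zero i (ha t) t (pow_dvd_expPoly (hF t ht))
  rw [hF.sum_eq] at h0
  intro t ht
  obtain ⟨h1, h2⟩ := hF.mem ht
  have h3 := decomposition_unique (D := Sm.dirD Ω (ei V i)) (mult F) (fun z hz => ?_) h0 t.1 h1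
  · have h4 : ∑ p ∈ Finset.range (mult F t.1), termOp Ω i (t.1, p) (a (t.1, p)) =
        expMul Ω (coordL V i t.1)
          (∑ p ∈ Finset.range (mult F t.1), (coordMul Ω i ^ p) (a (t.1, p))) := by
      rw [map_sum]
      rfl
    rw [h4] at h3
    have h5 := congrArg (expMul Ω (coordL V i (-t.1))) h3
    rw [expMul_neg', map_zero] at h5
    exact coordMul_pow_unique (fun p => ha (t.1, p)) _ h5 t.2 (Finset.mem_range.1 h2)
  · rw [map_sum]
    refine Finset.sum_eq_zero fun p hp => aeval_termOp_eq_zero i (ha (z, p)) (z, p) ?_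
    exact pow_dvd_pow _ (Finset.mem_range.1 hp)

/-- Coprimality splits the solution into pieces, one for each exponent `z`; multiplied by `ρ ^
(-z)`, such a piece is a polynomial in the logarithm. -/
theorem IsHalf.kernel_expPoly (h : IsHalf Ω i c) (hbd : ∃ C : ℝ, ∀ x ∈ Ω, ∀ l, x.1 l ≤ C)
    {F : Finset (ℂ × ℕ)} (hF : LogClosed F) {w : Fin m → ℝ} {s : Sm Ω} (hs : s ∈ Sym Ω (lin w))
    (hD : aeval (Sm.dirD Ω (ei V i)) (expPoly F) s = 0) :
    ∃ a : ℂ × ℕ → Sm Ω, (∀ t, Sm.dirD Ω (ei V i) (a t) = 0 ∧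
      a t ∈ Sym Ω (lin (Function.update w i 0))) ∧ s = ∑ t ∈ F, termOp Ω i t (a t) := by
  rw [expPoly_eq] at hD
  obtain ⟨σ, hσ, hsσ⟩ := exists_decomposition (dirD_mem_Sym (ei V i)) (mult F) _ s hs hD
  have hb : ∀ z, ∃ b : ℕ → Sm Ω, (∀ p, Sm.dirD Ω (ei V i) (b p) = 0 ∧
      b p ∈ Sym Ω (lin (Function.update w i 0))) ∧ (z ∈ F.image Prod.fst →
      σ z = ∑ p ∈ Finset.range (mult F z), termOp Ω i (z, p) (b p)) := by
    intro z
    by_cases hz : z ∈ F.image Prod.fst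
    · have h1 := (hσ z hz).2
      rw [← expMul_neg i z (σ z), aeval_expMul_pow] at h1
      have h2 := congrArg (expMul Ω (coordL V i (-z))) h1
      rw [expMul_neg', map_zero] at h2
      obtain ⟨b, hb, hbs⟩ := h.kernel_pow hbd _ _ (expMul_mem_lin (hσ z hz).1 i (-z)) h2
      rw [Function.update_idem] at hb
      refine ⟨b, hb, fun _ => ?_⟩
      rw [← expMul_neg i z (σ z), hbs, map_sum]
      rfl
    · exact ⟨0, fun p => ⟨map_zero _, Submodule.zero_mem _⟩, fun h => absurd h hz⟩
  choose b hb hbs using hb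
  refine ⟨fun t => b t.1 t.2, fun t => hb t.1 t.2, ?_⟩
  rw [hsσ, hF.sum_eq]
  exact Finset.sum_congr rfl fun z hz => hbs z hz

/-- Existence of finite expansions. -/
theorem IsHalf.exists_expansion (h : IsHalf Ω i c) (hbd : ∃ C : ℝ, ∀ x ∈ Ω, ∀ l, x.1 l ≤ C)
    {F : Finset (ℂ × ℕ)} (hF : LogClosed F) {w : Fin m → ℝ} {M : ℝ} (hwM : w i ≤ M)
    (hM : ∀ t ∈ F, t.1.re ≠ M) {f : Sm Ω} (hf : f ∈ Sym Ω (lin w))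
    (hD : aeval (Sm.dirD Ω (ei V i)) (expPoly F) f ∈ Sym Ω (lin (Function.update w i M))) :
    ∃ a : ℂ × ℕ → Sm Ω, (∀ t, Sm.dirD Ω (ei V i) (a t) = 0 ∧
      a t ∈ Sym Ω (lin (Function.update w i 0))) ∧
      f - ∑ t ∈ F.filter (fun t => t.1.re < M), termOp Ω i t (a t) ∈
        Sym Ω (lin (Function.update w i M)) := by
  -- Exponents beyond `M` can be dropped from the operator at once. The operator of those before `M`
  -- is inverted on functions of order `M`, which gives the remainder `r`; then `f - r` lies in its
  -- kernel and is a sum of terms.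
  set F₁ := F.filter fun t => t.1.re < M with hF₁
  set F₂ := F.filter fun t => ¬ t.1.re < M with hF₂
  have hP : expPoly F = expPoly F₂ * expPoly F₁ := by
    rw [mul_comm]
    exact (Finset.prod_filter_mul_prod_filter_not _ _ _).symm
  rw [hP, aeval_mul_apply] at hD
  have h1 : aeval (Sm.dirD Ω (ei V i)) (expPoly F₁) f ∈ Sym Ω (lin (Function.update w i M)) := by
    refine h.mem_of_aeval_mem F₂ (fun t ht => ?_) (aeval_mem_Sym _ _ hf) hD
    obtain ⟨h1, h2⟩ := Finset.mem_filter.1 ht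
    exact lt_of_le_of_ne (not_lt.1 h2) (hM t h1).symm
  obtain ⟨r, hr, hrD⟩ := h.exists_aeval_eq F₁ (w := Function.update w i M) (fun t ht => by
    simpa using (Finset.mem_filter.1 ht).2) h1
  have hr' : r ∈ Sym Ω (lin w) := by
    refine Sym_lin_mono hbd (fun l => ?_) hr
    by_cases hl : l = i
    · subst hl
      simpa using hwM
    · simp [hl]
  obtain ⟨a, ha, has⟩ := h.kernel_expPoly hbd (hF.filter_re_lt M) (s := f - r)
    (Submodule.sub_mem _ hf hr') (by rw [map_sub, hrD, sub_self])
  refine ⟨a, ha, ?_⟩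
  rw [← has, sub_sub_cancel]
  exact hr

end HalfDomain

/-! ### Infinite expansions -/

section Expansion

variable {m : ℕ} {V : Type} [NormedAddCommGroup V] [NormedSpace ℝ V]
variable {Ω : Opens ((Fin m → ℝ) × V)} {i : Fin m} {c : ℝ}

theorem lin_update_lin_le (w w' : Fin m → ℝ) (i : Fin m) {a a' : ℝ} (h : ∀ l, l ≠ i → w' l ≤ w l)
    (ha : a' ≤ a) : ∀ l, Function.update w' i a' l ≤ Function.update w i a l := by
  intro l
  by_cases hl : l = i
  · subst hl
    simpa using ha
  · simpa [hl] using h l hl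

theorem dirD_termOp {j : Fin m} (hij : j ≠ i) (t : ℂ × ℕ) (f : Sm Ω) :
    termOp Ω i t (Sm.dirD Ω (ei V j) f) = Sm.dirD Ω (ei V j) (termOp Ω i t f) := by
  have h0 : ∀ z : ℂ, coordL V i z (ei V j) = 0 := fun z => by simp [ei, hij.symm]
  have h1 : ∀ f : Sm Ω, coordMul Ω i (Sm.dirD Ω (ei V j) f) =
      Sm.dirD Ω (ei V j) (coordMul Ω i f) := by
    intro f
    refine Sm.ext' fun x hx => ?_
    rw [coordMul, dirD_mulSm _ _ (coordL V i 1).contDiff f hx, mulSm_apply,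
      ContinuousLinearMap.fderiv, h0, zero_mul, zero_add]
  have h2 : ∀ (p : ℕ) (f : Sm Ω), (coordMul Ω i ^ p) (Sm.dirD Ω (ei V j) f) =
      Sm.dirD Ω (ei V j) ((coordMul Ω i ^ p) f) := by
    intro p
    induction p with
    | zero => simp
    | succ p ih =>
      intro f
      rw [pow_succ', Module.End.mul_apply, ih, h1, Module.End.mul_apply]
  rw [termOp, Module.End.mul_apply, Module.End.mul_apply, dirD_expMul, h0, zero_smul, add_zero, h2]

/-- The crude bounds on logarithms give some order, possibly below `M`. The operator of the
exponents kills the sum, so `IsHalf.mem_of_aeval_mem` raises the order to `M`. -/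
theorem IsHalf.termOp_sum_mem (h : IsHalf Ω i c) (hbd : ∃ C : ℝ, ∀ x ∈ Ω, ∀ l, x.1 l ≤ C)
    {F : Finset (ℂ × ℕ)} {w : Fin m → ℝ} {M : ℝ} (hM : ∀ t ∈ F, M < t.1.re)
    (hF : LogClosed F) {a : ℂ × ℕ → Sm Ω} (ha : ∀ t, Sm.dirD Ω (ei V i) (a t) = 0)
    (haS : ∀ t, a t ∈ Sym Ω (lin (Function.update w i 0))) :
    ∑ t ∈ F, termOp Ω i t (a t) ∈ Sym Ω (lin (Function.update w i M)) := by
  have h1 : ∀ t : ℂ × ℕ, termOp Ω i t (a t) ∈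
      Sym Ω (lin (Function.update w i (t.1.re - t.2))) := by
    intro t
    have := expMul_mem_lin (h.coordMul_pow_mem (haS t) t.2) i t.1
    simp only [Function.update_self, Function.update_idem] at this
    rw [show 0 - (t.2 : ℝ) + t.1.re = t.1.re - t.2 by ring] at this
    exact this
  obtain ⟨r, hr⟩ : ∃ r : ℝ, ∀ t ∈ F, r ≤ t.1.re - t.2 := by
    obtain ⟨r, hr⟩ := (F.image fun t : ℂ × ℕ => t.1.re - t.2).bddBelow
    exact ⟨r, fun t ht => hr (Finset.mem_coe.2 (Finset.mem_image_of_mem _ ht))⟩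
  have h2 : ∑ t ∈ F, termOp Ω i t (a t) ∈ Sym Ω (lin (Function.update w i r)) :=
    Submodule.sum_mem _ fun t ht =>
      Sym_lin_mono hbd (lin_update_lin_le _ _ _ (fun _ _ => le_rfl) (hr t ht)) (h1 t)
  have h3 := h.mem_of_aeval_mem (M := M) F hM h2 (by
    rw [map_sum, Finset.sum_eq_zero]
    · exact Submodule.zero_mem _
    · exact fun t ht => aeval_termOp_eq_zero i (ha t) t (pow_dvd_expPoly (hF t ht)))
  rwa [Function.update_idem] at h3

theorem logClosed_upTo (E : IndexSet) (s : ℝ) : LogClosed (E.upTo s) :=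
  fun _ ht q hq => IndexSet.upTo_log_closed ht q hq

/-- There are no exponents slightly beyond `s`. -/
theorem IndexSet.exists_gap (E : IndexSet) (s : ℝ) :
    ∃ M, s < M ∧ M < s + 1 ∧ ∀ t ∈ E.carrier, s < t.1.re → M < t.1.re := by
  set G := (insert (s + 1) (((E.upTo (s + 1)).filter fun t => s < t.1.re).image fun t => t.1.re))
    with hG
  have hne : G.Nonempty := Finset.insert_nonempty _ _
  have hlt : s < G.min' hne := by
    rw [Finset.lt_min'_iff]
    intro y hy
    rcases Finset.mem_insert.1 hy with rfl | hy
    · linarith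
    · obtain ⟨t, ht, rfl⟩ := Finset.mem_image.1 hy
      exact (Finset.mem_filter.1 ht).2
  have hle : G.min' hne ≤ s + 1 := Finset.min'_le _ _ (Finset.mem_insert_self _ _)
  refine ⟨(s + G.min' hne) / 2, by linarith, by linarith, fun t ht hst => ?_⟩
  rcases le_or_gt t.1.re (s + 1) with h1 | h1
  · have : G.min' hne ≤ t.1.re := Finset.min'_le _ _ (Finset.mem_insert_of_mem
      (Finset.mem_image_of_mem _ (Finset.mem_filter.2 ⟨IndexSet.mem_upTo.2 ⟨ht, h1⟩, hst⟩)))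
    linarith
  · linarith

/-- Uniqueness of the expansion up to the order `s`. -/
theorem IsHalf.coeff_unique (h : IsHalf Ω i c) (hbd : ∃ C : ℝ, ∀ x ∈ Ω, ∀ l, x.1 l ≤ C)
    {E : IndexSet} {s M M' : ℝ} (hM : s < M) (hM' : s < M') {w w' : Fin m → ℝ} {f : Sm Ω}
    {a a' : ℂ × ℕ → Sm Ω} (ha : ∀ t, Sm.dirD Ω (ei V i) (a t) = 0)
    (ha' : ∀ t, Sm.dirD Ω (ei V i) (a' t) = 0)
    (hf : f - ∑ t ∈ E.upTo s, termOp Ω i t (a t) ∈ Sym Ω (lin (Function.update w i M)))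
    (hf' : f - ∑ t ∈ E.upTo s, termOp Ω i t (a' t) ∈ Sym Ω (lin (Function.update w' i M'))) :
    ∀ t ∈ E.upTo s, a t = a' t := by
  have h1 := h.expansion_unique (F := E.upTo s) (logClosed_upTo E s)
    (w := Function.update (fun l => min (w l) (w' l)) i (min M M')) (a := fun t => a t - a' t)
    (fun t ht => by
      have := (IndexSet.mem_upTo.1 ht).2
      simp only [Function.update_self]
      exact lt_min (by linarith) (by linarith))
    (fun t => by rw [map_sub, ha, ha', sub_zero]) (by
      have e1 : ∑ t ∈ E.upTo s, termOp Ω i t (a t - a' t) =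
          (f - ∑ t ∈ E.upTo s, termOp Ω i t (a' t)) -
            (f - ∑ t ∈ E.upTo s, termOp Ω i t (a t)) := by
        simp only [map_sub, Finset.sum_sub_distrib]
        abel
      rw [e1]
      exact Submodule.sub_mem _
        (Sym_lin_mono hbd (lin_update_lin_le _ _ _ (fun l _ => min_le_right _ _)
          (min_le_right _ _)) hf')
        (Sym_lin_mono hbd (lin_update_lin_le _ _ _ (fun l _ => min_le_left _ _)
          (min_le_left _ _)) hf))
  exact fun t ht => sub_eq_zero.1 (h1 t ht)

/-- If `f` is annihilated, up to any order, by the operators belonging to an index set, then it has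
an expansion. -/
theorem IsHalf.exists_full_expansion (h : IsHalf Ω i c)
    (hbd : ∃ C : ℝ, ∀ x ∈ Ω, ∀ l, x.1 l ≤ C) (E : IndexSet) {w : Fin m → ℝ} {f : Sm Ω}
    (hf : f ∈ Sym Ω (lin w)) (hD : ∀ N : ℕ, ∃ K : ℕ,
      aeval (Sm.dirD Ω (ei V i)) (expPoly (E.upTo K)) f ∈ Sym Ω (lin (Function.update w i N))) :
    ∃ a : ℂ × ℕ → Sm Ω, (∀ t, Sm.dirD Ω (ei V i) (a t) = 0 ∧
      a t ∈ Sym Ω (lin (Function.update w i 0))) ∧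
      ∀ N : ℕ, ∃ M : ℝ, N < M ∧
        f - ∑ t ∈ E.upTo N, termOp Ω i t (a t) ∈ Sym Ω (lin (Function.update w i M)) := by
  -- An expansion is first found separately for each `N`, with a remainder of order strictly above
  -- `N`; strictness is what makes the coefficients up to order `N` unique.
  have hex : ∀ N : ℕ, ∃ M : ℝ, N < M ∧ (∀ t ∈ E.carrier, (N : ℝ) < t.1.re → M < t.1.re) ∧
      ∃ a : ℂ × ℕ → Sm Ω, (∀ t, Sm.dirD Ω (ei V i) (a t) = 0 ∧
        a t ∈ Sym Ω (lin (Function.update w i 0))) ∧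
        f - ∑ t ∈ E.upTo N, termOp Ω i t (a t) ∈ Sym Ω (lin (Function.update w i M)) := by
    intro N
    obtain ⟨M, hM1, hM2, hM3⟩ := E.exists_gap N
    refine ⟨M, hM1, hM3, ?_⟩
    obtain ⟨K, hK⟩ := hD (N + 1)
    have hK' := aeval_mem_Sym_of_dvd
      (expPoly_dvd (E.upTo_mono (le_max_left (K : ℝ) (N + 1)))) hK
    have hcmp : ∀ t ∈ E.carrier, t.1.re < M ↔ t.1.re ≤ N := fun t ht =>
      ⟨fun h1 => not_lt.1 fun h2 => absurd (hM3 t ht h2) (not_lt.2 h1.le), fun h1 => by linarith⟩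
    obtain ⟨a, ha, hr⟩ := h.exists_expansion hbd (logClosed_upTo E (max (K : ℝ) (N + 1)))
      (w := Function.update w i (min (w i) 0)) (M := M) (f := f)
      (by
        simp only [Function.update_self]
        have := Nat.cast_nonneg (α := ℝ) N
        linarith [min_le_right (w i) 0])
      (fun t ht => by
        intro he
        have h1 := (IndexSet.mem_upTo.1 ht).1
        rcases le_or_gt t.1.re N with h2 | h2
        · linarith
        · exact absurd (hM3 t h1 h2) (by rw [he]; exact lt_irrefl _))
      (Sym_lin_mono hbd (fun l => by
        by_cases hl : l = i
        · subst hl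
          simp
        · simp [hl]) hf)
      (by
        rw [Function.update_idem]
        refine Sym_lin_mono hbd (lin_update_lin_le _ _ _ (fun _ _ => le_rfl) ?_) hK'
        push_cast
        linarith)
    simp only [Function.update_idem] at ha hr
    refine ⟨a, ha, ?_⟩
    have hE : (E.upTo (max (K : ℝ) (N + 1))).filter (fun t => t.1.re < M) = E.upTo (N : ℝ) := by
      ext t
      rw [Finset.mem_filter, IndexSet.mem_upTo, IndexSet.mem_upTo]
      constructor
      · rintro ⟨⟨h1, _⟩, h2⟩
        exact ⟨h1, (hcmp t h1).1 h2⟩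
      · rintro ⟨h1, h2⟩
        refine ⟨⟨h1, h2.trans ?_⟩, by linarith⟩
        exact le_trans (by linarith) (le_max_right _ _)
    rwa [hE] at hr
  choose M hM hgap a ha hr using hex
  -- The coefficient of `t` is taken from the first natural level at which `t` occurs. By
  -- uniqueness, all later levels give the same coefficient.
  refine ⟨fun t => a ⌈t.1.re⌉₊ t, fun t => ha _ t, fun N => ⟨M N, hM N, ?_⟩⟩
  have key : ∀ t ∈ E.upTo (N : ℝ), a ⌈t.1.re⌉₊ t = a N t := by
    intro t ht
    obtain ⟨ht1, ht2⟩ := IndexSet.mem_upTo.1 ht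
    set n := ⌈t.1.re⌉₊ with hn
    have hnN : n ≤ N := Nat.ceil_le.2 ht2
    have hsub : E.upTo (n : ℝ) ⊆ E.upTo (N : ℝ) := E.upTo_mono (by exact_mod_cast hnN)
    set F := E.upTo (N : ℝ) \ E.upTo (n : ℝ) with hF
    have hFmem : ∀ s ∈ F, s ∈ E.carrier ∧ (n : ℝ) < s.1.re := by
      intro s hs
      obtain ⟨h1, h2⟩ := Finset.mem_sdiff.1 hs
      rw [IndexSet.mem_upTo] at h1 h2
      exact ⟨h1.1, not_le.1 fun h3 => h2 ⟨h1.1, h3⟩⟩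
    have hFl : LogClosed F := by
      intro s hs q hq
      obtain ⟨h1, h2⟩ := Finset.mem_sdiff.1 hs
      refine Finset.mem_sdiff.2 ⟨IndexSet.upTo_log_closed h1 q hq, fun h3 => ?_⟩
      rw [IndexSet.mem_upTo] at h1 h2 h3
      exact h2 ⟨h1.1, h3.2⟩
    have h1 : f - ∑ t ∈ E.upTo (n : ℝ), termOp Ω i t (a N t) ∈
        Sym Ω (lin (Function.update w i (min (M n) (M N)))) := by
      have e1 : f - ∑ t ∈ E.upTo (n : ℝ), termOp Ω i t (a N t) =
          (f - ∑ t ∈ E.upTo (N : ℝ), termOp Ω i t (a N t)) +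
            ∑ t ∈ F, termOp Ω i t (a N t) := by
        rw [← Finset.sum_sdiff hsub]
        abel
      rw [e1]
      -- The terms of level `N` that are not of level `n` have exponents beyond the gap `M n`, so
      -- they may be counted as part of the remainder of level `n`.
      refine Submodule.add_mem _ (Sym_lin_mono hbd (lin_update_lin_le _ _ _ (fun _ _ => le_rfl)
        (min_le_right _ _)) (hr N)) ?_
      refine h.termOp_sum_mem hbd (fun s hs => ?_) hFl (fun t => (ha N t).1) (fun t => (ha N t).2)
      exact (min_le_left _ _).trans_lt (hgap n s (hFmem s hs).1 (hFmem s hs).2)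
    refine h.coeff_unique hbd (hM n) (lt_min (hM n) ?_) (fun t => (ha n t).1)
      (fun t => (ha N t).1) (hr n) h1 t (IndexSet.mem_upTo.2 ⟨ht1, Nat.le_ceil _⟩)
    exact lt_of_le_of_lt (by exact_mod_cast hnN) (hM N)
  have := hr N
  rwa [Finset.sum_congr rfl fun t ht => by rw [← key t ht]] at this

end Expansion

/-! ### From differential conditions to polyhomogeneity -/

section Converse

variable {m : ℕ} {V : Type} [NormedAddCommGroup V] [NormedSpace ℝ V]
variable {Ω : Opens ((Fin m → ℝ) × V)} {i : Fin m} {c : ℝ}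

theorem Sym_average_lin {w w' : Fin m → ℝ} {f : Sm Ω} (h : f ∈ Sym Ω (lin w))
    (h' : f ∈ Sym Ω (lin w')) : f ∈ Sym Ω (lin fun l => (w l + w' l) / 2) := by
  refine Sym_mono (c := 0) (fun x _ => le_of_eq ?_) (Sym_average h h')
  rw [lin, lin, lin, ← Finset.sum_add_distrib, Finset.sum_div, add_zero]
  exact Finset.sum_congr rfl fun l _ => by ring

theorem aeval_dirD_comm (d d' : (Fin m → ℝ) × V) (P Q : ℂ[X]) (f : Sm Ω) :
    aeval (Sm.dirD Ω d) P (aeval (Sm.dirD Ω d') Q f) =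
      aeval (Sm.dirD Ω d') Q (aeval (Sm.dirD Ω d) P f) :=
  aeval_linear (aeval (Sm.dirD Ω d) P)
    (fun a => (aeval_linear (Sm.dirD Ω d') (fun b => Sm.dirD_comm d' d b) P a).symm) Q f

/-- The operators belonging to an index set annihilate `f`, up to any order. -/
def Annihilated (E : IndexSet) (i : Fin m) (f : Sm Ω) : Prop :=
  ∃ w : Fin m → ℝ, ∀ N : ℕ, ∃ K : ℕ,
    aeval (Sm.dirD Ω (ei V i)) (expPoly (E.upTo K)) f ∈ Sym Ω (lin (Function.update w i N))

/-- Let `Q` be an operator belonging to the face `j`. By interpolation `Q f` has high order at `j`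
and still satisfies the conditions at `i`, so it has an expansion at `i` whose coefficients have
high order at `j`. Since `Q` commutes with multiplication by powers of `ρ i` and its logarithm,
uniqueness identifies these coefficients with `Q (a t)`. -/
theorem IsHalf.annihilated_coeff (h : IsHalf Ω i c) (hbd : ∃ C : ℝ, ∀ x ∈ Ω, ∀ l, x.1 l ≤ C)
    {E E' : IndexSet} {j : Fin m} (hij : j ≠ i) {w w₀ : Fin m → ℝ} {f : Sm Ω}
    (hf : f ∈ Sym Ω (lin w)) (hi : Annihilated E i f) (hj : Annihilated E' j f)
    {a : ℂ × ℕ → Sm Ω} (ha : ∀ t, Sm.dirD Ω (ei V i) (a t) = 0)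
    (hr : ∀ N : ℕ, ∃ M : ℝ, N < M ∧
        f - ∑ t ∈ E.upTo N, termOp Ω i t (a t) ∈ Sym Ω (lin (Function.update w₀ i M)))
    {t : ℂ × ℕ} (ht : t ∈ E.carrier) : Annihilated E' j (a t) := by
  obtain ⟨wi, hwi⟩ := hi
  obtain ⟨wj, hwj⟩ := hj
  set W : Fin m → ℝ := fun l => (min (w l) (wi l) + wj l) / 2 with hW
  refine ⟨Function.update W i 0, fun N₀ => ?_⟩
  -- Averaging halves the orders, so that `(min (w j) (wi j) + N) / 2 ≥ N₀` is needed.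
  set N : ℕ := ⌈2 * N₀ - min (w j) (wi j)⌉₊ with hN
  obtain ⟨K, hK⟩ := hwj N
  refine ⟨K, ?_⟩
  set Q := expPoly (E'.upTo K) with hQ
  set g := aeval (Sm.dirD Ω (ei V j)) Q f with hg
  set WN := Function.update W j ((min (w j) (wi j) + N) / 2) with hWN
  have hgW : g ∈ Sym Ω (lin WN) := by
    refine Sym_lin_mono hbd (fun l => ?_)
      (Sym_average_lin (aeval_mem_Sym (ei V j) Q hf) hK)
    by_cases hl : l = j
    · subst hl
      simp only [hWN, Function.update_self]
      linarith [min_le_left (w l) (wi l)]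
    · simp only [hWN, Function.update_of_ne hl, hW]
      linarith [min_le_left (w l) (wi l)]
  have hgi : ∀ n : ℕ, ∃ K : ℕ, aeval (Sm.dirD Ω (ei V i)) (expPoly (E.upTo K)) g ∈
      Sym Ω (lin (Function.update WN i n)) := by
    intro n
    obtain ⟨K', hK'⟩ := hwi ⌈2 * n - wj i⌉₊
    refine ⟨K', ?_⟩
    have h1 := aeval_mem_Sym (ei V j) Q hK'
    rw [← aeval_dirD_comm] at h1
    refine Sym_lin_mono hbd (fun l => ?_)
      (Sym_average_lin h1 (aeval_mem_Sym (ei V i) (expPoly (E.upTo K')) hK))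
    by_cases hl : l = i
    · subst hl
      have := Nat.le_ceil (2 * (n : ℝ) - wj l)
      simp only [Function.update_self, Function.update_of_ne hij.symm]
      linarith
    · by_cases hl' : l = j
      · subst hl'
        simp only [Function.update_of_ne hl, hWN, Function.update_self]
        linarith [min_le_right (w l) (wi l)]
      · simp only [Function.update_of_ne hl, hWN, Function.update_of_ne hl', hW]
        linarith [min_le_right (w l) (wi l)]
  obtain ⟨b, hb, hbr⟩ := h.exists_full_expansion hbd E hgW hgi
  have hab : aeval (Sm.dirD Ω (ei V j)) Q (a t) = b t := by
    obtain ⟨M, hM, hr1⟩ := hr ⌈t.1.re⌉₊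
    obtain ⟨M', hM', hr2⟩ := hbr ⌈t.1.re⌉₊
    refine h.coeff_unique (E := E) hbd hM hM'
      (a := fun t => aeval (Sm.dirD Ω (ei V j)) Q (a t)) (fun s => ?_) (fun s => (hb s).1)
      (f := g) (w := w₀) ?_ hr2 t (IndexSet.mem_upTo.2 ⟨ht, Nat.le_ceil _⟩)
    · have := aeval_dirD_comm (ei V i) (ei V j) X Q (a s)
      rw [aeval_X] at this
      rw [this, ha, map_zero]
    · have h1 := aeval_mem_Sym (ei V j) Q hr1
      rw [map_sub, map_sum] at h1
      convert h1 using 2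
      refine Finset.sum_congr rfl fun s _ => ?_
      exact aeval_linear (termOp Ω i s) (fun f => dirD_termOp hij s f) Q (a s)
  rw [hab]
  refine Sym_lin_mono hbd (fun l => ?_) (hb t).2
  by_cases hl : l = j
  · subst hl
    have := Nat.le_ceil (2 * (N₀ : ℝ) - min (w l) (wi l))
    simp only [Function.update_self, Function.update_of_ne hij, hWN]
    linarith
  · rw [Function.update_of_ne hl]
    by_cases hl' : l = i
    · subst hl'
      simp
    · simp [Function.update_of_ne hl', hWN, Function.update_of_ne hl]

theorem isHalf_logBall {q : (Fin m → ℝ) × V} {ε : ℝ} (hε : 0 < ε) (hi : q.1 i = 0) :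
    IsHalf (logBall q ε) i (Real.log ε) := by
  have key : ∀ s : ℝ, |Real.exp s - q.1 i| < ε ↔ s < Real.log ε := fun s => by
    rw [hi, sub_zero, abs_of_pos (Real.exp_pos s), Real.lt_log_iff_exp_lt hε]
  constructor
  · exact fun x hx => (key _).1 (((mem_logBall_iff hε).1 hx).1 i)
  · intro x hx s hs
    rw [mem_logBall_iff hε] at hx ⊢
    refine ⟨fun l => ?_, hx.2⟩
    by_cases hl : l = i
    · subst hl
      simpa using (key s).2 hs
    · simpa [hl] using hx.1 l

theorem logBall_bddAbove {q : (Fin m → ℝ) × V} {ε : ℝ} (hε : 0 < ε) :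
    ∃ C : ℝ, ∀ x ∈ logBall q ε, ∀ l, x.1 l ≤ C := by
  refine ⟨‖q.1‖ + ε, fun x hx l => ?_⟩
  have h1 := (abs_lt.1 (((mem_logBall_iff hε).1 hx).1 l)).2
  have h2 := (le_abs_self _).trans (norm_le_pi_norm q.1 l)
  linarith [Real.add_one_le_exp (x.1 l)]

/-- A function annihilated up to any order by the operators belonging to the index sets is
polyhomogeneous. -/
theorem phgOn_of_annihilated {Face : Type} {E : Face → IndexSet} {face : Fin m → Option Face}
    {q : (Fin m → ℝ) × V} {ε : ℝ} (hε : 0 < ε) (n : ℕ) : ∀ (S : Finset (Fin m))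
    (_ : ∀ i ∈ S, q.1 i = 0) (u : (Fin m → ℝ) × V → ℂ) (g : Sm (logBall q ε))
    (_ : ∀ x ∈ logBall q ε, g x = u (expMap x)) (_ : ∃ w, g ∈ Sym (logBall q ε) (lin w))
    (_ : ∀ i ∈ S, ∀ H, face i = some H → Annihilated (E H) i g),
    PhgOn E face (Metric.ball q ε) n S u := by
  induction n with
  | zero =>
    rintro S - u g hgu ⟨w, hw⟩ -
    exact ⟨w, conormalOn_iff.2 ⟨g, hw, hgu⟩⟩
  | succ n ih =>
    rintro S hS u g hgu ⟨w, hw⟩ hA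
    refine ⟨⟨w, conormalOn_iff.2 ⟨g, hw, hgu⟩⟩, fun i hi H hH => ?_⟩
    have h := isHalf_logBall (V := V) hε (hS i hi)
    have hbd := logBall_bddAbove (q := q) hε
    set c := Real.log ε
    obtain ⟨wi, hwi⟩ := hA i hi H hH
    set w' : Fin m → ℝ := fun l => min (w l) (wi l) with hw'
    obtain ⟨a, ha, hr⟩ := h.exists_full_expansion hbd (E H) (w := w')
      (Sym_lin_mono hbd (fun l => min_le_left _ _) hw) (fun N => by
        obtain ⟨K, hK⟩ := hwi N
        exact ⟨K, Sym_lin_mono hbd (lin_update_lin_le _ _ _ (fun _ _ => min_le_right _ _) le_rfl)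
          hK⟩)
    -- `PhgOn` wants coefficients independent of `ρ i` at all points, not only near `q`: the
    -- logarithmic coordinate is frozen at `c - 1`, inside the half line.
    set α : ℂ × ℕ → (Fin m → ℝ) × V → ℂ := fun t p =>
      a t (Function.update (fun l => Real.log (p.1 l)) i (c - 1), p.2) with hα
    have hαa : ∀ t, ∀ x ∈ logBall q ε, a t x = α t (expMap x) := by
      intro t x hx
      simp only [hα, expMap, Real.log_exp]
      exact (h.eq_update (ha t).1 hx (by linarith)).symm
    refine ⟨α, fun t ht => ⟨fun p r => ?_, ?_⟩, w', fun N => ?_⟩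
    · simp only [hα]
      have : (fun l => Real.log (Function.update p.1 i r l)) =
          Function.update (fun l => Real.log (p.1 l)) i (Real.log r) := by
        funext l
        by_cases hl : l = i
        · subst hl
          simp
        · simp [hl]
      rw [this, Function.update_idem]
    · refine ih (S.erase i) (fun l hl => hS l (Finset.mem_of_mem_erase hl)) _ (a t) (hαa t)
        ⟨_, (ha t).2⟩ fun j hj H' hH' => ?_
      exact h.annihilated_coeff hbd (Finset.ne_of_mem_erase hj) hw (hA i hi H hH)
        (hA j (Finset.mem_of_mem_erase hj) H' hH') (fun t => (ha t).1) hr ht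
    · obtain ⟨M, hM, hrM⟩ := hr N
      refine conormalOn_iff.2 ⟨_, Sym_lin_mono hbd
        (lin_update_lin_le _ _ _ (fun _ _ => le_rfl) hM.le) hrM, fun x hx => ?_⟩
      rw [Sm.sub_apply, Sm.sum_apply, hgu x hx]
      congr 1
      refine Finset.sum_congr rfl fun t _ => ?_
      rw [termOp_apply, hαa t x hx]
      simp only [expMap, Real.log_exp]
      rw [Complex.cpow_def_of_ne_zero (by exact_mod_cast (Real.exp_pos _).ne'),
        ← Complex.ofReal_log (Real.exp_pos _).le, Real.log_exp]
      ring

end Converse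

/-! ### Local polyhomogeneity -/

section Near

variable {m : ℕ} {V : Type} [NormedAddCommGroup V] [NormedSpace ℝ V] {Face : Type}

open Classical in
/-- `u` is polyhomogeneous near `q`. -/
def PhgNear (E : Face → IndexSet) (face : Fin m → Option Face) (u : (Fin m → ℝ) × V → ℂ)
    (q : (Fin m → ℝ) × V) : Prop :=
  ∃ ε > 0, PhgOn E face (Metric.ball q ε) m (Finset.univ.filter fun i => q.1 i = 0) u

theorem PhgNear.exists_annihilated {E : Face → IndexSet} {face : Fin m → Option Face}
    {u : (Fin m → ℝ) × V → ℂ} {q : (Fin m → ℝ) × V} (h : PhgNear E face u q) :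
    ∃ ε > 0, ∃ g : Sm (logBall q ε), (∀ x ∈ logBall q ε, g x = u (expMap x)) ∧
      (∃ w, g ∈ Sym (logBall q ε) (lin w)) ∧
      ∀ i H, q.1 i = 0 → face i = some H → ∃ w : Fin m → ℝ, ∀ N : ℕ,
        aeval (Sm.dirD (logBall q ε) (ei V i)) (expPoly ((E H).upTo N)) g ∈
          Sym (logBall q ε) (lin (Function.update w i N)) := by
  obtain ⟨ε, hε, h⟩ := h
  obtain ⟨w, hw⟩ := h.conormal
  obtain ⟨g, hg, hgu⟩ := conormalOn_iff.1 hw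
  refine ⟨ε, hε, g, hgu, ⟨w, hg⟩, fun i H hi hH => ?_⟩
  -- A face exists, so `m > 0` and the recursion in `PhgOn` has at least one level to unfold.
  obtain ⟨n, hn⟩ : ∃ n, m = n + 1 := Nat.exists_eq_succ_of_ne_zero (Fin.pos i).ne'
  have key : ∀ d : ℕ, d = n + 1 → PhgOn E face (Metric.ball q ε) d
      (Finset.univ.filter fun i => q.1 i = 0) u → ∃ w : Fin m → ℝ, ∀ N : ℕ,
        aeval (Sm.dirD (logBall q ε) (ei V i)) (expPoly ((E H).upTo N)) g ∈
          Sym (logBall q ε) (lin (Function.update w i N)) := by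
    rintro d rfl hd
    exact hd.aeval_mem hgu (Finset.mem_filter.2 ⟨Finset.mem_univ _, hi⟩) hH
  exact key m hn h

theorem phgNear_of_annihilated {E : Face → IndexSet} {face : Fin m → Option Face}
    {q : (Fin m → ℝ) × V} {ε : ℝ} (hε : 0 < ε) {u : (Fin m → ℝ) × V → ℂ} {g : Sm (logBall q ε)}
    (hgu : ∀ x ∈ logBall q ε, g x = u (expMap x)) (hg : ∃ w, g ∈ Sym (logBall q ε) (lin w))
    (hA : ∀ i H, q.1 i = 0 → face i = some H → Annihilated (E H) i g) : PhgNear E face u q :=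
  ⟨ε, hε, phgOn_of_annihilated hε m _ (fun _ hi => (Finset.mem_filter.1 hi).2) u g hgu hg
    fun i hi H hH => hA i H (Finset.mem_filter.1 hi).2 hH⟩

end Near

/-! ### Compactness through ultrafilters -/

/-- Otherwise the complements of the sets with property `p`, together with `ℱ`, generate a proper
filter. An ultrafilter below it contains a set with property `p` and also the complement of that
set. -/
theorem exists_mem_of_ultrafilter {Z : Type*} {ℱ : Filter Z} {p : Set Z → Prop} (he : p ∅)
    (hmono : ∀ s, p s → ∀ t ⊆ s, p t) (hunion : ∀ s, p s → ∀ t, p t → p (s ∪ t))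
    (h : ∀ 𝒰 : Ultrafilter Z, (𝒰 : Filter Z) ≤ ℱ → ∃ s ∈ 𝒰, p s) : ∃ s ∈ ℱ, p s := by
  by_contra hcon
  push Not at hcon
  set G := Filter.comk p he hmono hunion
  have hne : (ℱ ⊓ G).NeBot := by
    rw [Filter.inf_neBot_iff]
    intro s hs t ht
    by_contra hemp
    refine hcon s hs (hmono _ (Filter.mem_comk.1 ht) s fun x hx hxt => hemp ⟨x, hx, hxt⟩)
  obtain ⟨𝒰, h𝒰⟩ := Ultrafilter.exists_le (ℱ ⊓ G)
  obtain ⟨s, hs, hps⟩ := h 𝒰 (h𝒰.trans inf_le_left)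
  have : sᶜ ∈ (𝒰 : Filter Z) := h𝒰.trans inf_le_right (Filter.mem_comk.2 (by rwa [compl_compl]))
  exact Ultrafilter.compl_mem_iff_notMem.1 this hs

/-! ### Estimates along rays -/

section RayEstimates

variable {E' : Type} [NormedAddCommGroup E'] [NormedSpace ℝ E']

/-- The largest open set on which `U` is smooth. -/
def smoothDom (U : E' → ℂ) : Opens E' :=
  ⟨{x | ∃ O : Set E', IsOpen O ∧ x ∈ O ∧ ContDiffOn ℝ ∞ U O}, by
    rw [isOpen_iff_forall_mem_open]
    rintro x ⟨O, hO, hxO, hU⟩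
    exact ⟨O, fun y hy => ⟨O, hO, hy, hU⟩, hO, hxO⟩⟩

theorem contDiffOn_smoothDom (U : E' → ℂ) : ContDiffOn ℝ ∞ U (smoothDom U) := by
  rintro x ⟨O, hO, hxO, hU⟩
  exact (hU.contDiffAt (hO.mem_nhds hxO)).contDiffWithinAt

/-- `U` as a smooth function on its domain of smoothness. -/
def smPart (U : E' → ℂ) : Sm (smoothDom U) := Sm.of _ U (contDiffOn_smoothDom U)

/-- Along the rays in the direction `α`, for the starting points and the parameters in `s`, the
derivatives of `g` are bounded by a constant times `exp ψ`. -/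
def RayEst (g : E' → ℂ) (α : E') (s : Set (E' × ℝ)) (ψ : E' × ℝ → ℝ) : Prop :=
  ∀ j : ℕ, ∃ C : ℝ, ∀ z ∈ s, ‖iteratedFDeriv ℝ j g (z.1 + z.2 • α)‖ ≤ C * Real.exp (ψ z)

theorem RayEst.mono {g : E' → ℂ} {α : E'} {s s' : Set (E' × ℝ)} {ψ ψ' : E' × ℝ → ℝ} {c : ℝ}
    (h : RayEst g α s ψ) (hs : s' ⊆ s) (hψ : ∀ z ∈ s', ψ z ≤ ψ' z + c) : RayEst g α s' ψ' := by
  intro j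
  obtain ⟨C, hC⟩ := h j
  refine ⟨|C| * Real.exp c, fun z hz => (hC z (hs hz)).trans ?_⟩
  rw [mul_assoc, ← Real.exp_add]
  exact mul_le_mul (le_abs_self C) (Real.exp_le_exp.2 (by linarith [hψ z hz]))
    (Real.exp_pos _).le (abs_nonneg _)

theorem RayEst.union {g : E' → ℂ} {α : E'} {s s' : Set (E' × ℝ)} {ψ : E' × ℝ → ℝ}
    (h : RayEst g α s ψ) (h' : RayEst g α s' ψ) : RayEst g α (s ∪ s') ψ := by
  intro j
  obtain ⟨C, hC⟩ := h j
  obtain ⟨C', hC'⟩ := h' j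
  refine ⟨max C C', fun z hz => ?_⟩
  rcases hz with hz | hz
  · exact (hC z hz).trans (by gcongr; exact le_max_left _ _)
  · exact (hC' z hz).trans (by gcongr; exact le_max_right _ _)

end RayEstimates

section Ray

variable {m : ℕ} {V : Type} [NormedAddCommGroup V] [NormedSpace ℝ V] {Face : Type}

/-- A linear change of the logarithmic coordinates. -/
def prodL (V : Type) [NormedAddCommGroup V] [NormedSpace ℝ V]
    (L : (Fin m → ℝ) →L[ℝ] (Fin m → ℝ)) : ((Fin m → ℝ) × V) →L[ℝ] (Fin m → ℝ) × V :=
  L.prodMap (ContinuousLinearMap.id ℝ V)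

@[simp] theorem prodL_apply (L : (Fin m → ℝ) →L[ℝ] (Fin m → ℝ)) (x : (Fin m → ℝ) × V) :
    prodL V L x = (L x.1, x.2) := rfl

/-- A weight is linear in logarithmic coordinates, so along a ray it costs at most `exp (W * (‖τ‖ +
t))`. The part in `τ` becomes a fixed weight, the part in `t` is absorbed by the kernel. -/
theorem exists_lin_le (w : Fin m → ℝ) (L : (Fin m → ℝ) →L[ℝ] (Fin m → ℝ)) (e : Fin m → ℝ) :
    ∃ W : ℝ, 0 ≤ W ∧ ∀ (τ : Fin m → ℝ) (v : V) (t : ℝ), 0 ≤ t →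
      |lin w (L (τ + t • e), v)| ≤ W * (‖τ‖ + t) := by
  refine ⟨(∑ l, |w l|) * (‖L‖ * (1 + ‖e‖)), by positivity, fun τ v t ht => ?_⟩
  have h1 : |lin w (L (τ + t • e), v)| ≤ (∑ l, |w l|) * ‖L (τ + t • e)‖ := by
    rw [lin, Finset.sum_mul]
    refine (Finset.abs_sum_le_sum_abs _ _).trans (Finset.sum_le_sum fun l _ => ?_)
    rw [abs_mul]
    gcongr
    exact norm_le_pi_norm (L (τ + t • e)) l
  have h2 : ‖τ + t • e‖ ≤ (1 + ‖e‖) * (‖τ‖ + t) := by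
    refine (norm_add_le _ _).trans ?_
    rw [norm_smul, Real.norm_of_nonneg ht]
    nlinarith [norm_nonneg τ, norm_nonneg e, mul_nonneg (norm_nonneg e) (norm_nonneg τ)]
  refine h1.trans ?_
  rw [mul_assoc, mul_assoc]
  gcongr
  exact (L.le_opNorm _).trans (by gcongr)

variable {U : (Fin m → ℝ) × V → ℂ}

/-- The preimage of a ball under a linear change of the logarithmic coordinates. -/
def linBall (L : (Fin m → ℝ) →L[ℝ] (Fin m → ℝ)) (q : (Fin m → ℝ) × V) (ε : ℝ) :
    Opens ((Fin m → ℝ) × V) :=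
  ⟨prodL V L ⁻¹' logBall q ε, (logBall q ε).isOpen.preimage (prodL V L).continuous⟩

theorem mem_linBall {L : (Fin m → ℝ) →L[ℝ] (Fin m → ℝ)} {q : (Fin m → ℝ) × V} {ε : ℝ}
    {x : (Fin m → ℝ) × V} : x ∈ linBall L q ε ↔ prodL V L x ∈ logBall q ε := Iff.rfl

variable {L : (Fin m → ℝ) →L[ℝ] (Fin m → ℝ)} {q : (Fin m → ℝ) × V} {ε : ℝ}
  {u : (Fin m → ℝ) × V → ℂ} {g : Sm (logBall q ε)}

theorem linBall_le_smoothDom (hg : ∀ x ∈ logBall q ε, g x = u (expMap x))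
    (hU : ∀ x, U x = u (expMap (prodL V L x))) : linBall L q ε ≤ smoothDom U := by
  intro x hx
  refine ⟨linBall L q ε, (linBall L q ε).isOpen, hx, ?_⟩
  refine ((Sm.smooth g).comp (prodL V L).contDiff.contDiffOn fun y hy => hy).congr fun y hy => ?_
  rw [hU, Function.comp_apply, hg _ hy]

/-- In logarithmic coordinates `U` is the pullback of `g` by a linear map taking `d` to `d'`;
polynomials in the two derivatives correspond, and linear pullback preserves symbol estimates. -/
theorem norm_iteratedFDeriv_aeval_le (hg : ∀ x ∈ logBall q ε, g x = u (expMap x))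
    (hU : ∀ x, U x = u (expMap (prodL V L x))) {d d' : Fin m → ℝ} (hd : L d = d') (P : ℂ[X])
    {w : (Fin m → ℝ) × V → ℝ}
    (hP : aeval (Sm.dirD (logBall q ε) (d', (0 : V))) P g ∈ Sym (logBall q ε) w) (j : ℕ) :
    ∃ C : ℝ, ∀ x ∈ linBall L q ε,
      ‖iteratedFDeriv ℝ j (aeval (Sm.dirD (smoothDom U) (d, (0 : V))) P (smPart U)) x‖ ≤
        C * Real.exp (w (prodL V L x)) := by
  have hle := linBall_le_smoothDom hg hU
  set Ω := linBall L q ε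
  have hm : ∀ x ∈ Ω, prodL V L x ∈ logBall q ε := fun x hx => hx
  set Φ := pull (Ω := logBall q ε) (Ω' := Ω) (prodL V L) (prodL V L).contDiff.contDiffOn
    hm with hΦ
  set R := pull (Ω := smoothDom U) (Ω' := Ω) id contDiffOn_id (fun x hx => hle hx) with hR
  have h1 : R (aeval (Sm.dirD (smoothDom U) (d, (0 : V))) P (smPart U)) =
      Φ (aeval (Sm.dirD (logBall q ε) (d', (0 : V))) P g) := by
    rw [hR, pull_aeval (d' := (d, (0 : V))) (fun x _ => by simp), hΦ,
      pull_aeval (d' := (d, (0 : V))) (fun x _ => by simp [hd])]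
    congr 1
    refine Sm.ext' fun x hx => ?_
    rw [pull_apply _ hx, pull_apply _ hx, hg _ hx, id, smPart, Sm.of_apply (hle hx), hU]
  obtain ⟨C, hC⟩ := pull_mem_Sym (hΨ := (prodL V L).contDiff.contDiffOn) (Ω' := Ω)
    (hm := hm)
    (fun j hj => (bounded_iteratedFDeriv_clm (prodL V L) j hj).imp fun C hC x _ => hC x) hP j
  refine ⟨C, fun x hx => ?_⟩
  have h2 := hC x hx
  rw [← hΦ, ← h1] at h2
  have h3 : (R (aeval (Sm.dirD (smoothDom U) (d, (0 : V))) P (smPart U)) :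
      (Fin m → ℝ) × V → ℂ) =ᶠ[nhds x] aeval (Sm.dirD (smoothDom U) (d, (0 : V))) P (smPart U) := by
    filter_upwards [Ω.isOpen.mem_nhds hx] with y hy
    rw [hR, pull_apply _ hy, id]
  rwa [(h3.iteratedFDeriv ℝ j).eq_of_nhds] at h2

end Ray

/-! ### Estimates carried from the end of a ray to its start -/

section RayTheorem

variable {m : ℕ} {V : Type} [NormedAddCommGroup V] [NormedSpace ℝ V] {Face : Type}
variable {E : Face → IndexSet} {U : (Fin m → ℝ) × V → ℂ} {e : Fin m → ℝ}
  {L : (Fin m → ℝ) ≃L[ℝ] (Fin m → ℝ)} {face : Fin m → Option Face} {q : (Fin m → ℝ) × V}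
  {𝒰 : Ultrafilter (((Fin m → ℝ) × V) × ℝ)}

/-- The ends of the rays in the direction `e` converge, along the ultrafilter `𝒰`, in a chart with
logarithmic coordinates `L' τ`, in which the expansions at the faces through `q` can be seen. -/
def RayEnd (E : Face → IndexSet) (U : (Fin m → ℝ) × V → ℂ) (e : Fin m → ℝ)
    (L : (Fin m → ℝ) ≃L[ℝ] (Fin m → ℝ)) (face : Fin m → Option Face) (q : (Fin m → ℝ) × V)
    (𝒰 : Ultrafilter (((Fin m → ℝ) × V) × ℝ)) : Prop :=
  ∃ (L' : (Fin m → ℝ) →L[ℝ] (Fin m → ℝ)) (face' : Fin m → Option Face)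
    (u' : (Fin m → ℝ) × V → ℂ) (q' : (Fin m → ℝ) × V),
    (∀ x, U x = u' (expMap (prodL V L' x))) ∧ PhgNear E face' u' q' ∧
    Filter.Tendsto (fun z : ((Fin m → ℝ) × V) × ℝ => expMap (prodL V L' (z.1 + z.2 • (e, (0 : V)))))
      𝒰 (nhds q') ∧
    ∀ i H, q.1 i = 0 → face i = some H →
      (∃ i', face' i' = some H ∧ L' (L.symm (Pi.single i 1)) = Pi.single i' 1 ∧
        ∃ ℓ C : ℝ, ∀ᶠ z in (𝒰 : Filter (((Fin m → ℝ) × V) × ℝ)),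
          L' (z.1.1 + z.2 • e) i' ≤ L z.1.1 i + ℓ * z.2 + C) ∨
      ∃ ℓ C : ℝ, ∀ᶠ z in (𝒰 : Filter (((Fin m → ℝ) × V) × ℝ)), 0 ≤ L z.1.1 i + ℓ * z.2 + C

theorem RayEnd.exists_rayEst (h : RayEnd E U e L face q 𝒰)
    (hpos : ∀ᶠ z in (𝒰 : Filter (((Fin m → ℝ) × V) × ℝ)), 0 < z.2) :
    ∃ s ∈ 𝒰, (∀ z ∈ s, 0 < z.2 ∧ z.1 + z.2 • (e, (0 : V)) ∈ smoothDom U) ∧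
      ∃ W : ℝ, RayEst (smPart U) (e, (0 : V)) s fun z => W * (‖z.1.1‖ + z.2) := by
  obtain ⟨L', face', u', q', hU, hphg, hlim, -⟩ := h
  obtain ⟨ε, hε, g, hg, ⟨w, hw⟩, -⟩ := hphg.exists_annihilated
  have hball := hlim (Metric.ball_mem_nhds q' hε)
  refine ⟨_, Filter.inter_mem hpos hball, fun z hz => ⟨hz.1, linBall_le_smoothDom hg hU hz.2⟩, ?_⟩
  obtain ⟨W, -, hW⟩ := exists_lin_le (V := V) w L' e
  refine ⟨W, fun j => ?_⟩
  -- With the constant polynomial `1` this is an estimate of `U` itself, and the direction `0` plays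
  -- no role.
  obtain ⟨C, hC⟩ := norm_iteratedFDeriv_aeval_le hg hU (d := 0) (map_zero L') (1 : ℂ[X])
    (w := lin w) (by simpa using hw) j
  refine ⟨|C|, fun z hz => ?_⟩
  have h1 := hC _ hz.2
  rw [map_one, Module.End.one_apply] at h1
  refine h1.trans (mul_le_mul (le_abs_self C) (Real.exp_le_exp.2 ?_) (Real.exp_pos _).le
    (abs_nonneg _))
  exact (le_abs_self _).trans
    (by simpa using hW z.1.1 (z.1 + z.2 • (e, (0 : V))).2 z.2 (le_of_lt hz.1))

/-- The estimate satisfied along the rays by the operators that annihilate the expansion of `U` at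
the face `i`. -/
def FaceEst (E : IndexSet) (U : (Fin m → ℝ) × V → ℂ) (e : Fin m → ℝ)
    (L : (Fin m → ℝ) ≃L[ℝ] (Fin m → ℝ)) (i : Fin m) (s : Set (((Fin m → ℝ) × V) × ℝ)) : Prop :=
  -- `W` precedes `N`, since the weights at the other faces must not depend on the order; the rate
  -- `ℓ` may grow with `N`, because the kernel beats every exponential.
  ∃ W : ℝ, ∀ N : ℕ, ∃ ℓ : ℝ,
    RayEst (aeval (Sm.dirD (smoothDom U) (L.symm (Pi.single i 1), (0 : V))) (expPoly (E.upTo N))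
      (smPart U)) (e, (0 : V)) s fun z => N * L z.1.1 i + W * ‖z.1.1‖ + ℓ * z.2

/-- If the ray ends near the same face, the operator is the one of the end chart, and the factor `ρ'
^ N` at the end is at most a constant times `exp (N * ℓ * t)` times `ρ ^ N` at the start. If it ends
far from the face, `ρ ^ N` at the start is bounded below by a constant times `exp (-N * ℓ * t)`, and
plain conormality at the end suffices. -/
theorem RayEnd.exists_faceEst (h : RayEnd E U e L face q 𝒰)
    (hpos : ∀ᶠ z in (𝒰 : Filter (((Fin m → ℝ) × V) × ℝ)), 0 < z.2) {i : Fin m} {H : Face}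
    (hi : q.1 i = 0) (hH : face i = some H) :
    ∃ s ∈ 𝒰, (∀ z ∈ s, 0 < z.2) ∧ FaceEst (E H) U e L i s := by
  obtain ⟨L', face', u', q', hU, hphg, hlim, hcomp⟩ := h
  obtain ⟨ε, hε, g, hg, ⟨w, hw⟩, hA⟩ := hphg.exists_annihilated
  have hball := hlim (Metric.ball_mem_nhds q' hε)
  set d := L.symm (Pi.single i 1) with hd
  have hfar : (∃ ℓ C : ℝ, ∀ᶠ z in (𝒰 : Filter (((Fin m → ℝ) × V) × ℝ)),
      0 ≤ L z.1.1 i + ℓ * z.2 + C) → ∃ s ∈ 𝒰, (∀ z ∈ s, 0 < z.2) ∧ FaceEst (E H) U e L i s := by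
    rintro ⟨ℓ, C₀, hℓ⟩
    refine ⟨_, Filter.inter_mem (Filter.inter_mem hpos hball) hℓ, fun z hz => hz.1.1, ?_⟩
    obtain ⟨W, -, hW⟩ := exists_lin_le (V := V) w L' e
    refine ⟨W, fun N => ⟨W + N * ℓ, fun j => ?_⟩⟩
    obtain ⟨C, hC⟩ := norm_iteratedFDeriv_aeval_le hg hU (d := d) rfl (expPoly ((E H).upTo N))
      (aeval_mem_Sym _ _ hw) j
    refine ⟨|C| * Real.exp (N * C₀), fun z hz => (hC _ hz.1.2).trans ?_⟩
    rw [mul_assoc, ← Real.exp_add]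
    refine mul_le_mul (le_abs_self C) (Real.exp_le_exp.2 ?_) (Real.exp_pos _).le (abs_nonneg _)
    have h1 := (le_abs_self _).trans
      (hW z.1.1 (z.1 + z.2 • (e, (0 : V))).2 z.2 (le_of_lt hz.1.1))
    have h2 : (0 : ℝ) ≤ N * (L z.1.1 i + ℓ * z.2 + C₀) := mul_nonneg (Nat.cast_nonneg N) hz.2
    calc _ ≤ W * (‖z.1.1‖ + z.2) := h1
      _ ≤ _ := by linarith
  rcases hcomp i H hi hH with ⟨i', hi', hdi, ℓ, C₀, hℓ⟩ | hcase
  · by_cases hq' : q'.1 i' = 0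
    · obtain ⟨w', hw'⟩ := hA i' H hq' hi'
      refine ⟨_, Filter.inter_mem (Filter.inter_mem hpos hball) hℓ, fun z hz => hz.1.1, ?_⟩
      obtain ⟨W, -, hW⟩ := exists_lin_le (V := V) (Function.update w' i' 0) L' e
      refine ⟨W, fun N => ⟨W + N * ℓ, fun j => ?_⟩⟩
      obtain ⟨C, hC⟩ := norm_iteratedFDeriv_aeval_le hg hU (d := d) hdi (expPoly ((E H).upTo N))
        (hw' N) j
      refine ⟨|C| * Real.exp (N * C₀), fun z hz => (hC _ hz.1.2).trans ?_⟩
      rw [mul_assoc, ← Real.exp_add]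
      refine mul_le_mul (le_abs_self C) (Real.exp_le_exp.2 ?_) (Real.exp_pos _).le (abs_nonneg _)
      have h1 := (le_abs_self _).trans
        (hW z.1.1 (z.1 + z.2 • (e, (0 : V))).2 z.2 (le_of_lt hz.1.1))
      have h2 : (N : ℝ) * L' (z.1.1 + z.2 • e) i' ≤ N * (L z.1.1 i + ℓ * z.2 + C₀) :=
        mul_le_mul_of_nonneg_left hz.2 (Nat.cast_nonneg N)
      have h3 : lin (Function.update w' i' (N : ℝ)) (prodL V L' (z.1 + z.2 • (e, (0 : V)))) =
          lin (Function.update w' i' 0)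
            (L' (z.1.1 + z.2 • e), (z.1 + z.2 • (e, (0 : V))).2) +
            N * L' (z.1.1 + z.2 • e) i' := by
        rw [← Function.update_idem (0 : ℝ) (N : ℝ) w', lin_update, Function.update_self, sub_zero]
        rfl
      rw [h3]
      linarith
    -- The end chart shows the face, but the limit `q'` is off it: there `ρ'` eventually exceeds
    -- half its positive limit, and the comparison bounds the start from below.
    · refine hfar ⟨ℓ, C₀ - Real.log (q'.1 i' / 2), ?_⟩
      have hlim' : Filter.Tendsto (fun z : ((Fin m → ℝ) × V) × ℝ =>
          Real.exp (L' (z.1.1 + z.2 • e) i')) 𝒰 (nhds (q'.1 i')) :=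
        (((continuous_apply i').comp continuous_fst).tendsto q').comp hlim
      have h0 : 0 < q'.1 i' := lt_of_le_of_ne
        (ge_of_tendsto hlim' (Filter.Eventually.of_forall fun z => (Real.exp_pos _).le))
        (Ne.symm hq')
      filter_upwards [hℓ, hlim'.eventually_const_lt (half_lt_self h0)] with z hz1 hz2
      have := (Real.log_lt_iff_lt_exp (half_pos h0)).2 hz2
      linarith
  · exact hfar hcase

/-- The lengths `t` are unbounded, so compactness is replaced by ultrafilters on pairs of a starting
point and a length. The estimates survive subsets and finite unions, so they hold for all rays
starting close to `q` as soon as each ultrafilter has a set on which they hold. -/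
theorem exists_ball_rayEst
    (hend : ∀ 𝒰 : Ultrafilter (((Fin m → ℝ) × V) × ℝ),
      Filter.Tendsto (fun z : ((Fin m → ℝ) × V) × ℝ => expMap (prodL V (L : (Fin m → ℝ) →L[ℝ] (Fin m → ℝ)) z.1)) 𝒰
        (nhds q) → (∀ᶠ z in (𝒰 : Filter (((Fin m → ℝ) × V) × ℝ)), 0 < z.2) →
      RayEnd E U e L face q 𝒰) :
    ∃ ε > 0, (∀ x ∈ linBall (L : (Fin m → ℝ) →L[ℝ] (Fin m → ℝ)) q ε, ∀ t : ℝ, 0 < t →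
        x + t • (e, (0 : V)) ∈ smoothDom U) ∧
      (∃ W : ℝ, RayEst (smPart U) (e, (0 : V))
        {z | z.1 ∈ linBall (L : (Fin m → ℝ) →L[ℝ] (Fin m → ℝ)) q ε ∧ 0 < z.2}
        fun z => W * (‖z.1.1‖ + z.2)) ∧
      ∀ i H, q.1 i = 0 → face i = some H → FaceEst (E H) U e L i
        {z | z.1 ∈ linBall (L : (Fin m → ℝ) →L[ℝ] (Fin m → ℝ)) q ε ∧ 0 < z.2} := by
  set ℱ : Filter (((Fin m → ℝ) × V) × ℝ) :=
    Filter.comap (fun z : ((Fin m → ℝ) × V) × ℝ => expMap (prodL V (L : (Fin m → ℝ) →L[ℝ] (Fin m → ℝ)) z.1)) (nhds q) ⊓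
      Filter.principal {z | 0 < z.2} with hℱ
  have hend' : ∀ 𝒰 : Ultrafilter (((Fin m → ℝ) × V) × ℝ), (𝒰 : Filter _) ≤ ℱ →
      (∀ᶠ z in (𝒰 : Filter (((Fin m → ℝ) × V) × ℝ)), 0 < z.2) ∧ RayEnd E U e L face q 𝒰 := by
    intro 𝒰 h𝒰
    have h1 : ∀ᶠ z in (𝒰 : Filter (((Fin m → ℝ) × V) × ℝ)), 0 < z.2 :=
      (h𝒰.trans inf_le_right) (Filter.mem_principal_self _)
    exact ⟨h1, hend 𝒰 (Filter.tendsto_iff_comap.2 (h𝒰.trans inf_le_left)) h1⟩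
  have hmax : ∀ {s : Set (((Fin m → ℝ) × V) × ℝ)} {W W' : ℝ}, (∀ z ∈ s, 0 < z.2) → W ≤ W' →
      ∀ z ∈ s, W * (‖z.1.1‖ + z.2) ≤ W' * (‖z.1.1‖ + z.2) + 0 := by
    intro s W W' hs hW z hz
    rw [add_zero]
    exact mul_le_mul_of_nonneg_right hW (add_nonneg (norm_nonneg _) (hs z hz).le)
  obtain ⟨s₀, hs₀, hs₁, W₀, hW₀⟩ := exists_mem_of_ultrafilter (ℱ := ℱ)
    (p := fun s => (∀ z ∈ s, 0 < z.2 ∧ z.1 + z.2 • (e, (0 : V)) ∈ smoothDom U) ∧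
      ∃ W : ℝ, RayEst (smPart U) (e, (0 : V)) s fun z => W * (‖z.1.1‖ + z.2))
    ⟨fun z hz => absurd hz (notMem_empty z), 0, fun j => ⟨0, fun z hz => absurd hz (notMem_empty z)⟩⟩
    (fun s ⟨h1, W, h2⟩ t hts => ⟨fun z hz => h1 z (hts hz), W,
      h2.mono (c := 0) hts fun z _ => by rw [add_zero]⟩)
    (fun s ⟨h1, W, h2⟩ t ⟨h1', W', h2'⟩ => ⟨fun z hz => hz.elim (h1 z) (h1' z), max W W',
      (h2.mono Subset.rfl (hmax (fun z hz => (h1 z hz).1) (le_max_left _ _))).union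
        (h2'.mono Subset.rfl (hmax (fun z hz => (h1' z hz).1) (le_max_right _ _)))⟩)
    (fun 𝒰 h𝒰 => (hend' 𝒰 h𝒰).2.exists_rayEst (hend' 𝒰 h𝒰).1)
  have hface : ∀ i, ∃ s ∈ ℱ, ∀ H, q.1 i = 0 → face i = some H → FaceEst (E H) U e L i s := by
    intro i
    by_cases hi : q.1 i = 0
    swap
    · exact ⟨univ, Filter.univ_mem, fun H h => absurd h hi⟩
    rcases hH : face i with _ | H
    · exact ⟨univ, Filter.univ_mem, fun H _ h => by simp at h⟩
    have hmax' : ∀ {s : Set (((Fin m → ℝ) × V) × ℝ)} {W W' ℓ ℓ' r : ℝ}, (∀ z ∈ s, 0 < z.2) →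
        W ≤ W' → ℓ ≤ ℓ' → ∀ z ∈ s, r * L z.1.1 i + W * ‖z.1.1‖ + ℓ * z.2 ≤
          r * L z.1.1 i + W' * ‖z.1.1‖ + ℓ' * z.2 + 0 := by
      intro s W W' ℓ ℓ' r hs hW hℓ z hz
      have h1 := mul_le_mul_of_nonneg_right hW (norm_nonneg z.1.1)
      have h2 := mul_le_mul_of_nonneg_right hℓ (hs z hz).le
      linarith
    obtain ⟨s, hs, -, hsE⟩ := exists_mem_of_ultrafilter (ℱ := ℱ)
      (p := fun s => (∀ z ∈ s, 0 < z.2) ∧ FaceEst (E H) U e L i s)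
      ⟨fun z hz => absurd hz (notMem_empty z), 0, fun N => ⟨0, fun j =>
        ⟨0, fun z hz => absurd hz (notMem_empty z)⟩⟩⟩
      (fun s ⟨h1, W, h2⟩ t hts => ⟨fun z hz => h1 z (hts hz), W, fun N => (h2 N).imp fun ℓ h =>
        h.mono (c := 0) hts fun z _ => by rw [add_zero]⟩)
      (fun s ⟨h1, W, h2⟩ t ⟨h1', W', h2'⟩ => ⟨fun z hz => hz.elim (h1 z) (h1' z), max W W',
        fun N => by
          obtain ⟨ℓ, h3⟩ := h2 N
          obtain ⟨ℓ', h3'⟩ := h2' N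
          exact ⟨max ℓ ℓ', (h3.mono Subset.rfl
            (hmax' h1 (le_max_left _ _) (le_max_left _ _))).union
            (h3'.mono Subset.rfl (hmax' h1' (le_max_right _ _) (le_max_right _ _)))⟩⟩)
      (fun 𝒰 h𝒰 => (hend' 𝒰 h𝒰).2.exists_faceEst (hend' 𝒰 h𝒰).1 hi hH)
    refine ⟨s, hs, fun H' _ hH' => ?_⟩
    obtain rfl := Option.some_injective _ hH'
    exact hsE
  choose s hs hsE using hface
  have hall : s₀ ∩ ⋂ i, s i ∈ ℱ := Filter.inter_mem hs₀ (Filter.iInter_mem.2 hs)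
  rw [hℱ, Filter.mem_inf_principal, Filter.mem_comap] at hall
  obtain ⟨t, ht, hts⟩ := hall
  obtain ⟨ε, hε, hball⟩ := Metric.mem_nhds_iff.1 ht
  have hsub : {z : ((Fin m → ℝ) × V) × ℝ | z.1 ∈ linBall (L : (Fin m → ℝ) →L[ℝ] (Fin m → ℝ)) q ε ∧
      0 < z.2} ⊆ s₀ ∩ ⋂ i, s i := fun z hz => hts (hball hz.1) hz.2
  refine ⟨ε, hε, fun x hx t ht => (hs₁ (x, t) (hsub (a := (x, t)) ⟨hx, ht⟩).1).2,
    ⟨W₀, hW₀.mono (c := 0) (fun z hz => (hsub hz).1) fun z _ => by rw [add_zero]⟩,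
    fun i H hi hH => ?_⟩
  obtain ⟨W, hW⟩ := hsE i H hi hH
  exact ⟨W, fun N => (hW N).imp fun ℓ h => h.mono (c := 0)
    (fun z hz => mem_iInter.1 (hsub hz).2 i) fun z _ => by rw [add_zero]⟩

end RayTheorem

/-! ### Polyhomogeneity of integrals along rays -/

section RayIntegral

variable {m : ℕ} {V : Type} [NormedAddCommGroup V] [NormedSpace ℝ V] {Face : Type}
variable {Ω : Opens ((Fin m → ℝ) × V)}

theorem aeval_expMul_comp (d : (Fin m → ℝ) × V) (ℓ : ((Fin m → ℝ) × V) →L[ℝ] ℂ) (P : ℂ[X])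
    (f : Sm Ω) : aeval (Sm.dirD Ω d) P (expMul Ω ℓ f) =
      expMul Ω ℓ (aeval (Sm.dirD Ω d) (P.comp (X + C (ℓ d))) f) := by
  rw [aeval_comp]
  refine (aeval_linear (expMul Ω ℓ) (fun a => ?_) P f).symm
  rw [dirD_expMul]
  simp [Module.algebraMap_end_apply]

theorem IndexSet.add_mem (E : IndexSet) (n : ℕ) {t : ℂ × ℕ} (ht : t ∈ E.carrier) :
    (t.1 + n, t.2) ∈ E.carrier := by
  induction n with
  | zero => simpa using ht
  | succ n ih =>
    have := E.add_one_closed _ _ ih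
    push_cast
    rwa [← add_assoc]

/-- Multiplication by `ρ ^ n` shifts exponents by `n`, and `E` is stable under adding `1`. Hence
multiplying by `s ^ 2` needs no new exponents. -/
theorem expPoly_dvd_comp (E : IndexSet) (s : ℝ) (n : ℕ) :
    expPoly (E.upTo s) ∣ (expPoly (E.upTo (s + n))).comp (X + C (n : ℂ)) := by
  have h1 : (expPoly (E.upTo (s + n))).comp (X + C (n : ℂ)) =
      expPoly ((E.upTo (s + n)).image fun t => (t.1 - n, t.2)) := by
    rw [expPoly, expPoly, prod_comp, Finset.prod_image]
    · refine Finset.prod_congr rfl fun t _ => ?_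
      simp only [sub_comp, X_comp, C_comp, map_sub]
      ring
    · rintro ⟨a, p⟩ - ⟨b, q⟩ - h
      simpa using h
  rw [h1]
  refine expPoly_dvd fun t ht => Finset.mem_image.2 ⟨(t.1 + n, t.2), ?_, by simp⟩
  rw [IndexSet.mem_upTo] at ht ⊢
  refine ⟨E.add_mem n ht.1, ?_⟩
  simpa using ht.2

variable {E : Face → IndexSet} {U : (Fin m → ℝ) × V → ℂ} {e : Fin m → ℝ}
  {L : (Fin m → ℝ) ≃L[ℝ] (Fin m → ℝ)} {face : Fin m → Option Face} {q : (Fin m → ℝ) × V}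
  {ker : ℝ → ℂ}

theorem mem_rayDom_of_rayEst {ℓ : ℝ} {Ω' : Opens ((Fin m → ℝ) × V)}
    {α : (Fin m → ℝ) × V} {hα : ∀ x ∈ Ω, ∀ t : ℝ, 0 < t → x + t • α ∈ Ω'}
    (hker : ∀ ℓ : ℝ, IntegrableOn (fun t => ‖ker t‖ * Real.exp (ℓ * t)) (Ioi 0)) (g : Sm Ω')
    {w : (Fin m → ℝ) × V → ℝ}
    (hg : RayEst g α {z | z.1 ∈ Ω ∧ 0 < z.2} fun z => w z.1 + ℓ * z.2) : g ∈ rayDom hα ker w := by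
  choose C hC using hg
  refine ⟨fun j t => C j * Real.exp (ℓ * t), Sm.smooth g, fun j => ?_, fun j x hx t ht => ?_⟩
  · exact ((hker ℓ).const_mul (C j)).congr (Filter.Eventually.of_forall fun t => by
      simp only
      ring)
  · refine (hC j (x, t) ⟨hx, ht⟩).trans (le_of_eq ?_)
    rw [Real.exp_add]
    ring

/-- The logarithmic coordinates are bounded above, so only their negative parts can be large. Thus a
factor `exp (W * ‖τ‖)` with `W ≥ 0` is controlled by the weight `-W` at every coordinate. -/
theorem exists_norm_le_logBall {q : (Fin m → ℝ) × V} {ε : ℝ} (hε : 0 < ε) :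
    ∃ C : ℝ, ∀ x ∈ logBall q ε, ‖x.1‖ ≤ C - ∑ l, x.1 l := by
  obtain ⟨c, hc⟩ := logBall_bddAbove (q := q) hε
  set C₀ := max c 0 with hC₀
  refine ⟨2 * (m * C₀), fun x hx => ?_⟩
  have h1 : ∀ l, |x.1 l| ≤ 2 * C₀ - x.1 l := by
    intro l
    have h2 := (hc x hx l).trans (le_max_left c 0)
    have h3 := le_max_right c 0
    rw [abs_le]
    constructor
    · linarith
    · linarith
  calc ‖x.1‖ ≤ ∑ l, |x.1 l| := by
        refine (pi_norm_le_iff_of_nonneg (by positivity)).2 fun l => ?_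
        exact Finset.single_le_sum (f := fun l => |x.1 l|) (fun _ _ => abs_nonneg _)
          (Finset.mem_univ l)
    _ ≤ ∑ l, (2 * C₀ - x.1 l) := Finset.sum_le_sum fun l _ => h1 l
    _ = _ := by
        rw [Finset.sum_sub_distrib]
        simp
        ring

/-- The integral along the rays of a function which is polyhomogeneous near the ends of the rays is
polyhomogeneous. -/
theorem phgNear_rayIntegral (hk : ContinuousOn ker (Ioi 0))
    (hker : ∀ ℓ : ℝ, IntegrableOn (fun t => ‖ker t‖ * Real.exp (ℓ * t)) (Ioi 0))
    (κ : (Fin m → ℝ) →L[ℝ] ℝ)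
    (hκ : ∀ i, ∃ p : ℕ, κ (L.symm (Pi.single i 1)) = p)
    (hend : ∀ 𝒰 : Ultrafilter (((Fin m → ℝ) × V) × ℝ),
      Filter.Tendsto (fun z : ((Fin m → ℝ) × V) × ℝ =>
        expMap (prodL V (L : (Fin m → ℝ) →L[ℝ] (Fin m → ℝ)) z.1)) 𝒰 (nhds q) →
      (∀ᶠ z in (𝒰 : Filter (((Fin m → ℝ) × V) × ℝ)), 0 < z.2) → RayEnd E U e L face q 𝒰) :
    ∃ ε > 0, (∀ x ∈ linBall (L : (Fin m → ℝ) →L[ℝ] (Fin m → ℝ)) q ε,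
        IntegrableOn (fun t : ℝ => ker t • U (x + t • (e, (0 : V)))) (Ioi 0)) ∧
      ∀ u : (Fin m → ℝ) × V → ℂ, (∀ x ∈ linBall (L : (Fin m → ℝ) →L[ℝ] (Fin m → ℝ)) q ε,
        u (expMap (prodL V (L : (Fin m → ℝ) →L[ℝ] (Fin m → ℝ)) x)) =
          Complex.exp (κ x.1) * ∫ t in Ioi (0 : ℝ), ker t • U (x + t • (e, (0 : V)))) →
        PhgNear E face u q := by
  obtain ⟨ε, hε, hα, ⟨W, hW⟩, hF⟩ := exists_ball_rayEst hend
  set Lc : (Fin m → ℝ) →L[ℝ] (Fin m → ℝ) := L.toContinuousLinearMap with hLc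
  set Ls : (Fin m → ℝ) →L[ℝ] (Fin m → ℝ) := L.symm.toContinuousLinearMap with hLs
  set Ω := linBall Lc q ε with hΩ
  set α : (Fin m → ℝ) × V := (e, 0) with hα'
  have hcont : ∀ (r W : ℝ) (i : Fin m), ContinuousOn
      (fun x : (Fin m → ℝ) × V => r * L x.1 i + W * ‖x.1‖) Ω := by
    intro r W i
    have : Continuous fun x : (Fin m → ℝ) × V => L x.1 i :=
      (continuous_apply i).comp (L.continuous.comp continuous_fst)
    exact ((continuous_const.mul this).add
      (continuous_const.mul (continuous_norm.comp continuous_fst))).continuousOn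
  have hcont₀ : ContinuousOn (fun x : (Fin m → ℝ) × V => W * ‖x.1‖) Ω :=
    (continuous_const.mul (continuous_norm.comp continuous_fst)).continuousOn
  have hg' : RayEst (smPart U) α {z | z.1 ∈ Ω ∧ 0 < z.2}
      fun z => W * ‖z.1.1‖ + W * z.2 :=
    hW.mono (c := 0) Subset.rfl fun z _ => by rw [mul_add, add_zero]
  have hg : smPart U ∈ rayDom hα ker fun x => W * ‖x.1‖ :=
    mem_rayDom_of_rayEst (ℓ := W) (w := fun x => W * ‖x.1‖) hker (smPart U) hg'
  have hUint : ∀ x ∈ Ω, (fun t : ℝ => ker t • smPart U (x + t • α)) =ᵐ[volume.restrict (Ioi 0)]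
      fun t : ℝ => ker t • U (x + t • α) := by
    intro x hx
    filter_upwards [ae_restrict_mem measurableSet_Ioi] with t ht
    rw [smPart, Sm.of_apply (hα x hx t ht)]
  refine ⟨ε, hε, fun x hx => ?_, fun u hu => ?_⟩
  · obtain ⟨β, hβ⟩ := hg
    exact (hβ.integrableOn hα hk hx).congr (hUint x hx)
  have hm : ∀ x ∈ logBall q ε, prodL V Ls x ∈ Ω := by
    intro x hx
    have : prodL V Lc (prodL V Ls x) = x := by simp [hLc, hLs]
    rw [hΩ, mem_linBall, this]
    exact hx
  set F := rayInt (smoothDom U) Ω α ker (smPart U) with hFdef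
  set Φ := pull (Ω := Ω) (Ω' := logBall q ε) (prodL V Ls) (prodL V Ls).contDiff.contDiffOn hm
    with hΦ
  set Λ : ((Fin m → ℝ) × V) →L[ℝ] ℂ :=
    Complex.ofRealCLM.comp (κ.comp (Ls.comp (ContinuousLinearMap.fst ℝ (Fin m → ℝ) V))) with hΛ
  have hpull : ∀ {w : (Fin m → ℝ) × V → ℝ} {f : Sm Ω}, f ∈ Sym Ω w →
      Φ f ∈ Sym (logBall q ε) fun x => w (prodL V Ls x) := fun hf =>
    pull_mem_Sym (hΨ := (prodL V Ls).contDiff.contDiffOn)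
      (fun j hj => (bounded_iteratedFDeriv_clm (prodL V Ls) j hj).imp fun C hC x _ => hC x) hf
  have hbd := logBall_bddAbove (q := q) hε
  obtain ⟨C₀, hsum⟩ := exists_norm_le_logBall (q := q) hε
  have hnorm : ∀ W : ℝ, ∃ W' : ℝ, 0 ≤ W' ∧ ∀ x : (Fin m → ℝ) × V,
      (Λ x).re + W * ‖(prodL V Ls x).1‖ ≤ W' * ‖x.1‖ := by
    intro W
    refine ⟨(‖κ‖ + |W|) * ‖Ls‖, by positivity, fun x => ?_⟩
    have h1 : (Λ x).re = κ (Ls x.1) := rfl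
    have h2 : κ (Ls x.1) ≤ ‖κ‖ * ‖Ls x.1‖ := (le_abs_self _).trans (κ.le_opNorm _)
    have h3 : W * ‖Ls x.1‖ ≤ |W| * ‖Ls x.1‖ := by gcongr; exact le_abs_self W
    have h4 : (‖κ‖ + |W|) * ‖Ls x.1‖ ≤ (‖κ‖ + |W|) * (‖Ls‖ * ‖x.1‖) := by
      gcongr
      exact Ls.le_opNorm _
    rw [h1, prodL_apply]
    linarith
  refine phgNear_of_annihilated hε (g := expMul _ Λ (Φ F)) (fun x hx => ?_) ?_ fun i H hi hH => ?_
  · have hx' := hm x hx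
    have h1 : prodL V Lc (prodL V Ls x) = x := by simp [hLc, hLs]
    have h2 := hu _ hx'
    rw [h1] at h2
    rw [h2, expMul_apply, hΦ, pull_apply _ hx, hFdef, rayInt_apply hα hk hcont₀ hg hx',
      integral_congr_ae (hUint _ hx')]
    rfl
  · obtain ⟨W', hW', hle⟩ := hnorm W
    refine ⟨fun _ => -W', Sym_mono (c := W' * C₀) (fun x hx => ?_)
      (expMul_mem_Sym Λ (hpull (rayInt_mem_Sym hα hk hcont₀ hg)))⟩
    refine (hle x).trans ((mul_le_mul_of_nonneg_left (hsum x hx) hW').trans (le_of_eq ?_))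
    rw [lin, ← Finset.mul_sum]
    ring
  · obtain ⟨W₁, hW₁⟩ := hF i H hi hH
    obtain ⟨p, hp⟩ := hκ i
    obtain ⟨W', hW', hle⟩ := hnorm W₁
    refine ⟨fun _ => -W', fun N => ?_⟩
    -- The fixed weight `-W'` also affects the coordinate `i`, so the order requested there is
    -- raised by `⌈W'⌉₊`.
    set N₁ : ℕ := N + ⌈W'⌉₊ with hN₁
    obtain ⟨ℓ, hℓ⟩ := hW₁ N₁
    -- The factor `exp κ` has exponent `p` at this face and shifts the exponents by `p`.
    refine ⟨N₁ + p, ?_⟩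
    set d : (Fin m → ℝ) × V := (L.symm (Pi.single i 1), 0) with hd
    set P := expPoly ((E H).upTo N₁) with hP
    have hΛi : Λ (ei V i) = (p : ℂ) := by
      change ((κ (L.symm (Pi.single i 1)) : ℝ) : ℂ) = p
      rw [hp]
      simp
    -- The operator has constant coefficients in `τ`, so it commutes with translation along the ray
    -- and passes under the integral.
    have h1 : aeval (Sm.dirD Ω d) P F ∈ Sym Ω fun x => N₁ * L x.1 i + W₁ * ‖x.1‖ := by
      rw [hFdef, ← rayInt_aeval hα hk hcont₀ d P hg]
      exact rayInt_mem_Sym hα hk (hcont _ _ i) 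
        (mem_rayDom_of_rayEst (ℓ := ℓ) (w := fun x => N₁ * L x.1 i + W₁ * ‖x.1‖) hker _ hℓ)
    have h2 := hpull h1
    rw [hΦ, pull_aeval (d' := ei V i) (fun x _ => by simp [hd, ei, hLs]), ← hΦ] at h2
    have h3 := aeval_mem_Sym_of_dvd (expPoly_dvd_comp (E H) N₁ p) h2
    push_cast
    rw [aeval_expMul_comp, hΛi]
    refine Sym_lin_mono hbd (w := Function.update (fun _ => -W') i (N₁ - W'))
      (lin_update_lin_le _ _ _ (fun _ _ => le_rfl) ?_) ?_
    · have := Nat.le_ceil W'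
      rw [hN₁]
      push_cast
      linarith
    · refine Sym_mono (c := W' * C₀) (fun x hx => ?_) (expMul_mem_Sym Λ h3)
      have h4 : L (prodL V Ls x).1 i = x.1 i := by simp [hLs]
      have h5 := (hle x).trans (mul_le_mul_of_nonneg_left (hsum x hx) hW')
      rw [h4, lin_update, lin, ← Finset.mul_sum]
      linarith

end RayIntegral

/-! ### The kernel -/

/-- The kernel of the integral in the variable `t = log (k / s)`. -/
def rayKernel (θ t : ℝ) : ℂ :=
  2 * Complex.exp (2 * t) * Complex.exp ((Real.exp (2 * t) : ℝ) * Complex.exp (θ * Complex.I))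

theorem continuous_rayKernel (θ : ℝ) : Continuous (rayKernel θ) := by
  unfold rayKernel
  fun_prop

theorem norm_rayKernel (θ t : ℝ) :
    ‖rayKernel θ t‖ = 2 * Real.exp (2 * t) * Real.exp (Real.exp (2 * t) * Real.cos θ) := by
  rw [rayKernel, norm_mul, norm_mul, Complex.norm_exp, Complex.norm_exp, Complex.re_ofReal_mul,
    Complex.exp_ofReal_mul_I_re]
  simp

/-- For `t > 0` the modulus is `2 * exp (2 * t) * exp (-r * exp (2 * t))` with `r = -cos θ > 0`,
which decays doubly exponentially. -/
theorem integrableOn_rayKernel {θ : ℝ} (h₁ : Real.pi / 2 < θ) (h₂ : θ < Real.pi) (ℓ : ℝ) :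
    IntegrableOn (fun t => ‖rayKernel θ t‖ * Real.exp (ℓ * t)) (Ioi 0) := by
  set r := -Real.cos θ with hr
  have hr0 : 0 < r := by
    have := Real.cos_neg_of_pi_div_two_lt_of_lt h₁ (by linarith [Real.pi_pos])
    linarith
  -- From `exp y ≥ y ^ n / n!` one gains `exp (-2 * n * t)`; with `2 * n > 3 + ℓ` the total exponent
  -- is at most `-t`.
  obtain ⟨n, hn⟩ := exists_nat_gt ((3 + ℓ) / 2)
  have hint := (exp_neg_integrableOn_Ioi (0 : ℝ) one_pos).const_mul (2 * (n.factorial / r ^ n))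
  refine Integrable.mono' hint ?_ ?_
  · have : Continuous fun t => ‖rayKernel θ t‖ * Real.exp (ℓ * t) :=
      (continuous_rayKernel θ).norm.mul (by fun_prop)
    exact this.aestronglyMeasurable
  filter_upwards [ae_restrict_mem measurableSet_Ioi] with t ht
  have ht' : 0 < t := ht
  rw [norm_rayKernel, Real.norm_of_nonneg (by positivity)]
  have h3 : Real.exp (Real.exp (2 * t) * Real.cos θ) ≤
      n.factorial / r ^ n * Real.exp (-(2 * n * t)) := by
    have h4 := Real.pow_div_factorial_le_exp (Real.exp (2 * t) * r) (by positivity) n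
    have h5 : Real.exp (Real.exp (2 * t) * Real.cos θ) = (Real.exp (Real.exp (2 * t) * r))⁻¹ := by
      rw [← Real.exp_neg, hr]
      ring_nf
    have h6 : n.factorial / r ^ n * Real.exp (-(2 * n * t)) =
        ((Real.exp (2 * t) * r) ^ n / n.factorial)⁻¹ := by
      rw [Real.exp_neg, mul_pow, ← Real.exp_nat_mul]
      have : (n : ℝ) * (2 * t) = 2 * n * t := by ring
      rw [this]
      field_simp
    rw [h5, h6]
    exact inv_anti₀ (by positivity) h4
  calc 2 * Real.exp (2 * t) * Real.exp (Real.exp (2 * t) * Real.cos θ) * Real.exp (ℓ * t)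
      ≤ 2 * Real.exp (2 * t) * (n.factorial / r ^ n * Real.exp (-(2 * n * t))) *
          Real.exp (ℓ * t) := by gcongr
    _ = 2 * (n.factorial / r ^ n) *
          (Real.exp (2 * t) * Real.exp (-(2 * n * t)) * Real.exp (ℓ * t)) := by ring
    _ ≤ 2 * (n.factorial / r ^ n) * Real.exp (-1 * t) := by
        rw [← Real.exp_add, ← Real.exp_add]
        gcongr
        nlinarith

theorem exp_image_Ioi {s : ℝ} (hs : 0 < s) : (fun t => s * Real.exp t) '' Ioi 0 = Ioi s := by
  ext k
  constructor
  · rintro ⟨t, ht, rfl⟩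
    have := Real.one_lt_exp_iff.2 ht
    exact (lt_mul_iff_one_lt_right hs).2 this
  · intro hk
    have hk' : s < k := hk
    refine ⟨Real.log (k / s), Real.log_pos ((one_lt_div hs).2 hk'), ?_⟩
    simp only
    rw [Real.exp_log (div_pos (hs.trans hk') hs)]
    field_simp

section ChangeOfVariables

variable {s : ℝ} (θ : ℝ) (G : ℝ → ℂ)

theorem ray_integrand_eq (hs : 0 < s) (t : ℝ) :
    |s * Real.exp t| • (2 * ((s * Real.exp t : ℝ) : ℂ) *
      Complex.exp (((s * Real.exp t / s) ^ 2 : ℝ) * Complex.exp (θ * Complex.I)) *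
      G (s * Real.exp t)) = (s : ℂ) ^ 2 * (rayKernel θ t • G (s * Real.exp t)) := by
  rw [abs_of_pos (by positivity), mul_div_cancel_left₀ _ hs.ne', ← Real.exp_nat_mul, rayKernel,
    Complex.real_smul, smul_eq_mul]
  have h : Complex.exp (2 * t) = ((Real.exp t : ℝ) : ℂ) ^ 2 := by
    rw [Complex.ofReal_exp, ← Complex.exp_nat_mul]
    norm_num
  rw [h]
  push_cast
  ring

/-- Substitution `k = s * exp t`: the Jacobian and the factor `2 * k` together give `s ^ 2` times
the factor `2 * exp (2 * t)` of the kernel. -/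
theorem integral_ray (hs : 0 < s) :
    ∫ k in Ioi s, 2 * (k : ℂ) * Complex.exp (((k / s) ^ 2 : ℝ) * Complex.exp (θ * Complex.I)) *
        G k = (s : ℂ) ^ 2 * ∫ t in Ioi (0 : ℝ), rayKernel θ t • G (s * Real.exp t) := by
  rw [← exp_image_Ioi hs, integral_image_eq_integral_abs_deriv_smul measurableSet_Ioi
    (fun t _ => ((Real.hasDerivAt_exp t).const_mul s).hasDerivWithinAt)
    (fun a _ b _ h => Real.exp_injective (mul_left_cancel₀ hs.ne' h)), ← integral_const_mul]
  exact integral_congr_ae (Filter.Eventually.of_forall fun t => ray_integrand_eq θ G hs t)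

theorem integrableOn_ray (hs : 0 < s)
    (h : IntegrableOn (fun t => rayKernel θ t • G (s * Real.exp t)) (Ioi 0)) :
    IntegrableOn (fun k : ℝ => 2 * (k : ℂ) *
      Complex.exp (((k / s) ^ 2 : ℝ) * Complex.exp (θ * Complex.I)) * G k) (Ioi s) := by
  rw [← exp_image_Ioi hs, integrableOn_image_iff_integrableOn_abs_deriv_smul measurableSet_Ioi
    (fun t _ => ((Real.hasDerivAt_exp t).const_mul s).hasDerivWithinAt)
    (fun a _ b _ h => Real.exp_injective (mul_left_cancel₀ hs.ne' h))]
  exact (Integrable.const_mul h ((s : ℂ) ^ 2)).congr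
    (Filter.Eventually.of_forall fun t => (ray_integrand_eq θ G hs t).symm)

end ChangeOfVariables

/-! ### Monomial charts and the rays in the direction of `k` -/

section LogCharts

variable {n : ℕ} {V : Type} [NormedAddCommGroup V] [NormedSpace ℝ V] {Face : Type}

/-- Coordinates `ρ` which are monomials in the quantities `g = (k, …)`: `log ρ = L (log g)` and
`g = mono ρ`, where all components but `k` are continuous up to the boundary. -/
structure LogChart (n : ℕ) (Face : Type) where
  face : Fin (n + 1) → Option Face
  L : (Fin (n + 1) → ℝ) ≃L[ℝ] (Fin (n + 1) → ℝ)
  mono : (Fin (n + 1) → ℝ) → (Fin (n + 1) → ℝ)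
  mono_exp : ∀ τ, mono (fun l => Real.exp (L τ l)) = fun l => Real.exp (τ l)
  continuous_mono : ∀ l, l ≠ 0 → Continuous fun ρ => mono ρ l

/-- The direction in which only `k` increases. -/
def kDir (n : ℕ) : Fin (n + 1) → ℝ := Pi.single 0 1

/-- Let a ray start in the domain of the chart `s` and end in the domain of `c`. Every expansion at
a face of `s` is seen in `c`, unless the ray ends far from this face. -/
def LogChart.Compat (s c : LogChart n Face) : Prop :=
  ∀ j H, s.face j = some H →
    (∃ j', c.face j' = some H ∧ c.L (s.L.symm (Pi.single j 1)) = Pi.single j' 1 ∧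
      -- The factors `3` are generous and serve all pairs of charts below; only linearity in `t` and
      -- `C` matters.
      ∀ (τ : Fin (n + 1) → ℝ) (t C : ℝ), 0 ≤ C → 0 < t → (∀ l, s.L τ l ≤ C) →
        (∀ l, c.L (τ + t • kDir n) l ≤ C) → c.L (τ + t • kDir n) j' ≤ s.L τ j + 3 * t + 3 * C) ∨
    ∀ (τ : Fin (n + 1) → ℝ) (t C : ℝ), 0 ≤ C → 0 < t → (∀ l, s.L τ l ≤ C) →
      (∀ l, c.L (τ + t • kDir n) l ≤ C) → 0 ≤ s.L τ j + 3 * t + 3 * C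

variable {ι : Type} {c : ι → LogChart n Face} {E : Face → IndexSet}
  {T : (Fin (n + 1) → ℝ) → V → ℂ} {P : (Fin (n + 1) → ℝ) → V → Prop}

/-- Every ultrafilter on the values of `(k, …)` for which all components but `k` converge has a
limit in one of the charts. -/
def Covers (c : ι → LogChart n Face) : Prop :=
  ∀ 𝒰 : Ultrafilter (Fin (n + 1) → ℝ),
    (∀ l, l ≠ 0 → ∃ r, Filter.Tendsto (fun τ : Fin (n + 1) → ℝ => Real.exp (τ l)) 𝒰 (nhds r)) →
    ∃ i ρ, Filter.Tendsto (fun τ l => Real.exp ((c i).L τ l)) 𝒰 (nhds ρ)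

theorem eventually_le_of_tendsto_exp {Z ι : Type*} [Fintype ι] {ℱ : Filter Z} {f : Z → ι → ℝ}
    {ρ : ι → ℝ} (h : Filter.Tendsto (fun z l => Real.exp (f z l)) ℱ (nhds ρ)) :
    ∀ᶠ z in ℱ, ∀ l, f z l ≤ ‖ρ‖ + 1 := by
  have h1 := h.norm.eventually_lt_const (lt_add_one ‖ρ‖)
  filter_upwards [h1] with z hz l
  have h2 := (le_abs_self _).trans (norm_le_pi_norm (fun l => Real.exp (f z l)) l)
  linarith [Real.add_one_le_exp (f z l)]

/-- Along a ray only `k` changes, so the other quantities converge with the starting points.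
`Covers` then provides a chart in which the ends converge; since `P` ignores `k`, the limit lies in
the domain of that chart, and `LogChart.Compat` compares the faces. -/
theorem LogChart.rayEnd (s : LogChart n Face) (hP : ∀ g g' v, (∀ l, l ≠ 0 → g l = g' l) →
      P g v → P g' v)
    (hT : ∀ i ρ v, (∀ l, 0 ≤ ρ l) → P ((c i).mono ρ) v →
      PhgNear E (c i).face (fun q => T ((c i).mono q.1) q.2) (ρ, v))
    (hc : Covers c) (hcomp : ∀ i, s.Compat (c i)) {ρ : Fin (n + 1) → ℝ} {v : V}
    (hPv : P (s.mono ρ) v) (𝒰 : Ultrafilter (((Fin (n + 1) → ℝ) × V) × ℝ))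
    (hlim : Filter.Tendsto (fun z : ((Fin (n + 1) → ℝ) × V) × ℝ =>
      expMap (prodL V (s.L : (Fin (n + 1) → ℝ) →L[ℝ] (Fin (n + 1) → ℝ)) z.1)) 𝒰 (nhds (ρ, v)))
    (hpos : ∀ᶠ z in (𝒰 : Filter (((Fin (n + 1) → ℝ) × V) × ℝ)), 0 < z.2) :
    RayEnd E (fun x => T (fun l => Real.exp (x.1 l)) x.2) (kDir n) s.L s.face (ρ, v) 𝒰 := by
  have hlim₁ : Filter.Tendsto (fun (z : ((Fin (n + 1) → ℝ) × V) × ℝ) l =>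
      Real.exp (s.L z.1.1 l)) 𝒰 (nhds ρ) := (continuous_fst.tendsto (ρ, v)).comp hlim
  have hlim₂ : Filter.Tendsto (fun z : ((Fin (n + 1) → ℝ) × V) × ℝ => z.1.2) 𝒰 (nhds v) := by
    have := (continuous_snd.tendsto (ρ, v)).comp hlim
    exact this
  have hbase : ∀ l, l ≠ 0 → Filter.Tendsto (fun z : ((Fin (n + 1) → ℝ) × V) × ℝ =>
      Real.exp ((z.1.1 + z.2 • kDir n) l)) 𝒰 (nhds (s.mono ρ l)) := by
    intro l hl
    refine (((s.continuous_mono l hl).tendsto ρ).comp hlim₁).congr fun z => ?_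
    simp [s.mono_exp, kDir, hl]
  obtain ⟨i, ρ', hρ'⟩ := hc (𝒰.map fun z : ((Fin (n + 1) → ℝ) × V) × ℝ => z.1.1 + z.2 • kDir n) fun l hl =>
    ⟨_, Filter.tendsto_map'_iff.2 (hbase l hl)⟩
  have hρ'' : Filter.Tendsto (fun (z : ((Fin (n + 1) → ℝ) × V) × ℝ) l =>
      Real.exp ((c i).L (z.1.1 + z.2 • kDir n) l)) 𝒰 (nhds ρ') := Filter.tendsto_map'_iff.1 hρ'
  have hmono : ∀ l, l ≠ 0 → s.mono ρ l = (c i).mono ρ' l := by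
    intro l hl
    refine tendsto_nhds_unique (hbase l hl) ?_
    exact ((((c i).continuous_mono l hl).tendsto ρ').comp hρ'').congr fun z =>
      congrFun ((c i).mono_exp _) l
  have hnonneg : ∀ l, 0 ≤ ρ' l := fun l =>
    ge_of_tendsto (((continuous_apply l).tendsto ρ').comp hρ'')
      (Filter.Eventually.of_forall fun z => (Real.exp_pos _).le)
  refine ⟨((c i).L : (Fin (n + 1) → ℝ) →L[ℝ] (Fin (n + 1) → ℝ)), (c i).face,
    fun q => T ((c i).mono q.1) q.2, (ρ', v), fun x => ?_, hT i ρ' v hnonneg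
      (hP _ _ _ hmono hPv), ?_, fun j H _ hH => ?_⟩
  · simp [expMap, (c i).mono_exp]
  · have h1 := hρ''.prodMk_nhds hlim₂
    refine h1.congr fun z => ?_
    simp [expMap]
  · have hb := (eventually_le_of_tendsto_exp hlim₁).and
      ((eventually_le_of_tendsto_exp hρ'').and hpos)
    set C := max (‖ρ‖ + 1) (‖ρ'‖ + 1)
    have hC : 0 ≤ C := le_max_of_le_left (by positivity)
    rcases hcomp i j H hH with ⟨j', hj', hd, hle⟩ | hle
    · refine Or.inl ⟨j', hj', hd, 3, 3 * C, ?_⟩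
      filter_upwards [hb] with z hz
      exact hle _ _ C hC hz.2.2 (fun l => (hz.1 l).trans (le_max_left _ _))
        fun l => (hz.2.1 l).trans (le_max_right _ _)
    · refine Or.inr ⟨3, 3 * C, ?_⟩
      filter_upwards [hb] with z hz
      exact hle _ _ C hC hz.2.2 (fun l => (hz.1 l).trans (le_max_left _ _))
        fun l => (hz.2.1 l).trans (le_max_right _ _)

/-- The integral of `rayIntegrand` over `k > g 0`, with the other variables frozen. -/
def rayTransform (θ : ℝ) (T : (Fin (n + 1) → ℝ) → V → ℂ) (g : Fin (n + 1) → ℝ) (v : V) : ℂ :=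
  ∫ k in Ioi (g 0), 2 * (k : ℂ) *
    Complex.exp (((k / g 0) ^ 2 : ℝ) * Complex.exp (θ * Complex.I)) * T (Function.update g 0 k) v

theorem update_exp (τ : Fin (n + 1) → ℝ) (t : ℝ) :
    Function.update (fun l => Real.exp (τ l)) 0 (Real.exp (τ 0) * Real.exp t) =
      fun l => Real.exp ((τ + t • kDir n) l) := by
  funext l
  by_cases hl : l = 0
  · subst hl
    simp [kDir, Real.exp_add]
  · simp [kDir, hl]

theorem LogChart.phgNear_rayTransform {θ : ℝ} (hθ₁ : Real.pi / 2 < θ) (hθ₂ : θ < Real.pi)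
    (s : LogChart n Face)
    (hP : ∀ g g' v, (∀ l, l ≠ 0 → g l = g' l) → P g v → P g' v)
    (hT : ∀ i ρ v, (∀ l, 0 ≤ ρ l) → P ((c i).mono ρ) v →
      PhgNear E (c i).face (fun q => T ((c i).mono q.1) q.2) (ρ, v))
    (hc : Covers c) (hcomp : ∀ i, s.Compat (c i))
    (hs : ∀ j, ∃ p : ℕ, s.L.symm (Pi.single j 1) 0 = p) {ρ : Fin (n + 1) → ℝ} {v : V}
    (hPv : P (s.mono ρ) v) :
    (∃ ε > 0, ∀ x ∈ linBall (s.L : (Fin (n + 1) → ℝ) →L[ℝ] (Fin (n + 1) → ℝ)) (ρ, v) ε,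
      IntegrableOn (fun k : ℝ => 2 * (k : ℂ) *
        Complex.exp (((k / Real.exp (x.1 0)) ^ 2 : ℝ) * Complex.exp (θ * Complex.I)) *
        T (Function.update (fun l => Real.exp (x.1 l)) 0 k) x.2) (Ioi (Real.exp (x.1 0)))) ∧
    PhgNear E s.face (fun q => rayTransform θ T (s.mono q.1) q.2) (ρ, v) := by
  -- `exp κ` is the factor `s ^ 2` from the substitution; its exponent `2 * p` at each coordinate is
  -- a natural number.
  set κ : (Fin (n + 1) → ℝ) →L[ℝ] ℝ :=
    (2 : ℝ) • ContinuousLinearMap.proj (R := ℝ) (φ := fun _ : Fin (n + 1) => ℝ) 0 with hκ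
  obtain ⟨ε, hε, hint, hphg⟩ := phgNear_rayIntegral (E := E) (L := s.L) (face := s.face)
    (q := (ρ, v)) (ker := rayKernel θ) (continuous_rayKernel θ).continuousOn
    (integrableOn_rayKernel hθ₁ hθ₂) κ (fun j => by
      obtain ⟨p, hp⟩ := hs j
      refine ⟨2 * p, ?_⟩
      simp [hκ, hp])
    (s.rayEnd hP hT hc hcomp hPv)
  have key : ∀ x : (Fin (n + 1) → ℝ) × V, ∀ t : ℝ,
      T (Function.update (fun l => Real.exp (x.1 l)) 0 (Real.exp (x.1 0) * Real.exp t)) x.2 =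
        T (fun l => Real.exp ((x + t • (kDir n, (0 : V))).1 l))
          (x + t • (kDir n, (0 : V))).2 := by
    intro x t
    rw [update_exp]
    simp
  refine ⟨⟨ε, hε, fun x hx => ?_⟩, hphg _ fun x hx => ?_⟩
  · refine integrableOn_ray θ (fun k => T (Function.update (fun l => Real.exp (x.1 l)) 0 k) x.2)
      (Real.exp_pos _) ?_
    simp only [key]
    exact hint x hx
  · have h1 : s.mono (expMap (prodL V (s.L : (Fin (n + 1) → ℝ) →L[ℝ] (Fin (n + 1) → ℝ)) x)).1 =
        fun l => Real.exp (x.1 l) := s.mono_exp x.1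
    change rayTransform θ T (s.mono (expMap (prodL V
      (s.L : (Fin (n + 1) → ℝ) →L[ℝ] (Fin (n + 1) → ℝ)) x)).1) x.2 = _
    rw [h1, rayTransform,
      integral_ray θ (fun k => T (Function.update (fun l => Real.exp (x.1 l)) 0 k) x.2)
      (Real.exp_pos _)]
    have hI : ∀ t : ℝ, rayKernel θ t • T (Function.update (fun l => Real.exp (x.1 l)) 0
        (Real.exp (x.1 0) * Real.exp t)) x.2 = _ := fun t => congrArg (rayKernel θ t • ·) (key x t)
    rw [integral_congr_ae (Filter.Eventually.of_forall hI)]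
    congr 1
    rw [Complex.ofReal_exp, ← Complex.exp_nat_mul]
    simp [hκ]

end LogCharts

/-! ### The families of charts in one, two and three coordinates -/

section Templates

variable {n : ℕ} {Face : Type}

/-- The invertible linear map with matrix `A`. -/
def matrixEquiv (A B : Matrix (Fin (n + 1)) (Fin (n + 1)) ℝ) (hAB : A * B = 1) :
    (Fin (n + 1) → ℝ) ≃L[ℝ] (Fin (n + 1) → ℝ) :=
  ContinuousLinearEquiv.equivOfInverse A.mulVecLin.toContinuousLinearMap
    B.mulVecLin.toContinuousLinearMap
    (fun τ => by simp [mul_eq_one_comm.1 hAB]) (fun τ => by simp [hAB])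

@[simp] theorem matrixEquiv_apply (A B : Matrix (Fin (n + 1)) (Fin (n + 1)) ℝ) (hAB : A * B = 1)
    (τ : Fin (n + 1) → ℝ) : matrixEquiv A B hAB τ = A.mulVec τ := rfl

@[simp] theorem matrixEquiv_symm_apply (A B : Matrix (Fin (n + 1)) (Fin (n + 1)) ℝ)
    (hAB : A * B = 1) (τ : Fin (n + 1) → ℝ) : (matrixEquiv A B hAB).symm τ = B.mulVec τ := rfl

/-- Either `f` is eventually bounded above, so that `exp f` stays in a compact interval, or the
ultrafilter property forces `f` to tend to infinity. -/
theorem ultrafilter_exp_dichotomy {Z : Type*} (𝒰 : Ultrafilter Z) (f : Z → ℝ) :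
    (∃ r, Filter.Tendsto (fun z => Real.exp (f z)) 𝒰 (nhds r)) ∨
      Filter.Tendsto (fun z => Real.exp (-f z)) 𝒰 (nhds 0) := by
  by_cases h : ∃ C : ℝ, ∀ᶠ z in (𝒰 : Filter Z), f z ≤ C
  · left
    obtain ⟨C, hC⟩ := h
    have h1 : ∀ᶠ z in (𝒰 : Filter Z), Real.exp (f z) ∈ Icc (0 : ℝ) (Real.exp C) := by
      filter_upwards [hC] with z hz
      exact ⟨(Real.exp_pos _).le, Real.exp_le_exp.2 hz⟩
    obtain ⟨r, -, hr⟩ := (isCompact_Icc (a := (0 : ℝ)) (b := Real.exp C)).ultrafilter_le_nhds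
      (𝒰.map fun z => Real.exp (f z)) (Filter.le_principal_iff.2 h1)
    exact ⟨r, hr⟩
  · right
    refine Real.tendsto_exp_neg_atTop_nhds_zero.comp ?_
    refine Filter.tendsto_atTop.2 fun C => ?_
    push Not at h
    rcases 𝒰.em (fun z => f z ≤ C) with h1 | h1
    · exact absurd h1 (Filter.not_eventually.2 ((h C).mono fun _ h => not_le.2 h).frequently)
    · exact h1.mono fun z hz => (not_le.1 hz).le

/-! #### One coordinate -/

/-- The coordinate `k`. -/
def chart₁I (fz : Face) : LogChart 0 Face where
  face := ![some fz]
  L := matrixEquiv 1 1 (mul_one _)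
  mono ρ := ![ρ 0]
  mono_exp τ := by
    funext l
    fin_cases l
    simp
  continuous_mono l hl := absurd (Fin.eq_zero l) hl

/-- The coordinate `1/k`. -/
def chart₁L : LogChart 0 Face where
  face := ![none]
  L := matrixEquiv (-1) (-1) (by simp)
  mono ρ := ![(ρ 0)⁻¹]
  mono_exp τ := by
    funext l
    fin_cases l
    simp [Matrix.neg_mulVec, Real.exp_neg]
  continuous_mono l hl := absurd (Fin.eq_zero l) hl

/-- The charts `k`, `1/k`. -/
def charts₁ (fz : Face) : Fin 2 → LogChart 0 Face := ![chart₁I fz, chart₁L]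

theorem covers₁ (fz : Face) : Covers (charts₁ fz) := by
  intro 𝒰 _
  rcases ultrafilter_exp_dichotomy 𝒰 (fun τ => τ 0) with ⟨r, hr⟩ | h
  · refine ⟨0, ![r], tendsto_pi_nhds.2 fun l => ?_⟩
    fin_cases l
    simpa [charts₁, chart₁I] using hr
  · refine ⟨1, ![0], tendsto_pi_nhds.2 fun l => ?_⟩
    fin_cases l
    simpa [charts₁, chart₁L, Matrix.neg_mulVec] using h

theorem compat₁ (fz : Face) (i : Fin 2) : (chart₁I fz).Compat (charts₁ fz i) := by
  intro j H hj
  fin_cases j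
  obtain rfl : fz = H := by simpa [chart₁I] using hj
  fin_cases i
  · refine Or.inl ⟨0, rfl, ?_, fun τ t C hC ht _ _ => ?_⟩
    · ext l
      fin_cases l
      simp [charts₁, chart₁I, Matrix.mulVec, dotProduct]
    · simp [charts₁, chart₁I, kDir]
      linarith
  · refine Or.inr fun τ t C hC ht _ h => ?_
    have := h 0
    simp [charts₁, chart₁L, chart₁I, kDir, Matrix.neg_mulVec] at this ⊢
    linarith

/-! #### Two coordinates -/

/-- The coordinates `B/k, k`. -/
def chart₂I (fb fb₀ : Face) : LogChart 1 Face where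
  face := ![some fb, some fb₀]
  L := matrixEquiv !![-1, 1; 1, 0] !![0, 1; 1, 1] (by ext i j; fin_cases i <;> fin_cases j <;> simp)
  mono ρ := ![ρ 1, ρ 0 * ρ 1]
  mono_exp τ := by
    funext l
    fin_cases l <;> simp [← Real.exp_add, Matrix.mulVec, dotProduct]
  continuous_mono l hl := by
    fin_cases l
    · exact absurd rfl hl
    · simp only [Fin.mk_one, Matrix.cons_val_one, Matrix.cons_val_fin_one]
      fun_prop

/-- The coordinates `k/B, B`. -/
def chart₂II (fz fb₀ : Face) : LogChart 1 Face where
  face := ![some fz, some fb₀]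
  L := matrixEquiv !![1, -1; 0, 1] !![1, 1; 0, 1] (by ext i j; fin_cases i <;> fin_cases j <;> simp)
  mono ρ := ![ρ 0 * ρ 1, ρ 1]
  mono_exp τ := by
    funext l
    fin_cases l <;> simp [← Real.exp_add, Matrix.mulVec, dotProduct]
  continuous_mono l hl := by
    fin_cases l
    · exact absurd rfl hl
    · simp only [Fin.mk_one, Matrix.cons_val_one, Matrix.cons_val_fin_one]
      fun_prop

/-- The coordinates `1/k, B`. -/
def chart₂L (fb : Face) : LogChart 1 Face where
  face := ![none, some fb]
  L := matrixEquiv !![-1, 0; 0, 1] !![-1, 0; 0, 1]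
    (by ext i j; fin_cases i <;> fin_cases j <;> simp)
  mono ρ := ![(ρ 0)⁻¹, ρ 1]
  mono_exp τ := by
    funext l
    fin_cases l <;> simp [← Real.exp_neg, Matrix.mulVec, dotProduct]
  continuous_mono l hl := by
    fin_cases l
    · exact absurd rfl hl
    · simp only [Fin.mk_one, Matrix.cons_val_one, Matrix.cons_val_fin_one]
      fun_prop

/-- The charts for one boundary variable `B`. -/
def charts₂ (fb fb₀ fz : Face) : Fin 3 → LogChart 1 Face :=
  ![chart₂I fb fb₀, chart₂II fz fb₀, chart₂L fb]

theorem covers₂ (fb fb₀ fz : Face) : Covers (charts₂ fb fb₀ fz) := by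
  intro 𝒰 hconv
  obtain ⟨rb, hb⟩ := hconv 1 (by simp)
  rcases ultrafilter_exp_dichotomy 𝒰 (fun τ => -τ 0) with ⟨r, hr⟩ | h
  · refine ⟨2, ![r, rb], tendsto_pi_nhds.2 fun l => ?_⟩
    fin_cases l
    · simpa [charts₂, chart₂L, Matrix.mulVec, dotProduct] using hr
    · simpa [charts₂, chart₂L, Matrix.mulVec, dotProduct] using hb
  rcases ultrafilter_exp_dichotomy 𝒰 (fun τ => -τ 0 + τ 1) with ⟨r, hr⟩ | h'
  · refine ⟨0, ![r, 0], tendsto_pi_nhds.2 fun l => ?_⟩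
    fin_cases l
    · simpa [charts₂, chart₂I, Matrix.mulVec, dotProduct] using hr
    · simpa [charts₂, chart₂I, Matrix.mulVec, dotProduct] using h
  · refine ⟨1, ![0, rb], tendsto_pi_nhds.2 fun l => ?_⟩
    fin_cases l
    · simpa [charts₂, chart₂II, Matrix.mulVec, dotProduct, add_comm] using h'
    · simpa [charts₂, chart₂II, Matrix.mulVec, dotProduct] using hb

/-- A finite check. The labels are variables, so `rfl` finds the coordinate of the end chart with
the same label, if there is one; what remains is a matrix identity and a linear inequality. Without
such a coordinate, the bounds in the end chart keep the start away from the face up to a power of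
`exp t`. -/
theorem compat₂ (fb fb₀ fz : Face) (i : Fin 3) (hi : i ≠ 2) (i' : Fin 3) :
    (charts₂ fb fb₀ fz i).Compat (charts₂ fb fb₀ fz i') := by
  intro j H hj
  fin_cases i <;> first | exact absurd rfl hi | skip
  all_goals fin_cases j <;> fin_cases i' <;> (obtain rfl := Option.some_injective _ hj)
  all_goals
    first
    | refine Or.inl ⟨0, rfl, ?_, fun τ t C hC ht h h' => ?_⟩
    | refine Or.inl ⟨1, rfl, ?_, fun τ t C hC ht h h' => ?_⟩
    | refine Or.inr fun τ t C hC ht h h' => ?_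
  all_goals
    first
    | (have h0 := h 0
       have h1 := h 1
       have h'0 := h' 0
       have h'1 := h' 1
       simp [charts₂, chart₂I, chart₂II, chart₂L, kDir, Matrix.mulVec, dotProduct] at h0 h1 h'0 h'1 ⊢
       linarith)
    | (ext l
       fin_cases l <;> simp [charts₂, chart₂I, chart₂II, chart₂L, Matrix.mulVec, dotProduct])

/-! #### Three coordinates -/

/-- The coordinates `k, A/k, B`. -/
def chart₃I (f₀ f₁ fb : Face) : LogChart 2 Face where
  face := ![some f₀, some f₁, some fb]
  L := matrixEquiv !![1, 0, 0; -1, 1, 0; 0, 0, 1] !![1, 0, 0; 1, 1, 0; 0, 0, 1]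
    (by ext i j; fin_cases i <;> fin_cases j <;> simp [Matrix.mul_apply, Fin.sum_univ_three])
  mono ρ := ![ρ 0, ρ 0 * ρ 1, ρ 2]
  mono_exp τ := by
    funext l
    fin_cases l <;> simp [← Real.exp_add, Matrix.mulVec, dotProduct, Fin.sum_univ_three]
  continuous_mono l hl := by
    fin_cases l
    · exact absurd rfl hl
    all_goals simp
    all_goals fun_prop

/-- The coordinates `A/k, B, k`. -/
def chart₃I' (f₁ fb f₀ : Face) : LogChart 2 Face where
  face := ![some f₁, some fb, some f₀]
  L := matrixEquiv !![-1, 1, 0; 0, 0, 1; 1, 0, 0] !![0, 0, 1; 1, 0, 1; 0, 1, 0]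
    (by ext i j; fin_cases i <;> fin_cases j <;> simp [Matrix.mul_apply, Fin.sum_univ_three])
  mono ρ := ![ρ 2, ρ 0 * ρ 2, ρ 1]
  mono_exp τ := by
    funext l
    fin_cases l <;> simp [← Real.exp_add, Matrix.mulVec, dotProduct, Fin.sum_univ_three]
  continuous_mono l hl := by
    fin_cases l
    · exact absurd rfl hl
    all_goals simp
    all_goals fun_prop

/-- The coordinates `A, k/A, AB/k`. -/
def chart₃II (f₀ fb₀ fb : Face) : LogChart 2 Face where
  face := ![some f₀, some fb₀, some fb]
  L := matrixEquiv !![0, 1, 0; 1, -1, 0; -1, 1, 1] !![1, 1, 0; 1, 0, 0; 0, 1, 1]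
    (by ext i j; fin_cases i <;> fin_cases j <;> simp [Matrix.mul_apply, Fin.sum_univ_three])
  mono ρ := ![ρ 0 * ρ 1, ρ 0, ρ 1 * ρ 2]
  mono_exp τ := by
    funext l
    fin_cases l <;> simp [← Real.exp_add, Matrix.mulVec, dotProduct, Fin.sum_univ_three]
    ring
  continuous_mono l hl := by
    fin_cases l
    · exact absurd rfl hl
    all_goals simp
    all_goals fun_prop

/-- The coordinates `A, B, k/(AB)`. -/
def chart₃III (f₀ fb₀ fz : Face) : LogChart 2 Face where
  face := ![some f₀, some fb₀, some fz]
  L := matrixEquiv !![0, 1, 0; 0, 0, 1; 1, -1, -1] !![1, 1, 1; 1, 0, 0; 0, 1, 0]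
    (by ext i j; fin_cases i <;> fin_cases j <;> simp [Matrix.mul_apply, Fin.sum_univ_three])
  mono ρ := ![ρ 0 * ρ 1 * ρ 2, ρ 0, ρ 1]
  mono_exp τ := by
    funext l
    fin_cases l <;> simp [← Real.exp_add, Matrix.mulVec, dotProduct, Fin.sum_univ_three]
    ring
  continuous_mono l hl := by
    fin_cases l
    · exact absurd rfl hl
    all_goals simp
    all_goals fun_prop

/-- The coordinates `1/k, A, B`. -/
def chart₃L (f₁ fb : Face) : LogChart 2 Face where
  face := ![none, some f₁, some fb]
  L := matrixEquiv !![-1, 0, 0; 0, 1, 0; 0, 0, 1] !![-1, 0, 0; 0, 1, 0; 0, 0, 1]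
    (by ext i j; fin_cases i <;> fin_cases j <;> simp [Matrix.mul_apply, Fin.sum_univ_three])
  mono ρ := ![(ρ 0)⁻¹, ρ 1, ρ 2]
  mono_exp τ := by
    funext l
    fin_cases l <;> simp [← Real.exp_neg, Matrix.mulVec, dotProduct, Fin.sum_univ_three]
  continuous_mono l hl := by
    fin_cases l
    · exact absurd rfl hl
    all_goals simp
    all_goals fun_prop

/-- The charts for two boundary variables `A`, `B`. -/
def charts₃ (f₀ f₁ fb fb₀ fz : Face) : Fin 5 → LogChart 2 Face :=
  ![chart₃I f₀ f₁ fb, chart₃I' f₁ fb f₀, chart₃II f₀ fb₀ fb, chart₃III f₀ fb₀ fz, chart₃L f₁ fb]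

/-- The cases compare `k` with `1`, `A` and `A * B`; a failed comparison gives the limit zero needed
for the next chart. -/
theorem limits₃ (𝒰 : Ultrafilter (Fin 3 → ℝ)) :
    (∃ r, Filter.Tendsto (fun τ : Fin 3 → ℝ => Real.exp (-τ 0)) 𝒰 (nhds r)) ∨
    (Filter.Tendsto (fun τ : Fin 3 → ℝ => Real.exp (τ 0)) 𝒰 (nhds 0) ∧
      ((∃ r, Filter.Tendsto (fun τ : Fin 3 → ℝ => Real.exp (-τ 0 + τ 1)) 𝒰 (nhds r)) ∨
      (Filter.Tendsto (fun τ : Fin 3 → ℝ => Real.exp (τ 0 + -τ 1)) 𝒰 (nhds 0) ∧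
        ∃ r, Filter.Tendsto (fun τ : Fin 3 → ℝ => Real.exp (-τ 0 + τ 1 + τ 2)) 𝒰 (nhds r)) ∨
      Filter.Tendsto (fun τ : Fin 3 → ℝ => Real.exp (τ 0 + -τ 1 + -τ 2)) 𝒰 (nhds 0))) := by
  rcases ultrafilter_exp_dichotomy 𝒰 (fun τ => -τ 0) with h | h
  · exact Or.inl h
  refine Or.inr ⟨by simpa using h, ?_⟩
  rcases ultrafilter_exp_dichotomy 𝒰 (fun τ => -τ 0 + τ 1) with h | h
  · exact Or.inl h
  rcases ultrafilter_exp_dichotomy 𝒰 (fun τ => -τ 0 + τ 1 + τ 2) with h' | h'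
  · exact Or.inr (Or.inl ⟨h.congr fun τ => by ring_nf, h'⟩)
  · exact Or.inr (Or.inr (h'.congr fun τ => by ring_nf))

/-- The indices of the charts with the coordinates `k`, `A/k`, `B` in one of the two orders, and the
remaining ones. -/
def selection₃ (i₀ : Fin 5) : Fin 4 → Fin 5 := ![i₀, 2, 3, 4]

theorem covers₃ (f₀ f₁ fb fb₀ fz : Face) {i₀ : Fin 5} (hi₀ : i₀ = 0 ∨ i₀ = 1) :
    Covers fun i => charts₃ f₀ f₁ fb fb₀ fz (selection₃ i₀ i) := by
  intro 𝒰 hconv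
  obtain ⟨ra, ha⟩ := hconv 1 (by simp)
  obtain ⟨rb, hb⟩ := hconv 2 (by simp)
  rcases limits₃ 𝒰 with ⟨r, hr⟩ | ⟨h0, ⟨r, hr⟩ | ⟨h1, r, hr⟩ | h1⟩
  · refine ⟨3, ![r, ra, rb], tendsto_pi_nhds.2 fun l => ?_⟩
    fin_cases l
    · simpa [selection₃, charts₃, chart₃L, Matrix.mulVec, dotProduct, Fin.sum_univ_three] using hr
    · simpa [selection₃, charts₃, chart₃L, Matrix.mulVec, dotProduct, Fin.sum_univ_three] using ha
    · simpa [selection₃, charts₃, chart₃L, Matrix.mulVec, dotProduct, Fin.sum_univ_three] using hb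
  · rcases hi₀ with rfl | rfl
    · refine ⟨0, ![0, r, rb], tendsto_pi_nhds.2 fun l => ?_⟩
      fin_cases l
      · simpa [selection₃, charts₃, chart₃I, Matrix.mulVec, dotProduct, Fin.sum_univ_three] using h0
      · simpa [selection₃, charts₃, chart₃I, Matrix.mulVec, dotProduct, Fin.sum_univ_three] using hr
      · simpa [selection₃, charts₃, chart₃I, Matrix.mulVec, dotProduct, Fin.sum_univ_three] using hb
    · refine ⟨0, ![r, rb, 0], tendsto_pi_nhds.2 fun l => ?_⟩
      fin_cases l
      · simpa [selection₃, charts₃, chart₃I', Matrix.mulVec, dotProduct, Fin.sum_univ_three]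
          using hr
      · simpa [selection₃, charts₃, chart₃I', Matrix.mulVec, dotProduct, Fin.sum_univ_three]
          using hb
      · simpa [selection₃, charts₃, chart₃I', Matrix.mulVec, dotProduct, Fin.sum_univ_three]
          using h0
  · refine ⟨1, ![ra, 0, r], tendsto_pi_nhds.2 fun l => ?_⟩
    fin_cases l
    · simpa [selection₃, charts₃, chart₃II, Matrix.mulVec, dotProduct, Fin.sum_univ_three] using ha
    · simpa [selection₃, charts₃, chart₃II, Matrix.mulVec, dotProduct, Fin.sum_univ_three] using h1
    · simpa [selection₃, charts₃, chart₃II, Matrix.mulVec, dotProduct, Fin.sum_univ_three] using hr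
  · refine ⟨2, ![ra, rb, 0], tendsto_pi_nhds.2 fun l => ?_⟩
    fin_cases l
    · simpa [selection₃, charts₃, chart₃III, Matrix.mulVec, dotProduct, Fin.sum_univ_three] using ha
    · simpa [selection₃, charts₃, chart₃III, Matrix.mulVec, dotProduct, Fin.sum_univ_three] using hb
    · simpa [selection₃, charts₃, chart₃III, Matrix.mulVec, dotProduct, Fin.sum_univ_three] using h1

set_option maxHeartbeats 4000000 in
theorem compat₃ (f₀ f₁ fb fb₀ fz : Face) (i : Fin 5) (hi : i ≠ 4) (i' : Fin 5) :
    (charts₃ f₀ f₁ fb fb₀ fz i).Compat (charts₃ f₀ f₁ fb fb₀ fz i') := by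
  intro j H hj
  fin_cases i <;> first | exact absurd rfl hi | skip
  all_goals fin_cases j <;> fin_cases i' <;> (obtain rfl := Option.some_injective _ hj)
  all_goals
    first
    | refine Or.inl ⟨0, rfl, ?_, fun τ t C hC ht h h' => ?_⟩
    | refine Or.inl ⟨1, rfl, ?_, fun τ t C hC ht h h' => ?_⟩
    | refine Or.inl ⟨2, rfl, ?_, fun τ t C hC ht h h' => ?_⟩
    | refine Or.inr fun τ t C hC ht h h' => ?_
  all_goals
    first
    | (have h0 := h 0
       have h1 := h 1
       have h2 := h 2
       have h'0 := h' 0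
       have h'1 := h' 1
       have h'2 := h' 2
       simp [charts₃, chart₃I, chart₃I', chart₃II, chart₃III, chart₃L, kDir, Matrix.mulVec,
         dotProduct, Fin.sum_univ_three] at h0 h1 h2 h'0 h'1 h'2 ⊢
       linarith)
    | (ext l
       fin_cases l <;> simp [charts₃, chart₃I, chart₃I', chart₃II, chart₃III, chart₃L,
         Matrix.mulVec, dotProduct, Fin.sum_univ_three])

end Templates

/-! ### Families of charts -/

section Families

variable {n : ℕ} {V : Type} [NormedAddCommGroup V] [NormedSpace ℝ V] {Face : Type} {M : Type*}

theorem exists_nat_symm₁ (fz : Face) (j : Fin 1) :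
    ∃ p : ℕ, (chart₁I fz).L.symm (Pi.single j 1) 0 = p := by
  fin_cases j
  exact ⟨1, by simp [chart₁I, Matrix.mulVec, dotProduct]⟩

theorem exists_nat_symm₂ (fb fb₀ fz : Face) (i : Fin 3) (hi : i ≠ 2) (j : Fin 2) :
    ∃ p : ℕ, (charts₂ fb fb₀ fz i).L.symm (Pi.single j 1) 0 = p := by
  fin_cases i <;> first | exact absurd rfl hi | skip
  all_goals fin_cases j
  all_goals
    first
    | (refine ⟨0, ?_⟩; simp [charts₂, chart₂I, chart₂II, Matrix.mulVec, dotProduct]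
       done)
    | (refine ⟨1, ?_⟩; simp [charts₂, chart₂I, chart₂II, Matrix.mulVec, dotProduct])

theorem exists_nat_symm₃ (f₀ f₁ fb fb₀ fz : Face) (i : Fin 5) (hi : i ≠ 4) (j : Fin 3) :
    ∃ p : ℕ, (charts₃ f₀ f₁ fb fb₀ fz i).L.symm (Pi.single j 1) 0 = p := by
  fin_cases i <;> first | exact absurd rfl hi | skip
  all_goals fin_cases j
  all_goals
    first
    | (refine ⟨0, ?_⟩; simp [charts₃, chart₃I, chart₃I', chart₃II, chart₃III, Matrix.mulVec, dotProduct,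
        Fin.sum_univ_three]
       done)
    | (refine ⟨1, ?_⟩; simp [charts₃, chart₃I, chart₃I', chart₃II, chart₃III, Matrix.mulVec, dotProduct,
        Fin.sum_univ_three])

/-- The corner chart whose coordinates `ρ` determine `k` and further quantities `g = mono ρ`, which,
with the parameters `v`, determine the points `pp g v`. -/
def monoChart (pp : (Fin (n + 1) → ℝ) → V → M × M) (P : (Fin (n + 1) → ℝ) → V → Prop)
    (s : LogChart n Face) : CornerChart (ℝ × M × M) Face where
  m := n + 1
  V := V
  face := s.face
  dom := {q | (∀ i, 0 ≤ q.1 i) ∧ P (s.mono q.1) q.2}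
  param q := (s.mono q.1 0, pp (s.mono q.1) q.2)

/-- The integral of `rayIntegrand` over `k > q.1`. -/
def rayFun (θ : ℝ) (T : ℝ × M × M → ℂ) (q : ℝ × M × M) : ℂ :=
  ∫ k in Ioi q.1, rayIntegrand θ T q.1 q.2.1 q.2.2 k

variable {ι : Type} {c : ι → LogChart n Face} {E : Face → IndexSet}
  {pp : (Fin (n + 1) → ℝ) → V → M × M} {P : (Fin (n + 1) → ℝ) → V → Prop} {θ : ℝ}
  {T : ℝ × M × M → ℂ}

/-- `f g` does not depend on the component `k` of `g`. -/
def IndepOfK {β : Type*} (f : (Fin (n + 1) → ℝ) → β) : Prop :=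
  ∀ g g', (∀ l, l ≠ 0 → g l = g' l) → f g = f g'

theorem monoChart_phgAt_rayFun (hθ₁ : Real.pi / 2 < θ) (hθ₂ : θ < Real.pi) (hpp : IndepOfK pp)
    (hP : IndepOfK P) (hc : Covers c)
    (hT : ∀ i, ∀ q ∈ (monoChart pp P (c i)).dom, (monoChart pp P (c i)).PhgAt E T q)
    (s : LogChart n Face) (hcomp : ∀ i, s.Compat (c i))
    (hs : ∀ j, ∃ p : ℕ, s.L.symm (Pi.single j 1) 0 = p) :
    (∀ q ∈ (monoChart pp P s).dom, (monoChart pp P s).PhgAt E (rayFun θ T) q) ∧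
    ∀ q ∈ (monoChart pp P s).dom, ∃ ε > 0,
      ∀ x ∈ linBall (s.L : (Fin (n + 1) → ℝ) →L[ℝ] (Fin (n + 1) → ℝ)) q ε,
        IntegrableOn (rayIntegrand θ T (Real.exp (x.1 0)) (pp (fun l => Real.exp (x.1 l)) x.2).1
          (pp (fun l => Real.exp (x.1 l)) x.2).2) (Ioi (Real.exp (x.1 0))) := by
  have hup : ∀ (g : Fin (n + 1) → ℝ) (k : ℝ), pp (Function.update g 0 k) = pp g := fun g k =>
    hpp _ _ fun l hl => by simp [hl]
  have main := fun (ρ : Fin (n + 1) → ℝ) (v : V) (hPv : P (s.mono ρ) v) =>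
    s.phgNear_rayTransform (c := c) (E := E) (T := fun g v => T (g 0, pp g v)) (P := P) hθ₁ hθ₂
      (fun g g' v h hv => by rwa [← hP g g' h])
      (fun i ρ v hρ hv => hT i (ρ, v) ⟨hρ, hv⟩) hc hcomp hs hPv
  refine ⟨fun q hq => ?_, fun q hq => ?_⟩
  · have h := (main q.1 q.2 hq.2).2
    have he : (fun q : (Fin (n + 1) → ℝ) × V =>
        rayTransform θ (fun g v => T (g 0, pp g v)) (s.mono q.1) q.2) =
        rayFun θ T ∘ (monoChart pp P s).param := by
      funext q
      simp only [rayTransform, hup, Function.update_self]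
      rfl
    rw [he] at h
    exact h
  · obtain ⟨ε, hε, h⟩ := (main q.1 q.2 hq.2).1
    refine ⟨ε, hε, fun x hx => ?_⟩
    have h1 := h x hx
    simp only [hup, Function.update_self] at h1
    exact h1

/-- All integrals along rays are polyhomogeneous in a family of charts in one variable. -/
theorem family₁ (hθ₁ : Real.pi / 2 < θ) (hθ₂ : θ < Real.pi) {fz : Face}
    {pp : (Fin 1 → ℝ) → V → M × M} {P : (Fin 1 → ℝ) → V → Prop}
    (hpp : IndepOfK pp) (hP : IndepOfK P)
    (hT : ∀ i, ∀ q ∈ (monoChart pp P (charts₁ fz i)).dom,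
      (monoChart pp P (charts₁ fz i)).PhgAt E T q) :
    (∀ q ∈ (monoChart pp P (chart₁I fz)).dom,
      (monoChart pp P (chart₁I fz)).PhgAt E (rayFun θ T) q) ∧
    ∀ q ∈ (monoChart pp P (chart₁I fz)).dom, ∃ ε > 0,
      ∀ x ∈ linBall ((chart₁I fz).L : (Fin 1 → ℝ) →L[ℝ] (Fin 1 → ℝ)) q ε,
        IntegrableOn (rayIntegrand θ T (Real.exp (x.1 0)) (pp (fun l => Real.exp (x.1 l)) x.2).1
          (pp (fun l => Real.exp (x.1 l)) x.2).2) (Ioi (Real.exp (x.1 0))) :=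
  monoChart_phgAt_rayFun hθ₁ hθ₂ hpp hP (covers₁ fz) hT _ (compat₁ fz) (exists_nat_symm₁ fz)

theorem family₂ (hθ₁ : Real.pi / 2 < θ) (hθ₂ : θ < Real.pi) {fb fb₀ fz : Face}
    {pp : (Fin 2 → ℝ) → V → M × M} {P : (Fin 2 → ℝ) → V → Prop}
    (hpp : IndepOfK pp) (hP : IndepOfK P)
    (hT : ∀ i, ∀ q ∈ (monoChart pp P (charts₂ fb fb₀ fz i)).dom,
      (monoChart pp P (charts₂ fb fb₀ fz i)).PhgAt E T q) (i : Fin 3) (hi : i ≠ 2) :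
    ∀ q ∈ (monoChart pp P (charts₂ fb fb₀ fz i)).dom,
      (monoChart pp P (charts₂ fb fb₀ fz i)).PhgAt E (rayFun θ T) q :=
  (monoChart_phgAt_rayFun hθ₁ hθ₂ hpp hP (covers₂ fb fb₀ fz) hT _ (compat₂ fb fb₀ fz i hi)
    (exists_nat_symm₂ fb fb₀ fz i hi)).1

theorem family₃ (hθ₁ : Real.pi / 2 < θ) (hθ₂ : θ < Real.pi) {f₀ f₁ fb fb₀ fz : Face} {i₀ : Fin 5}
    (hi₀ : i₀ = 0 ∨ i₀ = 1) {pp : (Fin 3 → ℝ) → V → M × M} {P : (Fin 3 → ℝ) → V → Prop}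
    (hpp : IndepOfK pp) (hP : IndepOfK P)
    (hT : ∀ i, ∀ q ∈ (monoChart pp P (charts₃ f₀ f₁ fb fb₀ fz (selection₃ i₀ i))).dom,
      (monoChart pp P (charts₃ f₀ f₁ fb fb₀ fz (selection₃ i₀ i))).PhgAt E T q) (i : Fin 5)
    (hi : i ≠ 4) :
    ∀ q ∈ (monoChart pp P (charts₃ f₀ f₁ fb fb₀ fz i)).dom,
      (monoChart pp P (charts₃ f₀ f₁ fb fb₀ fz i)).PhgAt E (rayFun θ T) q :=
  (monoChart_phgAt_rayFun hθ₁ hθ₂ hpp hP (covers₃ f₀ f₁ fb fb₀ fz hi₀) hT _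
    (fun i' => compat₃ f₀ f₁ fb fb₀ fz i hi (selection₃ i₀ i'))
    (exists_nat_symm₃ f₀ f₁ fb fb₀ fz i hi)).1

end Families

/-! ### Changes of coordinates -/

section Transfer

variable {m m' : ℕ} {V V' : Type} [NormedAddCommGroup V] [NormedSpace ℝ V]
  [NormedAddCommGroup V'] [NormedSpace ℝ V'] {Face : Type}

/-- The projection to the coordinates which do not vanish at `q`. -/
def posPart (q : (Fin m → ℝ) × V) : ((Fin m → ℝ) × V) →L[ℝ] (Fin m → ℝ) × V :=
  (ContinuousLinearMap.pi fun i => if q.1 i = 0 then 0 else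
    ContinuousLinearMap.proj (R := ℝ) (φ := fun _ : Fin m => ℝ) i).prodMap
    (ContinuousLinearMap.id ℝ V)

/-- The logarithms of those coordinates of `q` which do not vanish. -/
def logPt (q : (Fin m → ℝ) × V) : (Fin m → ℝ) × V := (fun i => Real.log (q.1 i), q.2)

theorem posPart_apply_of_ne {q : (Fin m → ℝ) × V} {i : Fin m} (hi : q.1 i ≠ 0)
    (x : (Fin m → ℝ) × V) : (posPart q x).1 i = x.1 i := by
  simp [posPart, hi]

theorem posPart_apply_of_eq {q : (Fin m → ℝ) × V} {i : Fin m} (hi : q.1 i = 0)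
    (x : (Fin m → ℝ) × V) : (posPart q x).1 i = 0 := by
  simp [posPart, hi]

theorem posPart_snd (q x : (Fin m → ℝ) × V) : (posPart q x).2 = x.2 := rfl

theorem posPart_ei {q : (Fin m → ℝ) × V} {i : Fin m} (hi : q.1 i = 0) :
    posPart q (ei V i) = 0 := by
  refine Prod.ext (funext fun l => ?_) rfl
  by_cases hl : q.1 l = 0
  · rw [posPart_apply_of_eq hl]
    rfl
  · have : l ≠ i := fun h => hl (h ▸ hi)
    rw [posPart_apply_of_ne hl]
    simp [ei, this]

/-- Coordinates vanishing at `q` have logarithms tending to `-∞` and are discarded; the remaining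
logarithms converge. -/
theorem tendsto_posPart (q : (Fin m → ℝ) × V) :
    Filter.Tendsto (posPart q) (Filter.comap expMap (nhds q)) (nhds (logPt q)) := by
  have h0 : Filter.Tendsto (expMap : (Fin m → ℝ) × V → (Fin m → ℝ) × V)
      (Filter.comap expMap (nhds q)) (nhds q) := Filter.tendsto_comap
  refine Filter.Tendsto.prodMk_nhds (tendsto_pi_nhds.2 fun i => ?_)
    (show Filter.Tendsto (fun x : (Fin m → ℝ) × V => (expMap x).2) _ _ from
      (continuous_snd.tendsto q).comp h0)
  by_cases hi : q.1 i = 0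
  · simpa [hi] using tendsto_const_nhds
  · have h1 : Filter.Tendsto (fun x : (Fin m → ℝ) × V => Real.exp (x.1 i))
        (Filter.comap expMap (nhds q)) (nhds (q.1 i)) :=
      (((continuous_apply i).comp continuous_fst).tendsto q).comp h0
    simpa [hi] using h1.log hi

theorem exists_logBall_subset {q : (Fin m → ℝ) × V} {s : Set ((Fin m → ℝ) × V)}
    (hs : s ∈ Filter.comap expMap (nhds q)) : ∃ ε > 0, ∀ x ∈ logBall q ε, x ∈ s :=
  (Metric.nhds_basis_ball.comap expMap).mem_iff.1 hs

/-- Although `x` ranges over an unbounded set, `Φ` sees it only through `π x`, which stays in a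
compact set. -/
theorem bounded_iteratedFDeriv_comp_clm {E F G : Type} [NormedAddCommGroup E] [NormedSpace ℝ E]
    [NormedAddCommGroup F] [NormedSpace ℝ F] [NormedAddCommGroup G] [NormedSpace ℝ G]
    {O K : Set E} (hO : IsOpen O) (hK : IsCompact K) (hKO : K ⊆ O) {Φ : E → F}
    (hΦ : ContDiffOn ℝ ∞ Φ O) (π : G →L[ℝ] E) (j : ℕ) :
    ∃ C : ℝ, ∀ x, π x ∈ K → ‖iteratedFDeriv ℝ j (fun y => Φ (π y)) x‖ ≤ C := by
  have h1 : ContinuousOn (iteratedFDerivWithin ℝ j Φ O) K :=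
    (hΦ.continuousOn_iteratedFDerivWithin (by exact_mod_cast le_top) hO.uniqueDiffOn).mono hKO
  obtain ⟨C, hC⟩ := hK.exists_bound_of_continuousOn h1
  refine ⟨C * ‖π‖ ^ j, fun x hx => ?_⟩
  have hO' : IsOpen (π ⁻¹' O) := hO.preimage π.continuous
  have h2 := π.iteratedFDerivWithin_comp_right (i := j) hΦ hO.uniqueDiffOn hO'.uniqueDiffOn
    (hKO hx) (by exact_mod_cast le_top)
  rw [iteratedFDerivWithin_of_isOpen j hO' (hKO hx)] at h2
  have h3 : iteratedFDeriv ℝ j (fun y => Φ (π y)) x = _ := h2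
  rw [h3]
  refine (ContinuousMultilinearMap.norm_compContinuousLinearMap_le _ _).trans ?_
  rw [Finset.prod_const, Finset.card_univ, Fintype.card_fin]
  gcongr
  exact hC _ hx

/-- Polyhomogeneity is preserved by the coordinate changes which in logarithmic coordinates are the
sum of a linear map and a smooth function of those coordinates which stay bounded. -/
theorem PhgNear.transfer [FiniteDimensional ℝ V] {E : Face → IndexSet} {face : Fin m → Option Face}
    {face' : Fin m' → Option Face} {u : (Fin m → ℝ) × V → ℂ} {u' : (Fin m' → ℝ) × V' → ℂ}
    {q : (Fin m → ℝ) × V} {q' : (Fin m' → ℝ) × V'} (h : PhgNear E face' u' q')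
    (A : ((Fin m → ℝ) × V) →L[ℝ] (Fin m' → ℝ) × V') {Φ : (Fin m → ℝ) × V → (Fin m' → ℝ) × V'}
    {O : Set ((Fin m → ℝ) × V)} (hO : IsOpen O) (hqO : logPt q ∈ O) (hΦ : ContDiffOn ℝ ∞ Φ O)
    (hlim : Filter.Tendsto (fun x => expMap (A x + Φ (posPart q x)))
      (Filter.comap expMap (nhds q)) (nhds q'))
    (hu : ∀ᶠ x in Filter.comap expMap (nhds q),
      u (expMap x) = u' (expMap (A x + Φ (posPart q x))))
    (hface : ∀ i H, q.1 i = 0 → face i = some H → ∃ i', q'.1 i' = 0 ∧ face' i' = some H ∧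
      A (ei V i) = ei V' i' ∧ ∀ x, (A x).1 i' = x.1 i) : PhgNear E face u q := by
  obtain ⟨ε', hε', g', hg', ⟨w', hw'⟩, hA'⟩ := h.exists_annihilated
  obtain ⟨r, hr, hrO⟩ := Metric.nhds_basis_closedBall.mem_iff.1 (hO.mem_nhds hqO)
  set K := Metric.closedBall (logPt q) r with hK
  have hKc : IsCompact K := isCompact_closedBall _ _
  obtain ⟨ε, hε, hball⟩ := exists_logBall_subset
    (((tendsto_posPart q).eventually (Metric.closedBall_mem_nhds _ hr)).and
      ((hlim.eventually (Metric.ball_mem_nhds _ hε')).and hu))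
  set Ψ : (Fin m → ℝ) × V → (Fin m' → ℝ) × V' := fun x => A x + Φ (posPart q x) with hΨdef
  have hΦπ : ContDiffOn ℝ ∞ (fun x => Φ (posPart q x)) (logBall q ε) :=
    hΦ.comp (posPart q).contDiff.contDiffOn fun x hx => hrO (hball x hx).1
  have hΨ : ContDiffOn ℝ ∞ Ψ (logBall q ε) := A.contDiff.contDiffOn.add hΦπ
  have hm : ∀ x ∈ logBall q ε, Ψ x ∈ logBall q' ε' := fun x hx => (hball x hx).2.1
  have hb : ∀ j : ℕ, 1 ≤ j → ∃ C : ℝ, ∀ x ∈ logBall q ε, ‖iteratedFDeriv ℝ j Ψ x‖ ≤ C := by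
    intro j hj
    obtain ⟨C₁, hC₁⟩ := bounded_iteratedFDeriv_clm A j hj
    obtain ⟨C₂, hC₂⟩ := bounded_iteratedFDeriv_comp_clm hO hKc hrO hΦ (posPart q) j
    refine ⟨C₁ + C₂, fun x hx => ?_⟩
    have h1 := iteratedFDeriv_add_apply (i := j) (A.contDiff.contDiffAt (x := x))
      ((hΦπ.contDiffAt ((logBall q ε).isOpen.mem_nhds hx)).of_le (by exact_mod_cast le_top))
    have h2 : iteratedFDeriv ℝ j Ψ x = _ := h1
    rw [h2]
    exact (norm_add_le _ _).trans (add_le_add (hC₁ x) (hC₂ x (hball x hx).1))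
  obtain ⟨C₃, hC₃⟩ := hKc.exists_bound_of_continuousOn (hΦ.continuousOn.mono hrO)
  obtain ⟨C₀, hsum⟩ := exists_norm_le_logBall (q := q) hε
  have hbd := logBall_bddAbove (q := q) hε
  -- `Ψ` is linear up to a bounded term and the coordinates are bounded above, so each pulled back
  -- weight is dominated by one common negative power of the product of all `ρ l`.
  have hweight : ∀ w : Fin m' → ℝ, ∃ W C : ℝ, 0 ≤ W ∧ ∀ x ∈ logBall q ε,
      lin w (Ψ x) ≤ C - W * ∑ l, x.1 l := by
    intro w
    set D : ℝ := ∑ l, |w l|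
    have hD : 0 ≤ D := Finset.sum_nonneg fun _ _ => abs_nonneg _
    refine ⟨D * ‖A‖, D * (‖A‖ * (C₀ + (‖q.2‖ + ε)) + C₃), by positivity, fun x hx => ?_⟩
    have h1 : lin w (Ψ x) ≤ D * ‖(Ψ x).1‖ := by
      rw [lin, Finset.sum_mul]
      refine Finset.sum_le_sum fun l _ => (le_abs_self _).trans ?_
      rw [abs_mul]
      gcongr
      exact norm_le_pi_norm (Ψ x).1 l
    have h2 : ‖(Ψ x).1‖ ≤ ‖A‖ * ‖x‖ + C₃ := by
      refine (norm_fst_le _).trans ((norm_add_le _ _).trans ?_)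
      exact add_le_add (A.le_opNorm x) (hC₃ _ (hball x hx).1)
    have h3 : ‖x‖ ≤ ‖x.1‖ + ‖x.2‖ := by
      rw [Prod.norm_def]
      exact max_le (by linarith [norm_nonneg x.2]) (by linarith [norm_nonneg x.1])
    have h4 : ‖x.2‖ ≤ ‖q.2‖ + ε := by
      have := ((mem_logBall_iff hε).1 hx).2
      linarith [norm_le_norm_add_norm_sub' x.2 q.2]
    have h5 : ‖x‖ ≤ C₀ + (‖q.2‖ + ε) - ∑ l, x.1 l := by linarith [hsum x hx]
    calc lin w (Ψ x) ≤ D * (‖A‖ * (C₀ + (‖q.2‖ + ε) - ∑ l, x.1 l) + C₃) :=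
          h1.trans (by gcongr; exact h2.trans (by gcongr))
      _ = _ := by ring
  set Pl := pull (Ω := logBall q' ε') (Ω' := logBall q ε) Ψ hΨ hm with hPl
  refine phgNear_of_annihilated hε (g := Pl g') (fun x hx => ?_) ?_ fun i H hi hH => ?_
  · rw [hPl, pull_apply _ hx, hg' _ (hm x hx), (hball x hx).2.2]
  · obtain ⟨W, C, -, hWC⟩ := hweight w'
    refine ⟨fun _ => -W, Sym_mono (c := C) (fun x hx => (hWC x hx).trans (le_of_eq ?_))
      (pull_mem_Sym hb hw')⟩
    rw [lin, ← Finset.mul_sum]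
    ring
  · obtain ⟨i', hi', hH', hAi, hAx⟩ := hface i H hi hH
    obtain ⟨w, hw⟩ := hA' i' H hi' hH'
    obtain ⟨W, C, hW, hWC⟩ := hweight (Function.update w i' 0)
    refine ⟨fun _ => -W, fun N => ?_⟩
    set N₁ : ℕ := N + ⌈W⌉₊ with hN₁
    refine ⟨N₁, ?_⟩
    have h1 := pull_mem_Sym (hΨ := hΨ) (hm := hm) hb (hw N₁)
    rw [pull_aeval (d' := ei V i) (fun x hx => ?_)] at h1
    · refine Sym_lin_mono hbd (w := Function.update (fun _ => -W) i (N₁ - W))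
        (lin_update_lin_le _ _ _ (fun _ _ => le_rfl) ?_)
        (Sym_mono (c := C + N₁ * C₃) (fun x hx => ?_) h1)
      · have := Nat.le_ceil W
        rw [hN₁]
        push_cast
        linarith
      · have h2 : (Ψ x).1 i' ≤ x.1 i + C₃ := by
          have h3 : (Ψ x).1 i' = x.1 i + (Φ (posPart q x)).1 i' := by
            rw [← hAx x]
            rfl
          have h4 := (le_abs_self _).trans ((norm_le_pi_norm (Φ (posPart q x)).1 i').trans
            ((norm_fst_le _).trans (hC₃ _ (hball x hx).1)))
          linarith
        have h3 := hWC x hx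
        have h4 : (N₁ : ℝ) * (Ψ x).1 i' ≤ N₁ * (x.1 i + C₃) := by gcongr
        have h5 : Function.update w i' (N₁ : ℝ) =
            Function.update (Function.update w i' 0) i' (N₁ : ℝ) := by simp
        have h6 : lin (Function.update (fun _ => -W) i (N₁ - W)) x =
            -W * ∑ l, x.1 l + N₁ * x.1 i := by
          rw [lin_update, lin, ← Finset.mul_sum]
          ring
        rw [h5, lin_update, h6, Function.update_self]
        linarith
    -- `posPart q` annihilates the direction of a coordinate vanishing at `q`, so only the linear
    -- part `A` contributes and the fields of corresponding faces match.
    · have h2 : HasFDerivAt (fun x => Φ (posPart q x))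
          ((fderiv ℝ Φ (posPart q x)).comp (posPart q)) x :=
        (((hΦ.contDiffAt (hO.mem_nhds (hrO (hball x hx).1))).differentiableAt
          (by simp)).hasFDerivAt).comp x (posPart q).hasFDerivAt
      have h3 : fderiv ℝ Ψ x = A + (fderiv ℝ Φ (posPart q x)).comp (posPart q) :=
        (A.hasFDerivAt.add h2).fderiv
      rw [h3]
      simp [posPart_ei hi, hAi]

/-- A form of `PhgNear.transfer` in terms of the coordinate change `χ` itself. -/
theorem PhgNear.comp [FiniteDimensional ℝ V] {E : Face → IndexSet} {face : Fin m → Option Face}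
    {face' : Fin m' → Option Face} {u : (Fin m → ℝ) × V → ℂ} {u' : (Fin m' → ℝ) × V' → ℂ}
    {q : (Fin m → ℝ) × V} {χ : (Fin m → ℝ) × V → (Fin m' → ℝ) × V'} (h : PhgNear E face' u' (χ q))
    (hχ : ContinuousAt χ q) (A : ((Fin m → ℝ) × V) →L[ℝ] (Fin m' → ℝ) × V')
    {Φ : (Fin m → ℝ) × V → (Fin m' → ℝ) × V'} {O : Set ((Fin m → ℝ) × V)} (hO : IsOpen O)
    (hqO : logPt q ∈ O) (hΦ : ContDiffOn ℝ ∞ Φ O)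
    (hΨ : ∀ x, posPart q x ∈ O → expMap (A x + Φ (posPart q x)) = χ (expMap x))
    (hu : ∀ᶠ p in nhds q, u p = u' (χ p))
    (hface : ∀ i H, q.1 i = 0 → face i = some H → ∃ i', (χ q).1 i' = 0 ∧ face' i' = some H ∧
      A (ei V i) = ei V' i' ∧ ∀ x, (A x).1 i' = x.1 i) : PhgNear E face u q := by
  have h1 : ∀ᶠ x in Filter.comap expMap (nhds q),
      expMap (A x + Φ (posPart q x)) = χ (expMap x) :=
    ((tendsto_posPart q).eventually (hO.mem_nhds hqO)).mono hΨ
  refine h.transfer A hO hqO hΦ ?_ ?_ hface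
  · exact (hχ.tendsto.comp Filter.tendsto_comap).congr' (h1.mono fun x hx => hx.symm)
  · filter_upwards [h1, Filter.tendsto_comap.eventually hu] with x hx hux
    rw [hx, hux]

end Transfer

/-! ### The charts of the double space -/

section Geometry

variable {b f : ℕ} {M B : Type*}
  [TopologicalSpace M] [ChartedSpace (EuclideanHalfSpace (b + f + 1)) M]
  [TopologicalSpace B] [ChartedSpace (EuclideanSpace ℝ (Fin b)) B]

/-- `u` is polyhomogeneous near all points of the chart `c`. -/
def PhgChart (E : Face → IndexSet) (u : ℝ × M × M → ℂ) (c : CornerChart (ℝ × M × M) Face) : Prop :=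
  ∀ q ∈ c.dom, c.PhgAt E u q

section Families

variable {x : M → ℝ} {φ : (𝓡∂ (b + f + 1)).boundary M → B} {n : ℕ}

/-- The pairs of interior points. -/
def interiorMono (e e' : SmoothChart b f M) (s : LogChart 0 Face) :
    CornerChart (ℝ × M × M) Face :=
  monoChart (V := EuclideanSpace ℝ (Fin (b + f + 1)) × EuclideanSpace ℝ (Fin (b + f + 1)))
    (fun _ v => (e.pt v.1, e'.pt v.2)) (fun _ v => e.Valid v.1 ∧ e'.Valid v.2) s

theorem interiorChart_eq (e e' : SmoothChart b f M) (s : LogChart 0 Face)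
    {kf : (Fin 1 → ℝ) → ℝ} (hk : ∀ ρ, kf ρ = s.mono ρ 0) :
    interiorChart e e' s.face kf = interiorMono e e' s := by
  obtain rfl : kf = _ := funext hk
  rfl

/-- The pairs of a point near the boundary and an interior point; `g = (k, x)`. -/
def leftMono (e : AdaptedChart x φ) (e' : SmoothChart b f M) (s : LogChart 1 Face) :
    CornerChart (ℝ × M × M) Face :=
  monoChart (V := ((Fin b → ℝ) × (Fin f → ℝ)) × EuclideanSpace ℝ (Fin (b + f + 1)))
    (fun g v => (e.pt (g 1) v.1.1 v.1.2, e'.pt v.2))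
    (fun g v => e.Valid (g 1) v.1.1 v.1.2 ∧ e'.Valid v.2) s

theorem leftChart_eq (e : AdaptedChart x φ) (e' : SmoothChart b f M) (s : LogChart 1 Face)
    {kf xf : (Fin 2 → ℝ) → ℝ} (hk : ∀ ρ, kf ρ = s.mono ρ 0) (hx : ∀ ρ, xf ρ = s.mono ρ 1) :
    leftChart e e' s.face kf xf = leftMono e e' s := by
  obtain rfl : kf = _ := funext hk
  obtain rfl : xf = _ := funext hx
  rfl

/-- The pairs of an interior point and a point near the boundary; `g = (k, x')`. -/
def rightMono (e : SmoothChart b f M) (e' : AdaptedChart x φ) (s : LogChart 1 Face) :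
    CornerChart (ℝ × M × M) Face :=
  monoChart (V := EuclideanSpace ℝ (Fin (b + f + 1)) × ((Fin b → ℝ) × (Fin f → ℝ)))
    (fun g v => (e.pt v.1, e'.pt (g 1) v.2.1 v.2.2))
    (fun g v => e.Valid v.1 ∧ e'.Valid (g 1) v.2.1 v.2.2) s

theorem rightChart_eq (e : SmoothChart b f M) (e' : AdaptedChart x φ) (s : LogChart 1 Face)
    {kf xf : (Fin 2 → ℝ) → ℝ} (hk : ∀ ρ, kf ρ = s.mono ρ 0) (hx : ∀ ρ, xf ρ = s.mono ρ 1) :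
    rightChart e e' s.face kf xf = rightMono e e' s := by
  obtain rfl : kf = _ := funext hk
  obtain rfl : xf = _ := funext hx
  rfl

/-- The pairs of points near the boundary, away from the fibre diagonal, where `x = X g`,
`x' = X' g` and `g 2` is the ratio. -/
def cornerMono (e e' : AdaptedChart x φ) (X X' : (Fin 3 → ℝ) → ℝ) (s : LogChart 2 Face) :
    CornerChart (ℝ × M × M) Face :=
  monoChart (V := ((Fin b → ℝ) × (Fin f → ℝ)) × ((Fin b → ℝ) × (Fin f → ℝ)))
    (fun g v => (e.pt (X g) v.1.1 v.1.2, e'.pt (X' g) v.2.1 v.2.2))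
    (fun g v => e.Valid (X g) v.1.1 v.1.2 ∧ e'.Valid (X' g) v.2.1 v.2.2 ∧
      ¬ (X g = 0 ∧ X' g = 0 ∧ g 2 = 1 ∧ e.basePt v.1.1 = e'.basePt v.2.1)) s

theorem cornerChart_eq (e e' : AdaptedChart x φ) {X X' : (Fin 3 → ℝ) → ℝ} (s : LogChart 2 Face)
    {kf xf xf' r : (Fin 3 → ℝ) → ℝ} (hk : ∀ ρ, kf ρ = s.mono ρ 0) (hx : ∀ ρ, xf ρ = X (s.mono ρ))
    (hx' : ∀ ρ, xf' ρ = X' (s.mono ρ)) (hr : ∀ ρ, r ρ = s.mono ρ 2) :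
    cornerChart e e' s.face kf xf xf' r = cornerMono e e' X X' s := by
  obtain rfl : kf = _ := funext hk
  obtain rfl : xf = _ := funext hx
  obtain rfl : xf' = _ := funext hx'
  obtain rfl : r = _ := funext hr
  rfl

/-- The pairs of points near the fibre diagonal, where `x = X g` and
`(x'/x - 1, y' - y) = w g • dir θ`. -/
def diagMono (e e' : AdaptedChart x φ) {d : ℕ} (dir : (Fin d → ℝ) → Fin (b + 1) → ℝ)
    (X w : (Fin (n + 1) → ℝ) → ℝ) (s : LogChart n Face) : CornerChart (ℝ × M × M) Face :=
  monoChart (V := (Fin d → ℝ) × (Fin b → ℝ) × (Fin f → ℝ) × (Fin f → ℝ))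
    (fun g v => (e.pt (X g) v.2.1 v.2.2.1, e'.pt (X g * (1 + w g * dir v.1 0))
      (v.2.1 + w g • Fin.tail (dir v.1)) v.2.2.2))
    (fun g v => 0 < 1 + w g * dir v.1 0 ∧ e.Valid (X g) v.2.1 v.2.2.1 ∧
      e'.Valid (X g * (1 + w g * dir v.1 0)) (v.2.1 + w g • Fin.tail (dir v.1)) v.2.2.2) s

theorem diagChart_eq (e e' : AdaptedChart x φ) {d : ℕ} (dir : (Fin d → ℝ) → Fin (b + 1) → ℝ)
    {X w : (Fin (n + 1) → ℝ) → ℝ} (s : LogChart n Face) {kf xf wf : (Fin (n + 1) → ℝ) → ℝ}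
    (hk : ∀ ρ, kf ρ = s.mono ρ 0) (hx : ∀ ρ, xf ρ = X (s.mono ρ))
    (hw : ∀ ρ, wf ρ = w (s.mono ρ)) :
    diagChart e e' s.face kf xf wf dir ∅ = diagMono e e' dir X w s := by
  obtain rfl : kf = _ := funext hk
  obtain rfl : xf = _ := funext hx
  obtain rfl : wf = _ := funext hw
  simp only [diagChart, diagMono, monoChart, mem_empty_iff_false, not_false_eq_true, and_true]

end Families

section Ray

variable {𝔣 : FibredBoundary b f M B} {E : Face → IndexSet} {θ : ℝ} {T u : ℝ × M × M → ℂ}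

open Face

theorem PhgChart.congr {c c' : CornerChart (ℝ × M × M) Face} (hc : PhgChart E u c) (h : c = c') :
    PhgChart E u c' := h ▸ hc

theorem interior_family (hT : PhgDouble 𝔣 E T) (hT_infty : TemperedAtInfinity 𝔣 E T)
    (e e' : SmoothChart b f M) (i : Fin 2) : PhgChart E T (interiorMono e e' (charts₁ zf i)) := by
  fin_cases i
  · exact PhgChart.congr (hT _ (.int e e'))
      (interiorChart_eq e e' (chart₁I zf) fun _ => rfl)
  · exact PhgChart.congr (hT_infty _ (.int e e'))
      (interiorChart_eq e e' chart₁L fun _ => rfl)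

theorem left_family (hT : PhgDouble 𝔣 E T) (hT_infty : TemperedAtInfinity 𝔣 E T)
    (e : AdaptedChart 𝔣.x 𝔣.φ) (e' : SmoothChart b f M) (i : Fin 3) :
    PhgChart E T (leftMono e e' (charts₂ lb lb0 zf i)) := by
  fin_cases i
  · exact PhgChart.congr (hT _ (.left₁ e e'))
      (leftChart_eq e e' (chart₂I lb lb0) (fun _ => rfl) fun _ => rfl)
  · exact PhgChart.congr (hT _ (.left₂ e e'))
      (leftChart_eq e e' (chart₂II zf lb0) (fun _ => rfl) fun _ => rfl)
  · exact PhgChart.congr (hT_infty _ (.left e e'))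
      (leftChart_eq e e' (chart₂L lb) (fun _ => rfl) fun _ => rfl)

theorem right_family (hT : PhgDouble 𝔣 E T) (hT_infty : TemperedAtInfinity 𝔣 E T)
    (e : SmoothChart b f M) (e' : AdaptedChart 𝔣.x 𝔣.φ) (i : Fin 3) :
    PhgChart E T (rightMono e e' (charts₂ rb rb0 zf i)) := by
  fin_cases i
  · exact PhgChart.congr (hT _ (.right₁ e e'))
      (rightChart_eq e e' (chart₂I rb rb0) (fun _ => rfl) fun _ => rfl)
  · exact PhgChart.congr (hT _ (.right₂ e e'))
      (rightChart_eq e e' (chart₂II zf rb0) (fun _ => rfl) fun _ => rfl)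
  · exact PhgChart.congr (hT_infty _ (.right e e'))
      (rightChart_eq e e' (chart₂L rb) (fun _ => rfl) fun _ => rfl)

/-- `x = g 1` and `x' = g 1 * g 2`. -/
theorem corner_family (hT : PhgDouble 𝔣 E T) (hT_infty : TemperedAtInfinity 𝔣 E T)
    (e e' : AdaptedChart 𝔣.x 𝔣.φ) (i : Fin 4) :
    PhgChart E T (cornerMono e e' (fun g => g 1) (fun g => g 1 * g 2)
      (charts₃ bf0 bf rb rb0 zf (selection₃ 0 i))) := by
  fin_cases i
  · exact PhgChart.congr (hT _ (.corner₁ e e'))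
      (cornerChart_eq e e' (chart₃I bf0 bf rb) (fun _ => rfl)
      (fun _ => rfl) (fun _ => rfl) fun _ => rfl)
  · exact PhgChart.congr (hT _ (.corner₃ e e'))
      (cornerChart_eq e e' (chart₃II bf0 rb0 rb) (fun _ => rfl)
      (fun _ => rfl) (fun ρ => mul_assoc (ρ 0) (ρ 1) (ρ 2)) fun _ => rfl)
  · exact PhgChart.congr (hT _ (.corner₅ e e'))
      (cornerChart_eq e e' (chart₃III bf0 rb0 zf) (fun _ => rfl)
      (fun _ => rfl) (fun _ => rfl) fun _ => rfl)
  · exact PhgChart.congr (hT_infty _ (.corner₁ e e'))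
      (cornerChart_eq e e' (chart₃L bf rb) (fun _ => rfl)
      (fun _ => rfl) (fun _ => rfl) fun _ => rfl)

/-- `x' = g 1` and `x = g 1 * g 2`. -/
theorem corner_family' (hT : PhgDouble 𝔣 E T) (hT_infty : TemperedAtInfinity 𝔣 E T)
    (e e' : AdaptedChart 𝔣.x 𝔣.φ) (i : Fin 4) :
    PhgChart E T (cornerMono e e' (fun g => g 1 * g 2) (fun g => g 1)
      (charts₃ bf0 bf lb lb0 zf (selection₃ 0 i))) := by
  fin_cases i
  · exact PhgChart.congr (hT _ (.corner₂ e e'))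
      (cornerChart_eq e e' (chart₃I bf0 bf lb) (fun _ => rfl)
      (fun _ => rfl) (fun _ => rfl) fun _ => rfl)
  · exact PhgChart.congr (hT _ (.corner₄ e e'))
      (cornerChart_eq e e' (chart₃II bf0 lb0 lb) (fun _ => rfl)
      (fun ρ => mul_assoc (ρ 0) (ρ 1) (ρ 2)) (fun _ => rfl) fun _ => rfl)
  · exact PhgChart.congr (hT _ (.corner₆ e e'))
      (cornerChart_eq e e' (chart₃III bf0 lb0 zf) (fun _ => rfl)
      (fun _ => rfl) (fun _ => rfl) fun _ => rfl)
  · exact PhgChart.congr (hT_infty _ (.corner₂ e e'))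
      (cornerChart_eq e e' (chart₃L bf lb) (fun _ => rfl)
      (fun _ => rfl) (fun _ => rfl) fun _ => rfl)

/-- The parameter `θ = w/x` does not involve `k`, so the two-coordinate family applies with `x` as
the boundary variable. -/
theorem phi_family (hT : PhgDouble 𝔣 E T) (hT_infty : TemperedAtInfinity 𝔣 E T)
    (e e' : AdaptedChart 𝔣.x 𝔣.φ) (h : e.base = e'.base) (i : Fin 3) :
    PhgChart E T (diagMono e e' (fun θ : Fin (b + 1) → ℝ => θ) (fun g => g 1) (fun g => g 1)
      (charts₂ sc phif0 zf i)) := by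
  fin_cases i
  · exact PhgChart.congr (hT _ (.phi₁ e e' h))
      (diagChart_eq e e' _ (chart₂I sc phif0) (fun _ => rfl)
      (fun _ => rfl) fun _ => rfl)
  · exact PhgChart.congr (hT _ (.phi₃ e e' h))
      (diagChart_eq e e' _ (chart₂II zf phif0) (fun _ => rfl)
      (fun _ => rfl) fun _ => rfl)
  · exact PhgChart.congr (hT_infty _ (.sc₁ e e' h))
      (diagChart_eq e e' _ (chart₂L sc) (fun _ => rfl)
      (fun _ => rfl) fun _ => rfl)

/-- Here `A = x/r` and `B = r` with `r = |w j|`; these and the direction `w/r` are independent of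
`k`. The choice `selection₃ 1` fits the order in which `sc₂` lists its coordinates. -/
theorem sc_family (hT : PhgDouble 𝔣 E T) (hT_infty : TemperedAtInfinity 𝔣 E T)
    (e e' : AdaptedChart 𝔣.x 𝔣.φ) (h : e.base = e'.base) (j : Fin (b + 1)) (σ : SignType)
    (hσ : σ ≠ 0) (i : Fin 4) :
    PhgChart E T (diagMono e e' (projDir j σ) (fun g => g 1 * g 2) (fun g => g 2)
      (charts₃ bf0 bf sc phif0 zf (selection₃ 1 i))) := by
  fin_cases i
  · exact PhgChart.congr (hT _ (.sc₂ e e' h j σ hσ))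
      (diagChart_eq e e' _ (chart₃I' bf sc bf0)
      (fun _ => rfl) (fun ρ => mul_right_comm (ρ 0) (ρ 1) (ρ 2)) fun _ => rfl)
  · exact PhgChart.congr (hT _ (.phi₂ e e' h j σ hσ))
      (diagChart_eq e e' _ (chart₃II bf0 phif0 sc)
      (fun _ => rfl) (fun ρ => mul_assoc (ρ 0) (ρ 1) (ρ 2)) fun _ => rfl)
  · exact PhgChart.congr (hT _ (.phi₄ e e' h j σ hσ))
      (diagChart_eq e e' _ (chart₃III bf0 phif0 zf)
      (fun _ => rfl) (fun _ => rfl) fun _ => rfl)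
  · exact PhgChart.congr (hT_infty _ (.sc₂ e e' h j σ hσ))
      (diagChart_eq e e' _ (chart₃L bf sc)
      (fun _ => rfl) (fun _ => rfl) fun _ => rfl)

end Ray

end Geometry

/-! ### The exceptional coordinates near the fibre diagonal -/

section Diagonal

variable {b f : ℕ} {M B : Type*}
  [TopologicalSpace M] [ChartedSpace (EuclideanHalfSpace (b + f + 1)) M]
  [TopologicalSpace B] [ChartedSpace (EuclideanSpace ℝ (Fin b)) B]
  {x : M → ℝ} {φ : (𝓡∂ (b + f + 1)).boundary M → B} {E : Face → IndexSet} {u : ℝ × M × M → ℂ}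

open Face

variable (b f) in
/-- The space of the parameters `(θ, y, z, z')`. -/
abbrev DiagV (d : ℕ) : Type := (Fin d → ℝ) × (Fin b → ℝ) × (Fin f → ℝ) × (Fin f → ℝ)

theorem mul_eq_and_smul_tail_eq {w w' : ℝ} {d d' : Fin (b + 1) → ℝ} (h : w • d = w' • d') :
    w * d 0 = w' * d' 0 ∧ w • Fin.tail d = w' • Fin.tail d' :=
  ⟨congrFun h 0, funext fun i => congrFun h i.succ⟩

theorem smul_inv_smul_eq {r : ℝ} (hr : r ≠ 0) (s : ℝ) (θ : Fin (b + 1) → ℝ) :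
    (s * r) • (r⁻¹ • θ) = s • θ := by
  rw [smul_smul, mul_assoc, mul_inv_cancel₀ hr, mul_one]

/-- The coordinates `x/k, k, (k/x) w` in terms of `x/k, k, w/x`. -/
theorem sc₁_phgAt_of_phi₁ (e e' : AdaptedChart x φ)
    (h : PhgChart E u (diagChart e e' ![some sc, some phif0]
        (fun ρ => ρ 1) (fun ρ => ρ 0 * ρ 1) (fun ρ => ρ 0 * ρ 1)
        (fun θ : Fin (b + 1) → ℝ => θ) ∅))
    {S : Set ((Fin 2 → ℝ) × (Fin (b + 1) → ℝ))}
    {q : (Fin 2 → ℝ) × DiagV b f (b + 1)}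
    (hq : q ∈ (diagChart e e' ![some sc, some bf0] (fun ρ => ρ 1) (fun ρ => ρ 0 * ρ 1)
      (fun ρ => ρ 0) (fun θ : Fin (b + 1) → ℝ => θ) S).dom) (hq1 : q.1 1 ≠ 0) :
    (diagChart e e' ![some sc, some bf0] (fun ρ => ρ 1) (fun ρ => ρ 0 * ρ 1)
      (fun ρ => ρ 0) (fun θ : Fin (b + 1) → ℝ => θ) S).PhgAt E u q := by
  set χ : (Fin 2 → ℝ) × DiagV b f (b + 1) →
    (Fin 2 → ℝ) × DiagV b f (b + 1) :=
    fun p => (p.1, (p.1 1)⁻¹ • p.2.1, p.2.2) with hχ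
  obtain ⟨h0, hw, hv, hv', -⟩ := hq
  have hχq : PhgNear (m := 2) (V := DiagV b f (b + 1)) E ![some sc, some phif0]
      (u ∘ (diagChart e e' ![some sc, some phif0] (fun ρ => ρ 1) (fun ρ => ρ 0 * ρ 1)
        (fun ρ => ρ 0 * ρ 1) (fun θ : Fin (b + 1) → ℝ => θ) ∅).param) (χ q) := h (χ q) (by
    obtain ⟨h1, h2⟩ := mul_eq_and_smul_tail_eq (smul_inv_smul_eq hq1 (q.1 0) q.2.1)
    refine ⟨h0, ?_, hv, ?_, fun h => h⟩
    · simp only [hχ, h1]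
      exact hw
    · simp only [hχ, h1, h2]
      exact hv')
  suffices key : PhgNear (m := 2) (V := DiagV b f (b + 1)) E ![some sc, some bf0]
    (u ∘ (diagChart e e' ![some sc, some bf0] (fun ρ => ρ 1)
    (fun ρ => ρ 0 * ρ 1) (fun ρ => ρ 0) (fun θ : Fin (b + 1) → ℝ => θ) S).param) q from key
  -- The linear part keeps the coordinates `ρ`, and `Φ` carries the parameters. Dividing by `k` is
  -- smooth here: `k ≠ 0` at `q`, so `log k` is retained by `posPart`.
  refine PhgNear.comp (χ := χ) (O := univ) hχq ?_
    ((ContinuousLinearMap.fst ℝ _ _).prod 0)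
    (Φ := fun y => (0, Real.exp (-y.1 1) • y.2.1, y.2.2)) isOpen_univ trivial ?_ ?_ ?_ ?_
  · have h1 : ContinuousAt (fun p : (Fin 2 → ℝ) × DiagV b f (b + 1) => (p.1 1)⁻¹) q :=
      ((continuous_apply 1).comp continuous_fst).continuousAt.inv₀ hq1
    exact continuousAt_fst.prodMk ((h1.smul (by fun_prop)).prodMk (by fun_prop))
  · exact ContDiff.contDiffOn (by fun_prop)
  · intro y _
    refine Prod.ext ?_ (Prod.ext ?_ ?_)
    · simp [expMap, hχ]
    · simp [expMap, hχ, posPart_apply_of_ne hq1, Real.exp_neg, posPart_snd]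
    · simp [expMap, hχ, posPart_snd]
  · have h1 : ∀ᶠ p in nhds q, p.1 1 ≠ 0 :=
      ((continuous_apply (1 : Fin 2)).comp continuous_fst).continuousAt.eventually_ne hq1
    filter_upwards [h1] with p hp
    obtain ⟨h1, h2⟩ := mul_eq_and_smul_tail_eq (smul_inv_smul_eq hp (p.1 0) p.2.1)
    simp only [Function.comp_apply, diagChart, hχ, h1, h2]
  · intro i H hi hH
    obtain rfl : i = 0 := by
      by_contra h
      exact hq1 (Fin.eq_one_of_ne_zero i h ▸ hi)
    exact ⟨0, hi, hH, rfl, fun _ => rfl⟩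

theorem projDir_eq {σ : SignType} (hσ : σ ≠ 0) (j : Fin (b + 1)) (θ : Fin (b + 1) → ℝ)
    (hθ : (σ : ℝ) * θ j ≠ 0) :
    projDir j σ (fun i => ((σ : ℝ) * θ j)⁻¹ * θ (j.succAbove i)) = ((σ : ℝ) * θ j)⁻¹ • θ := by
  funext i
  refine Fin.succAboveCases j ?_ (fun i => ?_) i
  · have h1 : (σ : ℝ) * σ = 1 := by
      cases σ <;> simp at hσ ⊢
    have h2 : θ j ≠ 0 := right_ne_zero_of_mul hθ
    have h3 : (σ : ℝ) ≠ 0 := left_ne_zero_of_mul hθ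
    simp only [projDir, Fin.insertNth_apply_same, Pi.smul_apply, smul_eq_mul]
    field_simp
    rw [sq, h1]
  · simp [projDir]

/-- The coordinates `x/k, k, (k/x) w` in terms of `(x/k)/r, r, k, w/r`, where `r = |w j|`. -/
theorem sc₁_phgAt_of_sc₂ (e e' : AdaptedChart x φ) (j : Fin (b + 1)) {σ : SignType} (hσ : σ ≠ 0)
    (h : PhgChart E u (diagChart e e' ![some bf, some sc, some bf0]
        (fun ρ => ρ 2) (fun ρ => ρ 0 * ρ 1 * ρ 2) (fun ρ => ρ 1) (projDir j σ) ∅))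
    {S : Set ((Fin 2 → ℝ) × (Fin (b + 1) → ℝ))}
    {q : (Fin 2 → ℝ) × DiagV b f (b + 1)}
    (hq : q ∈ (diagChart e e' ![some sc, some bf0] (fun ρ => ρ 1) (fun ρ => ρ 0 * ρ 1)
      (fun ρ => ρ 0) (fun θ : Fin (b + 1) → ℝ => θ) S).dom) (hqj : 0 < (σ : ℝ) * q.2.1 j) :
    (diagChart e e' ![some sc, some bf0] (fun ρ => ρ 1) (fun ρ => ρ 0 * ρ 1)
      (fun ρ => ρ 0) (fun θ : Fin (b + 1) → ℝ => θ) S).PhgAt E u q := by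
  set r : (Fin 2 → ℝ) × DiagV b f (b + 1) → ℝ :=
    fun p => (σ : ℝ) * p.2.1 j with hr
  have hrs : ContDiff ℝ ∞ r := by
    rw [hr]
    fun_prop
  -- Since `w = (x/k) θ`, one has `|w j| = (x/k) * r` and `(x/k)/|w j| = r⁻¹`. The latter stays
  -- positive, so the face `bf` of the target chart is not met.
  set χ : (Fin 2 → ℝ) × DiagV b f (b + 1) →
    (Fin 3 → ℝ) × DiagV b f b :=
    fun p => (![(r p)⁻¹, p.1 0 * r p, p.1 1], fun i => (r p)⁻¹ * p.2.1 (j.succAbove i), p.2.2)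
    with hχ
  have hdir : ∀ p, r p ≠ 0 →
      (p.1 0 * r p) • projDir j σ (fun i => (r p)⁻¹ * p.2.1 (j.succAbove i)) = p.1 0 • p.2.1 := by
    intro p hp
    rw [hr, projDir_eq hσ j p.2.1 hp, smul_inv_smul_eq hp]
  have hprod : ∀ p, r p ≠ 0 → (r p)⁻¹ * (p.1 0 * r p) * p.1 1 = p.1 0 * p.1 1 := by
    intro p hp
    field_simp
  obtain ⟨h0, hw, hv, hv', -⟩ := hq
  have hχq : PhgNear (m := 3) (V := DiagV b f b) E ![some bf, some sc, some bf0]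
      (u ∘ (diagChart e e' ![some bf, some sc, some bf0] (fun ρ => ρ 2) (fun ρ => ρ 0 * ρ 1 * ρ 2)
        (fun ρ => ρ 1) (projDir j σ) ∅).param) (χ q) := h (χ q) (by
    obtain ⟨h1, h2⟩ := mul_eq_and_smul_tail_eq (hdir q hqj.ne')
    have h3 := hprod q hqj.ne'
    refine ⟨?_, ?_, ?_, ?_, fun h => h⟩
    · intro i
      fin_cases i
      · exact (inv_pos.2 hqj).le
      · exact mul_nonneg (h0 0) hqj.le
      · exact h0 1
    · change 0 < 1 + (q.1 0 * r q) * projDir j σ _ 0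
      rw [h1]
      exact hw
    · change e.Valid ((r q)⁻¹ * (q.1 0 * r q) * q.1 1) _ _
      rw [h3]
      exact hv
    · change e'.Valid ((r q)⁻¹ * (q.1 0 * r q) * q.1 1 *
        (1 + (q.1 0 * r q) * projDir j σ _ 0)) (_ + (q.1 0 * r q) • Fin.tail (projDir j σ _)) _
      rw [h1, h2, h3]
      exact hv')
  set O : Set ((Fin 2 → ℝ) × DiagV b f (b + 1)) :=
    {y | 0 < r y} with hOdef
  have hO : IsOpen O := isOpen_lt continuous_const hrs.continuous
  set a : Fin 3 → (Fin 2 → ℝ) →L[ℝ] ℝ :=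
    ![0, ContinuousLinearMap.proj (R := ℝ) (φ := fun _ : Fin 2 => ℝ) 0,
      ContinuousLinearMap.proj (R := ℝ) (φ := fun _ : Fin 2 => ℝ) 1] with ha
  have hΦ : ContDiffOn ℝ ∞ (fun y : (Fin 2 → ℝ) × DiagV b f (b + 1) => ((![-Real.log (r y), Real.log (r y), 0] : Fin 3 → ℝ),
        (fun i : Fin b => (r y)⁻¹ * y.2.1 (j.succAbove i)), y.2.2)) O := by
    have hl : ContDiffOn ℝ ∞ (fun y => Real.log (r y)) O :=
      hrs.contDiffOn.log fun y hy => (show 0 < r y from hy).ne'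
    have hi : ContDiffOn ℝ ∞ (fun y => (r y)⁻¹) O :=
      hrs.contDiffOn.inv fun y hy => (show 0 < r y from hy).ne'
    refine ContDiffOn.prodMk (contDiffOn_pi.2 fun i => ?_)
      (ContDiffOn.prodMk (contDiffOn_pi.2 fun i => hi.mul ?_) ?_)
    · fin_cases i
      · exact hl.neg
      · exact hl
      · exact contDiffOn_const
    · exact ContDiff.contDiffOn (by fun_prop)
    · exact ContDiff.contDiffOn (by fun_prop)
  suffices key : PhgNear (m := 2) (V := DiagV b f (b + 1)) E ![some sc, some bf0]
    (u ∘ (diagChart e e' ![some sc, some bf0] (fun ρ => ρ 1)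
    (fun ρ => ρ 0 * ρ 1) (fun ρ => ρ 0) (fun θ : Fin (b + 1) → ℝ => θ) S).param) q from key
  refine PhgNear.comp (χ := χ) hχq ?_
    (((ContinuousLinearMap.pi a).comp (ContinuousLinearMap.fst ℝ _ _)).prod 0) hO
    (show 0 < r (logPt q) from hqj) hΦ ?_ ?_ ?_
  · have hrc := hrs.continuous.continuousAt (x := q)
    have hi : ContinuousAt (fun p => (r p)⁻¹) q := hrc.inv₀ hqj.ne'
    refine ContinuousAt.prodMk (continuousAt_pi.2 fun i => ?_)
      (ContinuousAt.prodMk (continuousAt_pi.2 fun i => hi.mul (by fun_prop)) (by fun_prop))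
    fin_cases i
    · exact hi
    · exact ContinuousAt.mul (by fun_prop) hrc
    · exact ((continuous_apply (1 : Fin 2)).comp continuous_fst).continuousAt
  · intro y hy
    have hy' : 0 < r y := hy
    refine Prod.ext (funext fun l => ?_) (Prod.ext ?_ ?_)
    · fin_cases l
      · change Real.exp (0 + -Real.log (r y)) = (r y)⁻¹
        rw [zero_add, Real.exp_neg, Real.exp_log hy']
      · change Real.exp (y.1 0 + Real.log (r y)) = Real.exp (y.1 0) * r y
        rw [Real.exp_add, Real.exp_log hy']
      · change Real.exp (y.1 1 + 0) = Real.exp (y.1 1)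
        rw [add_zero]
    · exact zero_add _
    · exact zero_add _
  · have h1 : ∀ᶠ p in nhds q, 0 < r p := hrs.continuous.continuousAt.eventually (lt_mem_nhds hqj)
    filter_upwards [h1] with p hp
    obtain ⟨h1, h2⟩ := mul_eq_and_smul_tail_eq (hdir p hp.ne')
    have h3 := hprod p hp.ne'
    change u (p.1 1, e.pt (p.1 0 * p.1 1) _ _, e'.pt (p.1 0 * p.1 1 * (1 + p.1 0 * p.2.1 0))
      (p.2.2.1 + p.1 0 • Fin.tail p.2.1) _) = u (p.1 1, e.pt ((r p)⁻¹ * (p.1 0 * r p) * p.1 1) _ _,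
        e'.pt ((r p)⁻¹ * (p.1 0 * r p) * p.1 1 *
        (1 + (p.1 0 * r p) * projDir j σ _ 0)) (p.2.2.1 + (p.1 0 * r p) • Fin.tail (projDir j σ _)) _)
    rw [h1, h2, h3]
  · intro i H hi hH
    refine ⟨i.succ, ?_, ?_, ?_, fun y => ?_⟩
    · fin_cases i
      · exact mul_eq_zero_of_left hi _
      · exact hi
    · fin_cases i <;> exact hH
    · fin_cases i
      · refine Prod.ext (funext fun l => ?_) rfl
        fin_cases l <;> simp [ei, ha]
      · refine Prod.ext (funext fun l => ?_) rfl
        fin_cases l <;> simp [ei, ha]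
    · fin_cases i <;> rfl

/-- The set `{k = 0, θ = 0}` being removed, either `θ = 0` and `k > 0`, where `phi₁` can be used, or
some `θ j ≠ 0`, where `sc₂` can be used with the sign of `θ j`. This avoids rays in a chart whose
parameter moves with `k`. -/
theorem phgChart_sc₁ (e e' : AdaptedChart x φ)
    (hphi : PhgChart E u (diagChart e e' ![some sc, some phif0]
        (fun ρ => ρ 1) (fun ρ => ρ 0 * ρ 1) (fun ρ => ρ 0 * ρ 1)
        (fun θ : Fin (b + 1) → ℝ => θ) ∅))
    (hsc : ∀ (j : Fin (b + 1)) (σ : SignType), σ ≠ 0 →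
      PhgChart E u (diagChart e e' ![some bf, some sc, some bf0]
        (fun ρ => ρ 2) (fun ρ => ρ 0 * ρ 1 * ρ 2) (fun ρ => ρ 1) (projDir j σ) ∅)) :
    PhgChart E u (diagChart e e' ![some sc, some bf0]
        (fun ρ => ρ 1) (fun ρ => ρ 0 * ρ 1) (fun ρ => ρ 0)
        (fun θ : Fin (b + 1) → ℝ => θ) {q | q.1 1 = 0 ∧ q.2 = 0}) := by
  intro q hq
  by_cases hθ : q.2.1 = 0
  · exact sc₁_phgAt_of_phi₁ e e' hphi hq fun h => hq.2.2.2.2 ⟨h, hθ⟩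
  · obtain ⟨j, hj⟩ := Function.ne_iff.1 hθ
    have hj' : q.2.1 j ≠ 0 := hj
    refine sc₁_phgAt_of_sc₂ e e' j (σ := SignType.sign (q.2.1 j)) (by simpa using hj')
      (hsc j _ (by simpa using hj')) hq ?_
    rw [sign_mul_self]
    exact abs_pos.2 hj'

end Diagonal

/-! ### Assembly over the atlas, and convergence at interior points -/

section Conclusion

variable {b f : ℕ} {M B : Type*}
  [TopologicalSpace M] [ChartedSpace (EuclideanHalfSpace (b + f + 1)) M]
  [TopologicalSpace B] [ChartedSpace (EuclideanSpace ℝ (Fin b)) B]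
  {𝔣 : FibredBoundary b f M B} {E : Face → IndexSet} {θ : ℝ} {T : ℝ × M × M → ℂ}

open Face

/-- Each chart other than `sc₁` belongs to a family that also contains the large `k` charts with the
same quantities besides `k`, so rays never leave the family. -/
theorem phgDouble_rayFun (hθ₁ : Real.pi / 2 < θ) (hθ₂ : θ < Real.pi) (hT : PhgDouble 𝔣 E T)
    (hT_infty : TemperedAtInfinity 𝔣 E T) : PhgDouble 𝔣 E (rayFun θ T) := by
  have hint : ∀ e e', PhgChart E (rayFun θ T) (interiorMono e e' (chart₁I zf)) := fun e e' =>
    (family₁ hθ₁ hθ₂ (fun _ _ _ => rfl) (fun _ _ _ => rfl) (interior_family hT hT_infty e e')).1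
  have hleft : ∀ e e' i, i ≠ 2 → PhgChart E (rayFun θ T) (leftMono e e' (charts₂ lb lb0 zf i)) :=
    fun e e' => family₂ hθ₁ hθ₂ (fun g g' h => by simp only [h 1 one_ne_zero])
      (fun g g' h => by simp only [h 1 one_ne_zero]) (left_family hT hT_infty e e')
  have hright : ∀ e e' i, i ≠ 2 → PhgChart E (rayFun θ T) (rightMono e e' (charts₂ rb rb0 zf i)) :=
    fun e e' => family₂ hθ₁ hθ₂ (fun g g' h => by simp only [h 1 one_ne_zero])
      (fun g g' h => by simp only [h 1 one_ne_zero]) (right_family hT hT_infty e e')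
  have hcorner : ∀ e e' i, i ≠ 4 → PhgChart E (rayFun θ T) (cornerMono e e' (fun g => g 1)
      (fun g => g 1 * g 2) (charts₃ bf0 bf rb rb0 zf i)) :=
    fun e e' => family₃ hθ₁ hθ₂ (.inl rfl)
      (fun g g' h => by simp only [h 1 one_ne_zero, h 2 two_ne_zero])
      (fun g g' h => by simp only [h 1 one_ne_zero, h 2 two_ne_zero])
      (corner_family hT hT_infty e e')
  have hcorner' : ∀ e e' i, i ≠ 4 → PhgChart E (rayFun θ T) (cornerMono e e'
      (fun g => g 1 * g 2) (fun g => g 1) (charts₃ bf0 bf lb lb0 zf i)) :=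
    fun e e' => family₃ hθ₁ hθ₂ (.inl rfl)
      (fun g g' h => by simp only [h 1 one_ne_zero, h 2 two_ne_zero])
      (fun g g' h => by simp only [h 1 one_ne_zero, h 2 two_ne_zero])
      (corner_family' hT hT_infty e e')
  have hphi : ∀ (e e' : AdaptedChart 𝔣.x 𝔣.φ), e.base = e'.base → ∀ i, i ≠ 2 →
      PhgChart E (rayFun θ T) (diagMono e e' (fun θ : Fin (b + 1) → ℝ => θ) (fun g => g 1)
        (fun g => g 1) (charts₂ sc phif0 zf i)) :=
    fun e e' h => family₂ hθ₁ hθ₂ (fun g g' h => by simp only [h 1 one_ne_zero])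
      (fun g g' h => by simp only [h 1 one_ne_zero]) (phi_family hT hT_infty e e' h)
  have hsc : ∀ (e e' : AdaptedChart 𝔣.x 𝔣.φ), e.base = e'.base → ∀ (j : Fin (b + 1))
      (σ : SignType), σ ≠ 0 → ∀ i, i ≠ 4 → PhgChart E (rayFun θ T) (diagMono e e' (projDir j σ)
        (fun g => g 1 * g 2) (fun g => g 2) (charts₃ bf0 bf sc phif0 zf i)) :=
    fun e e' h j σ hσ => family₃ hθ₁ hθ₂ (.inr rfl)
      (fun g g' h => by simp only [h 1 one_ne_zero, h 2 two_ne_zero])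
      (fun g g' h => by simp only [h 1 one_ne_zero, h 2 two_ne_zero])
      (sc_family hT hT_infty e e' h j σ hσ)
  have hphi₁ := fun (e e' : AdaptedChart 𝔣.x 𝔣.φ) (h : e.base = e'.base) =>
    (hphi e e' h 0 (by decide)).congr (diagChart_eq (kf := fun ρ => ρ 1)
      (xf := fun ρ => ρ 0 * ρ 1) (wf := fun ρ => ρ 0 * ρ 1) e e' _ (chart₂I sc phif0)
      (fun _ => rfl) (fun _ => rfl) fun _ => rfl).symm
  have hsc₂ := fun (e e' : AdaptedChart 𝔣.x 𝔣.φ) (h : e.base = e'.base) j σ hσ =>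
    (hsc e e' h j σ hσ 1 (by decide)).congr (diagChart_eq (kf := fun ρ => ρ 2)
      (xf := fun ρ => ρ 0 * ρ 1 * ρ 2) (wf := fun ρ => ρ 1) e e' _ (chart₃I' bf sc bf0)
      (fun _ => rfl) (fun ρ => mul_right_comm (ρ 0) (ρ 1) (ρ 2)) fun _ => rfl).symm
  rintro _ (⟨e, e'⟩ | ⟨e, e'⟩ | ⟨e, e'⟩ | ⟨e, e'⟩ | ⟨e, e'⟩ | ⟨e, e'⟩ | ⟨e, e'⟩ | ⟨e, e'⟩ |
    ⟨e, e'⟩ | ⟨e, e'⟩ | ⟨e, e'⟩ | ⟨e, e', h⟩ | ⟨e, e', h, j, σ, hσ⟩ | ⟨e, e', h⟩ |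
    ⟨e, e', h, j, σ, hσ⟩ | ⟨e, e', h⟩ | ⟨e, e', h, j, σ, hσ⟩)
  · exact (hint e e').congr (interiorChart_eq e e' (chart₁I zf) fun _ => rfl).symm
  · exact (hleft e e' 0 (by decide)).congr
      (leftChart_eq e e' (chart₂I lb lb0) (fun _ => rfl) fun _ => rfl).symm
  · exact (hleft e e' 1 (by decide)).congr
      (leftChart_eq e e' (chart₂II zf lb0) (fun _ => rfl) fun _ => rfl).symm
  · exact (hright e e' 0 (by decide)).congr
      (rightChart_eq e e' (chart₂I rb rb0) (fun _ => rfl) fun _ => rfl).symm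
  · exact (hright e e' 1 (by decide)).congr
      (rightChart_eq e e' (chart₂II zf rb0) (fun _ => rfl) fun _ => rfl).symm
  · exact (hcorner e e' 0 (by decide)).congr (cornerChart_eq e e' (chart₃I bf0 bf rb)
      (fun _ => rfl) (fun _ => rfl) (fun _ => rfl) fun _ => rfl).symm
  · exact (hcorner' e e' 0 (by decide)).congr (cornerChart_eq e e' (chart₃I bf0 bf lb)
      (fun _ => rfl) (fun _ => rfl) (fun _ => rfl) fun _ => rfl).symm
  · exact (hcorner e e' 2 (by decide)).congr (cornerChart_eq e e' (chart₃II bf0 rb0 rb)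
      (fun _ => rfl) (fun _ => rfl) (fun ρ => mul_assoc (ρ 0) (ρ 1) (ρ 2)) fun _ => rfl).symm
  · exact (hcorner' e e' 2 (by decide)).congr (cornerChart_eq e e' (chart₃II bf0 lb0 lb)
      (fun _ => rfl) (fun ρ => mul_assoc (ρ 0) (ρ 1) (ρ 2)) (fun _ => rfl) fun _ => rfl).symm
  · exact (hcorner e e' 3 (by decide)).congr (cornerChart_eq e e' (chart₃III bf0 rb0 zf)
      (fun _ => rfl) (fun _ => rfl) (fun _ => rfl) fun _ => rfl).symm
  · exact (hcorner' e e' 3 (by decide)).congr (cornerChart_eq e e' (chart₃III bf0 lb0 zf)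
      (fun _ => rfl) (fun _ => rfl) (fun _ => rfl) fun _ => rfl).symm
  · exact phgChart_sc₁ e e' (hphi₁ e e' h) (hsc₂ e e' h)
  · exact hsc₂ e e' h j σ hσ
  · exact hphi₁ e e' h
  · exact (hsc e e' h j σ hσ 2 (by decide)).congr (diagChart_eq e e' _ (chart₃II bf0 phif0 sc)
      (fun _ => rfl) (fun ρ => mul_assoc (ρ 0) (ρ 1) (ρ 2)) fun _ => rfl).symm
  · exact (hphi e e' h 1 (by decide)).congr (diagChart_eq e e' _ (chart₂II zf phif0)
      (fun _ => rfl) (fun _ => rfl) fun _ => rfl).symm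
  · exact (hsc e e' h j σ hσ 3 (by decide)).congr (diagChart_eq e e' _ (chart₃III bf0 phif0 zf)
      (fun _ => rfl) (fun _ => rfl) fun _ => rfl).symm

/-- Every interior point lies in the domain of a chart. -/
theorem exists_smoothChart [IsManifold (𝓡∂ (b + f + 1)) ∞ M] {p : M}
    (hp : p ∈ (𝓡∂ (b + f + 1)).interior M) :
    ∃ (e : SmoothChart b f M) (v : EuclideanSpace ℝ (Fin (b + f + 1))), e.Valid v ∧ e.pt v = p := by
  refine ⟨⟨chartAt _ p, IsManifold.chart_mem_maximalAtlas p⟩, extChartAt (𝓡∂ (b + f + 1)) p p,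
    ⟨mem_extChartAt_target p, ?_⟩, extChartAt_to_inv p⟩
  have h : extChartAt (𝓡∂ (b + f + 1)) p p ∈ interior (range (𝓡∂ (b + f + 1))) := hp
  rwa [interior_range_modelWithCornersEuclideanHalfSpace] at h

theorem mem_linBall_chart₁I {V Face : Type} [NormedAddCommGroup V] [NormedSpace ℝ V] (fz : Face)
    {s ε : ℝ} (hs : 0 < s) (hε : 0 < ε) (v : V) :
    ((fun _ => Real.log s, v) : (Fin 1 → ℝ) × V) ∈
      linBall ((chart₁I fz).L : (Fin 1 → ℝ) →L[ℝ] (Fin 1 → ℝ)) (fun _ => s, v) ε := by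
  have h : expMap (prodL V ((chart₁I fz).L : (Fin 1 → ℝ) →L[ℝ] (Fin 1 → ℝ))
      ((fun _ => Real.log s, v) : (Fin 1 → ℝ) × V)) = (fun _ => s, v) := by
    refine Prod.ext (funext fun l => ?_) rfl
    simp [expMap, chart₁I, Real.exp_log hs]
  rw [mem_linBall, mem_logBall, h]
  exact Metric.mem_ball_self hε

theorem integrableOn_rayIntegrand [IsManifold (𝓡∂ (b + f + 1)) ∞ M] (hθ₁ : Real.pi / 2 < θ)
    (hθ₂ : θ < Real.pi) (hT : PhgDouble 𝔣 E T) (hT_infty : TemperedAtInfinity 𝔣 E T) {s : ℝ}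
    (hs : 0 < s) {p p' : M} (hp : p ∈ (𝓡∂ (b + f + 1)).interior M)
    (hp' : p' ∈ (𝓡∂ (b + f + 1)).interior M) :
    IntegrableOn (rayIntegrand θ T s p p') (Ioi s) := by
  obtain ⟨e, v, hv, rfl⟩ := exists_smoothChart hp
  obtain ⟨e', v', hv', rfl⟩ := exists_smoothChart hp'
  obtain ⟨ε, hε, h⟩ := (family₁ hθ₁ hθ₂ (fun _ _ _ => rfl) (fun _ _ _ => rfl)
    (interior_family hT hT_infty e e')).2 (fun _ => s, v, v') ⟨fun _ => hs.le, hv, hv'⟩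
  -- Convergence is known at all points of a ball around `(s, p, p')`; it is used at the centre.
  have h1 := h (fun _ => Real.log s, v, v') (mem_linBall_chart₁I zf hs hε _)
  simpa only [Real.exp_log hs] using h1

end Conclusion

end PhiGeometry

end

open scoped Manifold ContDiff in
open PhiGeometry in
theorem lemma3p3 {b f : ℕ} {M B : Type*}
    [TopologicalSpace M] [T2Space M] [CompactSpace M]
    [ChartedSpace (EuclideanHalfSpace (b + f + 1)) M] [IsManifold (𝓡∂ (b + f + 1)) ∞ M]
    [TopologicalSpace B] [T2Space B]
    [ChartedSpace (EuclideanSpace ℝ (Fin b)) B] [IsManifold (𝓡 b) ∞ B]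
    (𝔣 : FibredBoundary b f M B)
    (θ : ℝ) (hθ₁ : Real.pi / 2 < θ) (hθ₂ : θ < Real.pi)
    (T : ℝ × M × M → ℂ) (E : Face → IndexSet)
    (hT : PhgDouble 𝔣 E T) (hT_infty : TemperedAtInfinity 𝔣 E T)
    (hlb : (E Face.lb).carrier = ∅) (hrb : (E Face.rb).carrier = ∅)
    (hbf : (E Face.bf).carrier = ∅) :
    (∀ s : ℝ, 0 < s → ∀ p p' : M,
      p ∈ (𝓡∂ (b + f + 1)).interior M → p' ∈ (𝓡∂ (b + f + 1)).interior M →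
        MeasureTheory.IntegrableOn (rayIntegrand θ T s p p') (Set.Ioi s)) ∧
    ∃ E' : Face → IndexSet, PhgDouble 𝔣 E'
      (fun q : ℝ × M × M => ∫ k in Set.Ioi q.1, rayIntegrand θ T q.1 q.2.1 q.2.2 k) :=
  ⟨fun _ hs _ _ hp hp' => integrableOn_rayIntegrand hθ₁ hθ₂ hT hT_infty hs hp hp',
    E, phgDouble_rayFun hθ₁ hθ₂ hT hT_infty⟩
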